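/- **Setting.** A participant has potential outcomes $Y(0),Y(1)\in\mathbb R$, potential treatment decisions $D(0),D(1)\in\{0,1\}$ and covariates $Z\in\mathcal Z$, with joint distribution $Q$; strata are $S=S(Z)$ for a function $S:\mathcal Z\to\mathcal S$ with $\mathcal S$ finite. Let $C=\{D(0)=0,D(1)=1\}$, $AT=\{D(0)=D(1)=1\}$, $NT=\{D(0)=D(1)=0\}$, $p(s)=P(S=s)$, $\pi_a(s)=P(D(a)=1\mid S=s)$ for $a\in\{0,1\}$, $\beta=E[Y(1)-Y(0)\mid C]$ and $\beta(s)=E[Y(1)-Y(0)\mid C,S=s]$. Abbreviate $m^C_d(s)=E[Y(d)|C,S=s]$, $v^C_d(s)=V[Y(d)|C,S=s]$, $m^{AT}(s),v^{AT}(s)$ the mean and variance of $Y(1)$ given $AT,S=s$, and $m^{NT}(s),v^{NT}(s)$ those of $Y(0)$ given $NT,S=s$ (set to $0$ if the conditioning event is null). An RCT of size $n$ on $Q$ consists of $W^{(n)}=(Y_i(1),Y_i(0),D_i(0),D_i(1),Z_i)_{i\le n}$, i.i.d. from $Q$, and assignments $A^{(n)}\in\{0,1\}^n$; one observes $A_i$,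 $S_i=S(Z_i)$, $D_i=D_i(A_i)$, $Y_i=Y_i(D_i)$. Let $n(s)=\#\{S_i=s\}$, $n_A(s)=\#\{A_i=1,S_i=s\}$, $n_D(s)=\#\{D_i=1,S_i=s\}$, $n_{AD}(s)=\#\{A_i=D_i=1,S_i=s\}$. *Assumption 1* (on $Q,S$): $E[Y(d)^2]<\infty$; $p(s)>0$ for all $s$; $P(D(0)=1,D(1)=0)=0$; $\pi_1(s)>\pi_0(s)$ for all $s$. *Assumption 2* (propensities $\pi_A(s)\in(0,1)$): $W^{(n)}\perp A^{(n)}\mid S^{(n)}$ and $n_A(s)/n(s)\to_p\pi_A(s)$ for all $s$. *Assumption 3* (constant $\pi_A\in(0,1)$, $\tau(s)\in[0,1]$): $W^{(n)}\perp A^{(n)}\mid S^{(n)}$, and the conditional laws of $\{\sqrt n(n_A(s)/n(s)-\pi_A)\}_{s}$ given $S^{(n)}$ converge weakly, in probability, to $N(0,\mathrm{diag}\{\tau(s)\pi_A(1-\pi_A)/p(s)\})$. *Estimators.* With $(\mathbf Z'\mathbf X)^{-1}\mathbf Z'\mathbf Y$ denoting the linear IV estimator, the SAT regression has $X_i=(\{I\{S_i=s\}\}_s,\{D_iI\{S_i=s\}\}_s)$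 and $Z_i$ the same with $A_i$ for $D_i$, giving coefficients $\hat\gamma(s),\hat\beta(s)$. Put $\hat p(s)=\frac{n(s)}n$, $\hat\pi_1(s)=\frac{n_{AD}(s)}{n_A(s)}$, $\hat\pi_0(s)=\frac{n_D(s)-n_{AD}(s)}{n(s)-n_A(s)}$; the SAT estimator of $\beta$ is $\hat\beta_{sat}=\sum_s\frac{\hat p(s)(\hat\pi_1(s)-\hat\pi_0(s))}{\sum_{t}\hat p(t)(\hat\pi_1(t)-\hat\pi_0(t))}\hat\beta(s)$. The SFE estimator is the coefficient on $D_i$ with $X_i=(\{I\{S_i=s\}\}_s,D_i)$, $Z_i=(\{I\{S_i=s\}\}_s,A_i)$; the 2S estimator is the one with $X_i=(1,D_i)$, $Z_i=(1,A_i)$. An estimator $b_n$ has asymptotic variance $V\ge0$ if $\sqrt n(b_n-\beta)\to_dN(0,V)$. *Formulas.* Omitting the argument $s$ (where $\beta_s=\beta(s)$), let $$Y_1=v^{AT}\pi_0+v^{NT}(1-\pi_1)+v^C_1(\pi_1-\pi_0)+(m^C_1-m^{AT})^2\tfrac{\pi_0(\pi_1-\pi_0)}{\pi_1},$$ $$Y_0=v^{AT}\pi_0+v^{NT}(1-\pi_1)+v^C_0(\pi_1-\pi_0)+(m^C_0-m^{NT})^2\tfrac{(1-\pi_1)(\pi_1-\pi_0)}{1-\pi_0},$$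 $$B_1=-\pi_0(m^C_1-m^{AT})+\pi_1(m^C_0-m^{NT})+\pi_1(\beta_s-\beta),$$ $$B_0=-(1-\pi_0)(m^C_1-m^{AT})+(1-\pi_1)(m^C_0-m^{NT})+(1-\pi_0)(\beta_s-\beta),$$ $$\Pi_1=Y_1+\tfrac{1-\pi_1}{\pi_1}B_1^2,\qquad \Pi_2=Y_0+\tfrac{\pi_0}{1-\pi_0}B_0^2.$$ With $P(C)=\sum_sp(s)(\pi_1(s)-\pi_0(s))$, let $$V_{sat}(\pi_A)=\tfrac1{P(C)^2}\sum_sp(s)\Big[\tfrac{Y_1}{\pi_A(s)}+\tfrac{Y_0}{1-\pi_A(s)}+\tfrac{(1-\pi_1)B_1^2}{\pi_A(s)\pi_1}+\tfrac{\pi_0B_0^2}{(1-\pi_A(s))(1-\pi_0)}+(\pi_1-\pi_0)^2(\beta_s-\beta)^2\Big].$$ **Theorem.** Let $Q,S$ satisfy Assumption 1. 1. In every RCT satisfying Assumption 2 with propensities $\{\pi_A(s)\}$, the SAT IV estimator has asymptotic variance $V_{sat}(\pi_A)$. If $\Pi_1(s)>0$ and $\Pi_2(s)>0$ for all $s$,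 then $$\pi_A^*(s)=\Big(1+\sqrt{\Pi_2(s)/\Pi_1(s)}\Big)^{-1},\qquad s\in\mathcal S,$$ lies in $(0,1)^{\mathcal S}$ and is the unique minimizer of $V_{sat}$ over $(0,1)^{\mathcal S}$. 2. In every RCT satisfying Assumption 3 with constant propensity $\pi_A$ and $\tau(s)=0$ for all $s$, the SAT, SFE and 2S IV estimators all have asymptotic variance $V_{sat}(\pi_A,\dots,\pi_A)$. If $\sum_sp(s)\Pi_1(s)>0$ and $\sum_sp(s)\Pi_2(s)>0$, then $$\pi_A^*=\Big(1+\sqrt{\tfrac{\sum_sp(s)\Pi_2(s)}{\sum_sp(s)\Pi_1(s)}}\Big)^{-1}$$ lies in $(0,1)$ and is the unique minimizer of $\pi_A\mapsto V_{sat}(\pi_A,\dots,\pi_A)$ over $(0,1)$. 3. Given data of a pilot RCT on $Q$ with strata function $S$ satisfying Assumption 2 for some propensities, let $\hat\pi_A^*(s)$ and $\hat\pi_A^*$ be obtained by replacing $p,\pi_1,\pi_0,\beta_s,\beta$ by $\hat p,\hat\pi_1,\hat\pi_0,\hat\beta(s),\hat\beta_{sat}$ and the means and variances by the estimators below. As the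 pilot sample size tends to infinity, $\hat\pi_A^*(s)\to_p\pi_A^*(s)$ for every $s$ with $\Pi_1(s)>0$, and $\hat\pi_A^*\to_p\pi_A^*$ if $\sum_sp(s)\Pi_1(s)>0$. The estimators in 3 use the residuals $\hat u_i=Y_i-\hat\gamma(S_i)-D_i\hat\beta(S_i)$ and $M^b_{da}=\frac1n\sum_iI\{D_i=d,A_i=a,S_i=s\}\hat u_i^b$; they are (omitting $s$, with $\hat\beta=\hat\beta(s)$ and $\hat\gamma=\hat\gamma(s)$) $$\hat m^{NT}=\tfrac{n/2}{n_A-n_{AD}}(M^1_{01}-M^1_{11})+\hat\gamma,\quad \hat m^{AT}=\tfrac{n/2}{n_D-n_{AD}}(M^1_{10}-M^1_{00})+\hat\beta+\hat\gamma,$$ $$\hat m^C_0=\tfrac{\hat\gamma+\hat\pi_0\hat\beta-(1-\hat\pi_1)\hat m^{NT}-\hat\pi_0\hat m^{AT}}{\hat\pi_1-\hat\pi_0},\quad \hat m_1^C=\hat\beta+\hat m_0^C,$$ and, with $G=(1-\hat\pi_0)(\hat m_1^C-\hat m^{AT})-(1-\hat\pi_1)(\hat m_0^C-\hat m^{NT})$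 and $H=\hat\pi_0(\hat m_1^C-\hat m^{AT})-\hat\pi_1(\hat m_0^C-\hat m^{NT})$, $$\hat v^{AT}=\tfrac{M^2_{10}}{\frac{n(s)}n(1-\frac{n_A}{n(s)})\hat\pi_0}-G^2,\quad \hat v^{NT}=\tfrac{n}{n_A-n_{AD}}M^2_{01}-H^2,$$ $$\hat v^C_1=\tfrac1{\hat\pi_1-\hat\pi_0}\Big[\tfrac n{n_A}M^2_{11}-\tfrac{(1-\hat\pi_1)^2}{\hat\pi_1}H^2-\tfrac{\hat\pi_0(\hat\pi_1-\hat\pi_0)}{\hat\pi_1}(\hat m_1^C-\hat m^{AT})^2-\hat\pi_0\hat v^{AT}\Big],$$ $$\hat v^C_0=\tfrac1{\hat\pi_1-\hat\pi_0}\Big[\tfrac n{n(s)-n_A}M^2_{00}-\tfrac{\hat\pi_0^2}{1-\hat\pi_0}G^2-\tfrac{(1-\hat\pi_1)(\hat\pi_1-\hat\pi_0)}{1-\hat\pi_0}(\hat m_0^C-\hat m^{NT})^2-(1-\hat\pi_1)\hat v^{NT}\Big].$$ In these estimators a quotient with denominator $0$, the inverse of a singular matrix, and the square root of a negative number are read as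 $0$. -/

import Mathlib

open MeasureTheory ProbabilityTheory Filter Topology Matrix

universe u v w

noncomputable section

namespace LATE

/-! ### Population: potential outcomes, strata, primitive parameters -/

/-- A participant `w`: potential outcomes `w.1 d = Y(d)`, potential treatment decisions
`w.2.1 a = D(a)` and baseline covariates `w.2.2 = Z`, where `true` stands for `1` and
`false` for `0`. -/
abbrev Participant (𝒵 : Type u) : Type u := (Bool → ℝ) × (Bool → Bool) × 𝒵

section Population

variable {𝒵 : Type u} [MeasurableSpace 𝒵] {𝒮 : Type w}

/-- The event `S(Z) = s`. -/
def stratum (S : 𝒵 → 𝒮) (s : 𝒮) : Set (Participant 𝒵) := {w | S w.2.2 = s}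

def compliers : Set (Participant 𝒵) := {w | w.2.1 false = false ∧ w.2.1 true = true}

def alwaysTakers : Set (Participant 𝒵) := {w | w.2.1 false = true ∧ w.2.1 true = true}

def neverTakers : Set (Participant 𝒵) := {w | w.2.1 false = false ∧ w.2.1 true = false}

def defiers : Set (Participant 𝒵) := {w | w.2.1 false = true ∧ w.2.1 true = false}

/-- `E[f | E]`; it is `0` if the event `E` is null. -/
def condMean (Q : Measure (Participant 𝒵)) (f : Participant 𝒵 → ℝ)
    (E : Set (Participant 𝒵)) : ℝ :=
  ∫ w, f w ∂(cond Q E)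

/-- `V[f | E]`; it is `0` if the event `E` is null. -/
def condVariance (Q : Measure (Participant 𝒵)) (f : Participant 𝒵 → ℝ)
    (E : Set (Participant 𝒵)) : ℝ :=
  variance f (cond Q E)

/-- `π_{D(a)}(s) = P(D(a) = 1 | S = s)`. -/
def piD (Q : Measure (Participant 𝒵)) (S : 𝒵 → 𝒮) (a : Bool) (s : 𝒮) : ℝ :=
  (cond Q (stratum S s)).real {w | w.2.1 a = true}

/-- The LATE, `β = E[Y(1) - Y(0) | C]`. -/
def late (Q : Measure (Participant 𝒵)) : ℝ :=
  condMean Q (fun w => w.1 true - w.1 false) compliers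

/-- Assumptions on the distribution `Q` of one participant and the strata function `S`. -/
structure Assumption1 (Q : Measure (Participant 𝒵)) (S : 𝒵 → 𝒮) : Prop where
  second_moment : ∀ d, MemLp (fun w : Participant 𝒵 => w.1 d) 2 Q
  stratum_pos : ∀ s, 0 < Q.real (stratum S s)
  no_defiers : Q defiers = 0
  compliers_pos : ∀ s, 0 < piD Q S true s - piD Q S false s

end Population

/-- The primitive parameters of one stratum. -/
structure Primitives where
  /-- `p(s)` -/
  p : ℝ
  /-- `π_{D(1)}(s)` -/
  piD1 : ℝ
  /-- `π_{D(0)}(s)` -/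
  piD0 : ℝ
  /-- `E[Y(1) | C, S = s]` -/
  meanY1C : ℝ
  /-- `E[Y(0) | C, S = s]` -/
  meanY0C : ℝ
  /-- `E[Y(1) | AT, S = s]` -/
  meanY1AT : ℝ
  /-- `E[Y(0) | NT, S = s]` -/
  meanY0NT : ℝ
  /-- `V[Y(1) | C, S = s]` -/
  varY1C : ℝ
  /-- `V[Y(0) | C, S = s]` -/
  varY0C : ℝ
  /-- `V[Y(1) | AT, S = s]` -/
  varY1AT : ℝ
  /-- `V[Y(0) | NT, S = s]` -/
  varY0NT : ℝ
  /-- `β(s) = E[Y(1) - Y(0) | C, S = s]` -/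
  beta : ℝ

/-- The true primitive parameters of stratum `s`. -/
def primitives {𝒵 : Type u} [MeasurableSpace 𝒵] {𝒮 : Type w}
    (Q : Measure (Participant 𝒵)) (S : 𝒵 → 𝒮) (s : 𝒮) : Primitives where
  p := Q.real (stratum S s)
  piD1 := piD Q S true s
  piD0 := piD Q S false s
  meanY1C := condMean Q (fun w => w.1 true) (compliers ∩ stratum S s)
  meanY0C := condMean Q (fun w => w.1 false) (compliers ∩ stratum S s)
  meanY1AT := condMean Q (fun w => w.1 true) (alwaysTakers ∩ stratum S s)
  meanY0NT := condMean Q (fun w => w.1 false) (neverTakers ∩ stratum S s)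
  varY1C := condVariance Q (fun w => w.1 true) (compliers ∩ stratum S s)
  varY0C := condVariance Q (fun w => w.1 false) (compliers ∩ stratum S s)
  varY1AT := condVariance Q (fun w => w.1 true) (alwaysTakers ∩ stratum S s)
  varY0NT := condVariance Q (fun w => w.1 false) (neverTakers ∩ stratum S s)
  beta := condMean Q (fun w => w.1 true - w.1 false) (compliers ∩ stratum S s)

/-! ### The asymptotic variance formula and the optimal propensities -/

section Formulas

variable {𝒮 : Type w} [Fintype 𝒮]

/-- `P(C) = ∑ p(s) (π_{D(1)}(s) - π_{D(0)}(s))`. -/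
def probC (θ : 𝒮 → Primitives) : ℝ := ∑ s, (θ s).p * ((θ s).piD1 - (θ s).piD0)

def VY1 (θ : 𝒮 → Primitives) (pA : 𝒮 → ℝ) : ℝ :=
  1 / probC θ ^ 2 * ∑ s, (θ s).p / pA s *
    ((θ s).varY1AT * (θ s).piD0 + (θ s).varY0NT * (1 - (θ s).piD1)
      + (θ s).varY1C * ((θ s).piD1 - (θ s).piD0)
      + ((θ s).meanY1C - (θ s).meanY1AT) ^ 2 *
          ((θ s).piD0 * ((θ s).piD1 - (θ s).piD0) / (θ s).piD1))

def VY0 (θ : 𝒮 → Primitives) (pA : 𝒮 → ℝ) : ℝ :=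
  1 / probC θ ^ 2 * ∑ s, (θ s).p / (1 - pA s) *
    ((θ s).varY1AT * (θ s).piD0 + (θ s).varY0NT * (1 - (θ s).piD1)
      + (θ s).varY0C * ((θ s).piD1 - (θ s).piD0)
      + ((θ s).meanY0C - (θ s).meanY0NT) ^ 2 *
          ((1 - (θ s).piD1) * ((θ s).piD1 - (θ s).piD0) / (1 - (θ s).piD0)))

def VD1 (θ : 𝒮 → Primitives) (β : ℝ) (pA : 𝒮 → ℝ) : ℝ :=
  1 / probC θ ^ 2 * ∑ s, (θ s).p * (1 - (θ s).piD1) / (pA s * (θ s).piD1) *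
    (-(θ s).piD0 * ((θ s).meanY1C - (θ s).meanY1AT)
      + (θ s).piD1 * ((θ s).meanY0C - (θ s).meanY0NT)
      + (θ s).piD1 * ((θ s).beta - β)) ^ 2

def VD0 (θ : 𝒮 → Primitives) (β : ℝ) (pA : 𝒮 → ℝ) : ℝ :=
  1 / probC θ ^ 2 * ∑ s, (θ s).p * (θ s).piD0 / ((1 - pA s) * (1 - (θ s).piD0)) *
    (-(1 - (θ s).piD0) * ((θ s).meanY1C - (θ s).meanY1AT)
      + (1 - (θ s).piD1) * ((θ s).meanY0C - (θ s).meanY0NT)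
      + (1 - (θ s).piD0) * ((θ s).beta - β)) ^ 2

def VH (θ : 𝒮 → Primitives) (β : ℝ) : ℝ :=
  1 / probC θ ^ 2 * ∑ s, (θ s).p * ((θ s).piD1 - (θ s).piD0) ^ 2 * ((θ s).beta - β) ^ 2

/-- `V_sat` as a function of the primitives, the LATE and the propensity vector `pA`. -/
def Vsat (θ : 𝒮 → Primitives) (β : ℝ) (pA : 𝒮 → ℝ) : ℝ :=
  VY1 θ pA + VY0 θ pA + VD1 θ β pA + VD0 θ β pA + VH θ β

/-- `Π₁(s)`. -/
def Pi1 (t : Primitives) (β : ℝ) : ℝ :=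
  (t.varY1AT * t.piD0 + t.varY0NT * (1 - t.piD1) + t.varY1C * (t.piD1 - t.piD0)
      + (t.meanY1C - t.meanY1AT) ^ 2 * (t.piD0 * (t.piD1 - t.piD0) / t.piD1))
    + (1 - t.piD1) / t.piD1 *
      (-t.piD0 * (t.meanY1C - t.meanY1AT) + t.piD1 * (t.meanY0C - t.meanY0NT)
        + t.piD1 * (t.beta - β)) ^ 2

/-- `Π₂(s)`. -/
def Pi2 (t : Primitives) (β : ℝ) : ℝ :=
  (t.varY1AT * t.piD0 + t.varY0NT * (1 - t.piD1) + t.varY0C * (t.piD1 - t.piD0)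
      + (t.meanY0C - t.meanY0NT) ^ 2 *
          ((1 - t.piD1) * (t.piD1 - t.piD0) / (1 - t.piD0)))
    + t.piD0 / (1 - t.piD0) *
      (-(1 - t.piD0) * (t.meanY1C - t.meanY1AT) + (1 - t.piD1) * (t.meanY0C - t.meanY0NT)
        + (1 - t.piD0) * (t.beta - β)) ^ 2

/-- `π_A^*(s) = (1 + √(Π₂(s) / Π₁(s)))⁻¹`. -/
def optPropensity (t : Primitives) (β : ℝ) : ℝ :=
  (1 + √(Pi2 t β / Pi1 t β))⁻¹

/-- `π_A^* = (1 + √(∑ p(s) Π₂(s) / ∑ p(s) Π₁(s)))⁻¹`. -/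
def optConstPropensity (θ : 𝒮 → Primitives) (β : ℝ) : ℝ :=
  (1 + √((∑ s, (θ s).p * Pi2 (θ s) β) / ∑ s, (θ s).p * Pi1 (θ s) β))⁻¹

end Formulas

/-! ### Observed samples and estimators -/

/-- Observed data of `n` participants: outcome, treatment decision, treatment assignment,
stratum. -/
structure Sample (𝒮 : Type w) (n : ℕ) where
  Y : Fin n → ℝ
  D : Fin n → Bool
  A : Fin n → Bool
  S : Fin n → 𝒮

/-- The `0`-`1` value of a treatment variable. -/
def toReal (b : Bool) : ℝ := if b = true then 1 else 0

/-- The linear IV estimator `(Z' X)⁻¹ (Z' Y)`. -/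
def ivEstimator {n : ℕ} {k : Type*} [Fintype k] [DecidableEq k]
    (Z X : Matrix (Fin n) k ℝ) (Y : Fin n → ℝ) : k → ℝ :=
  (Zᵀ * X)⁻¹ *ᵥ (Zᵀ *ᵥ Y)

/-- Regressors `(1, V_i)` of the two sample regression. -/
def matTwoS {n : ℕ} (V : Fin n → Bool) : Matrix (Fin n) (Unit ⊕ Unit) ℝ :=
  Matrix.of fun i => Sum.elim (fun _ => 1) (fun _ => toReal (V i))

namespace Sample

variable {𝒮 : Type w} [Fintype 𝒮] [DecidableEq 𝒮] {n : ℕ} (x : Sample 𝒮 n)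

/-- `I{S_i = s}`. -/
def indS (i : Fin n) (s : 𝒮) : ℝ := if x.S i = s then 1 else 0

/-- `n(s)`. -/
def nS (s : 𝒮) : ℝ := ∑ i, x.indS i s

/-- `n_A(s)`. -/
def nA (s : 𝒮) : ℝ := ∑ i, toReal (x.A i) * x.indS i s

/-- `n_D(s)`. -/
def nD (s : 𝒮) : ℝ := ∑ i, toReal (x.D i) * x.indS i s

/-- `n_AD(s)`. -/
def nAD (s : 𝒮) : ℝ := ∑ i, toReal (x.A i) * toReal (x.D i) * x.indS i s

/-- Regressors `({I{S_i = s}}_s, {V_i I{S_i = s}}_s)` of the fully saturated regression. -/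
def matSat (V : Fin n → Bool) : Matrix (Fin n) (𝒮 ⊕ 𝒮) ℝ :=
  Matrix.of fun i => Sum.elim (fun s => x.indS i s) (fun s => toReal (V i) * x.indS i s)

/-- Regressors `({I{S_i = s}}_s, V_i)` of the strata fixed effects regression. -/
def matSfe (V : Fin n → Bool) : Matrix (Fin n) (𝒮 ⊕ Unit) ℝ :=
  Matrix.of fun i => Sum.elim (fun s => x.indS i s) (fun _ => toReal (V i))

/-- SAT IV estimator of the coefficient on `I{S_i = s}`. -/
def gammaSat (s : 𝒮) : ℝ := ivEstimator (x.matSat x.A) (x.matSat x.D) x.Y (Sum.inl s)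

/-- SAT IV estimator of the coefficient on `D_i I{S_i = s}`. -/
def betaSatStratum (s : 𝒮) : ℝ :=
  ivEstimator (x.matSat x.A) (x.matSat x.D) x.Y (Sum.inr s)

/-- Estimator `n_AD(s) / n_A(s)` of `π_{D(1)}(s)`. -/
def piD1Hat (s : 𝒮) : ℝ := x.nAD s / x.nA s

/-- Estimator `(n_D(s) - n_AD(s)) / (n(s) - n_A(s))` of `π_{D(0)}(s)`. -/
def piD0Hat (s : 𝒮) : ℝ := (x.nD s - x.nAD s) / (x.nS s - x.nA s)

/-- Estimator of `P(S = s, C)`. -/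
def probSCHat (s : 𝒮) : ℝ := x.nS s / n * (x.piD1Hat s - x.piD0Hat s)

/-- Estimator of `P(C)`. -/
def probCHat : ℝ := ∑ s, x.probSCHat s

/-- SAT IV estimator of the LATE. -/
def betaSat : ℝ := ∑ s, x.probSCHat s / x.probCHat * x.betaSatStratum s

/-- SFE IV estimator of the LATE. -/
def betaSfe : ℝ := ivEstimator (x.matSfe x.A) (x.matSfe x.D) x.Y (Sum.inr ())

/-- 2S IV estimator of the LATE. -/
def betaTwoS : ℝ := ivEstimator (matTwoS x.A) (matTwoS x.D) x.Y (Sum.inr ())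

/-- SAT IV regression residuals. -/
def resid (i : Fin n) : ℝ :=
  x.Y i - ∑ s, x.indS i s * x.gammaSat s - ∑ s, toReal (x.D i) * x.indS i s * x.betaSatStratum s

/-- `(1/n) ∑ I{D_i = d, A_i = a, S_i = s} û_i ^ b`. -/
def residMoment (b : ℕ) (d a : Bool) (s : 𝒮) : ℝ :=
  1 / n * ∑ i, if x.D i = d ∧ x.A i = a ∧ x.S i = s then x.resid i ^ b else 0

def meanY0NTHat (s : 𝒮) : ℝ :=
  n / 2 / (x.nA s - x.nAD s) * (x.residMoment 1 false true s - x.residMoment 1 true true s)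
    + x.gammaSat s

def meanY1ATHat (s : 𝒮) : ℝ :=
  n / 2 / (x.nD s - x.nAD s) * (x.residMoment 1 true false s - x.residMoment 1 false false s)
    + x.betaSatStratum s + x.gammaSat s

def meanY0CHat (s : 𝒮) : ℝ :=
  1 / (x.piD1Hat s - x.piD0Hat s) *
    (x.gammaSat s + x.piD0Hat s * x.betaSatStratum s
      - (1 - x.piD1Hat s) * x.meanY0NTHat s - x.piD0Hat s * x.meanY1ATHat s)

def meanY1CHat (s : 𝒮) : ℝ := x.betaSatStratum s + x.meanY0CHat s

def varY1ATHat (s : 𝒮) : ℝ :=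
  1 / (x.nS s / n * (1 - x.nA s / x.nS s) * x.piD0Hat s) * x.residMoment 2 true false s
    - ((1 - x.piD0Hat s) * (x.meanY1CHat s - x.meanY1ATHat s)
        - (1 - x.piD1Hat s) * (x.meanY0CHat s - x.meanY0NTHat s)) ^ 2

def varY0NTHat (s : 𝒮) : ℝ :=
  n / (x.nA s - x.nAD s) * x.residMoment 2 false true s
    - (x.piD0Hat s * (x.meanY1CHat s - x.meanY1ATHat s)
        - x.piD1Hat s * (x.meanY0CHat s - x.meanY0NTHat s)) ^ 2

def varY1CHat (s : 𝒮) : ℝ :=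
  1 / (x.piD1Hat s - x.piD0Hat s) *
    (n / x.nA s * x.residMoment 2 true true s
      - (1 - x.piD1Hat s) ^ 2 / x.piD1Hat s *
          (x.piD0Hat s * (x.meanY1CHat s - x.meanY1ATHat s)
            - x.piD1Hat s * (x.meanY0CHat s - x.meanY0NTHat s)) ^ 2
      - x.piD0Hat s * (x.piD1Hat s - x.piD0Hat s) / x.piD1Hat s *
          (x.meanY1CHat s - x.meanY1ATHat s) ^ 2
      - x.piD0Hat s * x.varY1ATHat s)

def varY0CHat (s : 𝒮) : ℝ :=
  1 / (x.piD1Hat s - x.piD0Hat s) *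
    (n / (x.nS s - x.nA s) * x.residMoment 2 false false s
      - x.piD0Hat s ^ 2 / (1 - x.piD0Hat s) *
          ((1 - x.piD0Hat s) * (x.meanY1CHat s - x.meanY1ATHat s)
            - (1 - x.piD1Hat s) * (x.meanY0CHat s - x.meanY0NTHat s)) ^ 2
      - (x.nA s - x.nAD s) / x.nA s * (x.piD1Hat s - x.piD0Hat s) / (1 - x.piD0Hat s) *
          (x.meanY0CHat s - x.meanY0NTHat s) ^ 2
      - (1 - x.piD1Hat s) * x.varY0NTHat s)

/-- The estimated primitive parameters of stratum `s`. -/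
def primitivesHat (s : 𝒮) : Primitives where
  p := x.nS s / n
  piD1 := x.piD1Hat s
  piD0 := x.piD0Hat s
  meanY1C := x.meanY1CHat s
  meanY0C := x.meanY0CHat s
  meanY1AT := x.meanY1ATHat s
  meanY0NT := x.meanY0NTHat s
  varY1C := x.varY1CHat s
  varY0C := x.varY0CHat s
  varY1AT := x.varY1ATHat s
  varY0NT := x.varY0NTHat s
  beta := x.betaSatStratum s

/-- Plug-in estimator of the optimal propensity in stratum `s`. -/
def optPropensityHat (s : 𝒮) : ℝ := optPropensity (x.primitivesHat s) x.betaSat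

/-- Plug-in estimator of the optimal constant propensity. -/
def optConstPropensityHat : ℝ := optConstPropensity x.primitivesHat x.betaSat

end Sample

/-! ### Randomized controlled trials with covariate-adaptive randomization -/

/-- RCTs of every sample size `n` on the population `Q`: the underlying variables `W^{(n)}` are
`n` i.i.d. draws from `Q`, and `A^{(n)}` are the treatment assignments. -/
structure Trial {𝒵 : Type u} [MeasurableSpace 𝒵] (Q : Measure (Participant 𝒵)) where
  Ω : Type v
  [measurableSpace : MeasurableSpace Ω]
  P : Measure Ω
  [isProbabilityMeasure : IsProbabilityMeasure P]
  W : (n : ℕ) → Ω → Fin n → Participant 𝒵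
  A : (n : ℕ) → Ω → Fin n → Bool
  measurable_W : ∀ n, Measurable (W n)
  measurable_A : ∀ n, Measurable (A n)
  iid : ∀ n, P.map (W n) = Measure.pi fun _ => Q

attribute [instance] Trial.measurableSpace Trial.isProbabilityMeasure

section Trials

variable {𝒵 : Type u} [MeasurableSpace 𝒵] {Q : Measure (Participant 𝒵)}
  {𝒮 : Type w} [Fintype 𝒮] [DecidableEq 𝒮]

/-- The strata `S^{(n)}`. -/
def Trial.strata (T : Trial.{u, v} Q) (S : 𝒵 → 𝒮) (n : ℕ) (ω : T.Ω) : Fin n → 𝒮 :=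
  fun i => S (T.W n ω i).2.2

/-- The observed data, with `D_i = D_i(A_i)` and `Y_i = Y_i(D_i)`. -/
def Trial.sample (T : Trial.{u, v} Q) (S : 𝒵 → 𝒮) (n : ℕ) (ω : T.Ω) : Sample 𝒮 n where
  Y i := (T.W n ω i).1 ((T.W n ω i).2.1 (T.A n ω i))
  D i := (T.W n ω i).2.1 (T.A n ω i)
  A i := T.A n ω i
  S i := T.strata S n ω i

/-- `W^{(n)} ⊥ A^{(n)} | S^{(n)}`: independence under `P(· | S^{(n)} = σ)` for every `σ`. -/
def Trial.CondIndep (T : Trial.{u, v} Q) (S : 𝒵 → 𝒮) : Prop :=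
  ∀ (n : ℕ) (σ : Fin n → 𝒮), IndepFun (T.W n) (T.A n) (cond T.P {ω | T.strata S n ω = σ})

/-- `{X_n | S^{(n)}} →d ν` with probability approaching one: the conditional laws of `X_n` given
`S^{(n)}` converge weakly to `ν`, in probability. -/
def Trial.CondTendsto (T : Trial.{u, v} Q) (S : 𝒵 → 𝒮) {k : Type*} [Fintype k]
    (X : ℕ → T.Ω → k → ℝ) (ν : Measure (k → ℝ)) : Prop :=
  ∀ f : BoundedContinuousFunction (k → ℝ) ℝ,
    TendstoInMeasure T.P
      (fun n ω => ∫ ω', f (X n ω') ∂(cond T.P {ω' | T.strata S n ω' = T.strata S n ω}))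
      atTop (fun _ => ∫ y, f y ∂ν)

/-- Assumptions on the treatment assignment mechanism with target propensities `pA`. -/
structure Assumption2 (T : Trial.{u, v} Q) (S : 𝒵 → 𝒮) (pA : 𝒮 → ℝ) : Prop where
  condIndep : T.CondIndep S
  pA_mem : ∀ s, pA s ∈ Set.Ioo (0 : ℝ) 1
  propensity : ∀ s, TendstoInMeasure T.P
    (fun n ω => (T.sample S n ω).nA s / (T.sample S n ω).nS s) atTop (fun _ => pA s)

/-- Strengthened assumptions on the treatment assignment mechanism with constant target
propensity `pA` and imbalance parameters `τ`. The normal law `N(0, Σ_A)`, whose covariance matrix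
is diagonal, is written as a product of normal laws. -/
structure Assumption3 (T : Trial.{u, v} Q) (S : 𝒵 → 𝒮) (pA : ℝ) (τ : 𝒮 → ℝ) : Prop where
  condIndep : T.CondIndep S
  τ_mem : ∀ s, τ s ∈ Set.Icc (0 : ℝ) 1
  normal : T.CondTendsto S
    (fun n ω s => √n * ((T.sample S n ω).nA s / (T.sample S n ω).nS s - pA))
    (Measure.pi fun s =>
      gaussianReal 0 (τ s * pA * (1 - pA) / Q.real (stratum S s)).toNNReal)
  pA_mem : pA ∈ Set.Ioo (0 : ℝ) 1

/-- The estimator `b` of `β` has asymptotic variance `V`: `√n (b - β) →d N(0, V)`. -/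
def Trial.HasAsymptoticVariance (T : Trial.{u, v} Q) (S : 𝒵 → 𝒮)
    (b : (n : ℕ) → Sample 𝒮 n → ℝ) (β V : ℝ) : Prop :=
  0 ≤ V ∧ TendstoInDistribution (fun (n : ℕ) ω => √n * (b n (T.sample S n ω) - β)) atTop
    (id : ℝ → ℝ) (fun _ => T.P) (gaussianReal 0 V.toNNReal)

end Trials

end LATE

end

set_option linter.unusedSectionVars false

noncomputable section
namespace LATE

/-! ### Convergence in probability as convergence along a filter -/

/-! Everything is expressed through the net outcome R(a) = Y(D(a)) - β D(a), with β the LATE. Let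
μ_a(s) and σ²_a(s) be its mean and variance given S = s. Without defiers, always-takers and
never-takers have the same net outcome under both assignments, so only compliers contribute to
μ_1(s) - μ_0(s) = (π_1(s) - π_0(s)) (β(s) - β) (`Assumption1.netMean_sub`), and these differences
average to zero over the strata (`Assumption1.sum_late_eq_zero`). Mixing the three compliance types
gives Π_1(s) = σ²_1(s) and Π_2(s) = σ²_0(s) (`Assumption1.Pi_primitives`). Hence P(C)² V_sat is the
sum of p(s) [σ²_1/π_A + σ²_0/(1 - π_A) + (μ_1 - μ_0)²], and the optimal propensities come from
minimizing a/x + b/(1 - x), which is done by completing a square (`variance_lt_of_ne_optimum`).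

For the asymptotic variances, each IV estimator is a ratio of the sums of v_a(s) Ȳ_a(s) and of
v_a(s) D̄_a(s), where Ȳ_a(s), D̄_a(s) are the means over the cell A = a, S = s. The weights satisfy
v_a(s) = ± k n(s)/n + o_p(n^{-1/2}) with a constant k: exactly for SAT, and because τ = 0 forces √n
(n_A(s)/n(s) - π_A) → 0 for SFE and 2S (`Assumption3.strongBalance`). An exact linearization
(`sqrt_mul_ratio_sub_late`) and Slutsky's theorem then reduce all three cases to one limit
(`hasAsymptoticVariance_of_contrast`).

That limit is the central limit theorem `tendstoInDistribution_sum_assigned`. Given the strata, the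
participants are independent with laws Q(· | S = s) and independent of the assignments. A
characteristic function therefore becomes the expectation of a product of conditional characteristic
functions, one for each participant. Replacing each factor by a Gaussian one costs o(1/n), so o(1)
altogether. The resulting product depends only on the cell frequencies, which converge in
probability, so it can be pulled out of the expectation. What is left is the i.i.d. sum of the
strata scores. The weak law `tendsto_average_assigned` follows in the same way.

For the plug-in estimators, the long formulas collapse: on a regular sample Π_1 and Π_2 at the
estimated primitives are exactly the empirical variances of Y - β̂ D in the two cells of the stratum
(`Sample.Regular.Pi1_primitivesHat`, `Sample.Regular.Pi2_primitivesHat`). Consistency then follows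
from the weak law and continuity. -/

/-- The filter of the sets `E` of pairs `(n, ω)` whose sections have probability tending to one. -/
def probFilter {Ω : Type*} [MeasurableSpace Ω] (P : Measure Ω) : Filter (ℕ × Ω) where
  sets := {E | Tendsto (fun n => P {ω | (n, ω) ∉ E}) atTop (𝓝 0)}
  univ_sets := by simp
  sets_of_superset := by
    intro E F hE hEF
    refine tendsto_of_tendsto_of_tendsto_of_le_of_le tendsto_const_nhds hE (fun _ => zero_le) ?_
    exact fun n => measure_mono fun ω hω h => hω (hEF h)
  inter_sets := by
    intro E F hE hF
    have h := Tendsto.add hE hF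
    rw [add_zero] at h
    refine tendsto_of_tendsto_of_tendsto_of_le_of_le tendsto_const_nhds h (fun _ => zero_le) ?_
    intro n
    refine (measure_mono ?_).trans (measure_union_le _ _)
    intro ω hω
    by_cases h : (n, ω) ∈ E
    · exact Or.inr fun h' => hω ⟨h, h'⟩
    · exact Or.inl h

section ProbFilter

variable {Ω : Type*} [MeasurableSpace Ω] {P : Measure Ω}

lemma eventually_probFilter {p : ℕ × Ω → Prop} :
    (∀ᶠ z in probFilter P, p z) ↔ Tendsto (fun n => P {ω | ¬ p (n, ω)}) atTop (𝓝 0) :=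
  Iff.rfl

/-- This makes the calculus of `Tendsto` (sums, quotients, continuous maps, changes on an eventually
full event) available for limits in probability. -/
lemma tendsto_probFilter_iff {X : ℕ → Ω → ℝ} {c : ℝ} :
    Tendsto (fun z : ℕ × Ω => X z.1 z.2) (probFilter P) (𝓝 c) ↔
      TendstoInMeasure P X atTop (fun _ => c) := by
  rw [tendstoInMeasure_iff_dist, Metric.tendsto_nhds]
  refine forall₂_congr fun ε hε => ?_
  rw [eventually_probFilter]
  simp only [not_lt]

lemma tendsto_fst_probFilter : Tendsto Prod.fst (probFilter P) atTop := by
  refine tendsto_atTop.2 fun b => ?_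
  rw [eventually_probFilter]
  refine tendsto_const_nhds.congr' ?_
  filter_upwards [eventually_ge_atTop b] with n hn
  simp [hn]

/-- Markov's inequality for the truncated distance; truncation makes the criterion independent of
any moments. -/
lemma tendsto_probFilter_of_integral_min [IsFiniteMeasure P] {X : ℕ → Ω → ℝ} {c : ℝ}
    (hX : ∀ n, Measurable (X n))
    (h : Tendsto (fun n => ∫ ω, min 1 |X n ω - c| ∂P) atTop (𝓝 0)) :
    Tendsto (fun z : ℕ × Ω => X z.1 z.2) (probFilter P) (𝓝 c) := by
  rw [tendsto_probFilter_iff, tendstoInMeasure_iff_measureReal_dist]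
  intro ε hε
  have h' := h.const_mul (min 1 ε)⁻¹
  rw [mul_zero] at h'
  refine squeeze_zero (fun _ => measureReal_nonneg) (fun n => ?_) h'
  have hε' : 0 < min 1 ε := lt_min one_pos hε
  rw [← div_eq_inv_mul, le_div_iff₀' hε']
  have hi : Integrable (fun ω => min 1 |X n ω - c|) P := by
    refine Integrable.of_bound (C := 1) ?_ (ae_of_all _ fun ω => ?_)
    · have := hX n
      exact (measurable_const.min (by fun_prop)).aestronglyMeasurable
    · rw [Real.norm_eq_abs, abs_of_nonneg (le_min zero_le_one (abs_nonneg _))]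
      exact min_le_left _ _
  refine le_trans ?_ (mul_meas_ge_le_integral_of_nonneg
    (ae_of_all _ fun ω => le_min zero_le_one (abs_nonneg _)) hi (min 1 ε))
  refine mul_le_mul_of_nonneg_left (measureReal_mono fun ω hω => ?_) hε'.le
  exact le_min (min_le_left _ _) ((min_le_right _ _).trans (show ε ≤ dist (X n ω) c from hω))

/-- Weak convergence to a point mass, tested against the bounded continuous function min(1, |x -
c|). -/
lemma tendsto_probFilter_of_tendstoInDistribution [IsProbabilityMeasure P] {Ω' : Type*}
    [MeasurableSpace Ω'] {P' : Measure Ω'} [IsProbabilityMeasure P'] {X : ℕ → Ω → ℝ} {c : ℝ}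
    (hX : ∀ n, Measurable (X n))
    (h : TendstoInDistribution X atTop (fun _ : Ω' => c) (fun _ => P) P') :
    Tendsto (fun z : ℕ × Ω => X z.1 z.2) (probFilter P) (𝓝 c) := by
  refine tendsto_probFilter_of_integral_min hX ?_
  let f : BoundedContinuousFunction ℝ ℝ :=
    BoundedContinuousFunction.ofNormedAddCommGroup (fun x => min 1 |x - c|) (by fun_prop) 1
      (fun x => by
        rw [Real.norm_eq_abs, abs_of_nonneg (le_min zero_le_one (abs_nonneg _))]
        exact min_le_left _ _)
  have := (ProbabilityMeasure.tendsto_iff_forall_integral_tendsto.1 h.tendsto) f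
  simp only [ProbabilityMeasure.coe_mk] at this
  rw [integral_map (by fun_prop) (by fun_prop)] at this
  have h0 : ∫ _ : Ω', f c ∂P' = 0 := by simp [f]
  rw [h0] at this
  refine this.congr fun n => ?_
  rw [integral_map (hX n).aemeasurable (by fun_prop)]
  rfl

/-- A bounded factor that converges in probability can be pulled out of an expectation: the
difference is at most E‖B - c‖, which is split at ε/2. Nothing is assumed about convergence of the
other factor. -/
lemma tendsto_integral_mul_sub_of_probFilter [IsProbabilityMeasure P] {G B : ℕ → Ω → ℂ} {c : ℂ}
    (hG : ∀ n, AEStronglyMeasurable (G n) P) (hB : ∀ n, AEStronglyMeasurable (B n) P)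
    (hG1 : ∀ n ω, ‖G n ω‖ ≤ 1) (hB1 : ∀ n ω, ‖B n ω‖ ≤ 1)
    (h : Tendsto (fun z : ℕ × Ω => B z.1 z.2) (probFilter P) (𝓝 c)) :
    Tendsto (fun n => ∫ ω, G n ω * B n ω ∂P - c * ∫ ω, G n ω ∂P) atTop (𝓝 0) := by
  have key : ∀ n, ‖∫ ω, G n ω * B n ω ∂P - c * ∫ ω, G n ω ∂P‖ ≤ ∫ ω, ‖B n ω - c‖ ∂P := by
    intro n
    have hGi : Integrable (G n) P := Integrable.of_bound (hG n) 1 (ae_of_all _ (hG1 n))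
    have hGBi : Integrable (fun ω => G n ω * B n ω) P :=
      Integrable.of_bound ((hG n).mul (hB n)) 1 (ae_of_all _ fun ω => by
        rw [norm_mul]
        exact mul_le_one₀ (hG1 n ω) (norm_nonneg _) (hB1 n ω))
    rw [← integral_const_mul, ← integral_sub hGBi (hGi.const_mul c)]
    refine norm_integral_le_of_norm_le ?_ (ae_of_all _ fun ω => ?_)
    · exact ((Integrable.of_bound (hB n) 1 (ae_of_all _ (hB1 n))).sub (integrable_const c)).norm
    · rw [mul_comm c, ← mul_sub, norm_mul]
      exact mul_le_of_le_one_left (norm_nonneg _) (hG1 n ω)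
  refine squeeze_zero_norm key ?_
  have hd : TendstoInMeasure P (fun n ω => ‖B n ω - c‖) atTop (fun _ => 0) := by
    refine tendsto_probFilter_iff.1 ?_
    have := (h.sub_const c).norm
    simpa using this
  have hint : ∀ n, Integrable (fun ω => ‖B n ω - c‖) P := fun n =>
    ((Integrable.of_bound (hB n) 1 (ae_of_all _ (hB1 n))).sub (integrable_const c)).norm
  have hbd : ∀ n ω, ‖B n ω - c‖ ≤ 1 + ‖c‖ := fun n ω =>
    (norm_sub_le _ _).trans (by gcongr; exact hB1 n ω)
  rw [Metric.tendsto_nhds]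
  intro ε hε
  rw [tendstoInMeasure_iff_measureReal_dist] at hd
  have h2 := (hd (ε / 2) (by positivity)).const_mul (1 + ‖c‖)
  rw [mul_zero] at h2
  filter_upwards [h2.eventually_lt_const (half_pos hε)] with n hn
  rw [Real.dist_eq, sub_zero, abs_of_nonneg (integral_nonneg fun _ => norm_nonneg _)]
  have hms : NullMeasurableSet {ω | ε / 2 ≤ ‖B n ω - c‖} P :=
    nullMeasurableSet_le aemeasurable_const (hint n).aestronglyMeasurable.aemeasurable
  have hle : ∀ ω, ‖B n ω - c‖ ≤
      ε / 2 + {ω | ε / 2 ≤ ‖B n ω - c‖}.indicator (fun _ => 1 + ‖c‖) ω := by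
    intro ω
    by_cases hω : ε / 2 ≤ ‖B n ω - c‖
    · rw [Set.indicator_of_mem (by exact hω)]
      linarith [hbd n ω]
    · rw [Set.indicator_of_notMem (by exact hω)]
      linarith
  have hii : Integrable ({ω | ε / 2 ≤ ‖B n ω - c‖}.indicator (fun _ => 1 + ‖c‖)) P :=
    (integrable_const _).indicator₀ hms
  calc ∫ ω, ‖B n ω - c‖ ∂P
      ≤ ∫ ω, (ε / 2 + {ω | ε / 2 ≤ ‖B n ω - c‖}.indicator (fun _ => 1 + ‖c‖) ω) ∂P :=
        integral_mono (hint n) ((integrable_const _).add hii) hle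
    _ = ε / 2 + (1 + ‖c‖) * P.real {ω | ε / 2 ≤ ‖B n ω - c‖} := by
        rw [integral_add (integrable_const _) hii, integral_indicator₀ hms]
        simp [mul_comm]
    _ < ε := by
        simp only [Real.dist_eq, sub_zero, abs_norm] at hn
        linarith

end ProbFilter

/-! ### Characteristic functions -/

/-- Telescoping. It turns an o(1/n) error for each participant into an o(1) error for the product of
n factors. -/
lemma norm_prod_sub_prod_le {ι : Type*} (s : Finset ι) (a b : ι → ℂ) (ha : ∀ i, ‖a i‖ ≤ 1)
    (hb : ∀ i, ‖b i‖ ≤ 1) : ‖∏ i ∈ s, a i - ∏ i ∈ s, b i‖ ≤ ∑ i ∈ s, ‖a i - b i‖ := by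
  classical
  induction s using Finset.induction_on with
  | empty => simp
  | insert i s hi ih =>
    rw [Finset.prod_insert hi, Finset.prod_insert hi, Finset.sum_insert hi]
    have h1 : a i * ∏ j ∈ s, a j - b i * ∏ j ∈ s, b j
        = (a i - b i) * ∏ j ∈ s, a j + b i * (∏ j ∈ s, a j - ∏ j ∈ s, b j) := by ring
    rw [h1]
    refine (norm_add_le _ _).trans (add_le_add ?_ ?_)
    · rw [norm_mul, norm_prod]
      exact mul_le_of_le_one_right (norm_nonneg _)
        (Finset.prod_le_one (fun _ _ => norm_nonneg _) fun j _ => ha j)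
    · rw [norm_mul]
      exact (mul_le_of_le_one_left (norm_nonneg _) (hb i)).trans ih

lemma norm_cexp_ofReal_mul_I_le (x : ℝ) : ‖Complex.exp (x * Complex.I)‖ ≤ 1 :=
  (Complex.norm_exp_ofReal_mul_I x).le

lemma norm_cexp_neg_ofReal_le {x : ℝ} (hx : 0 ≤ x) : ‖Complex.exp (-(x : ℂ))‖ ≤ 1 := by
  rw [← Complex.ofReal_neg, Complex.norm_exp_ofReal]
  simpa using hx

/-! ### Taylor expansions of characteristic functions at the scales 1/n and 1/√n. -/

section Taylor

variable {Ω : Type*} [MeasurableSpace Ω] {κ : Measure Ω} {X : Ω → ℝ}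

lemma integral_cexp_eq_charFun (hX : AEMeasurable X κ) (t : ℝ) :
    ∫ w, Complex.exp (((t * X w : ℝ) : ℂ) * Complex.I) ∂κ = charFun (κ.map X) t := by
  rw [charFun_apply_real, integral_map hX (by fun_prop)]
  simp

variable [IsProbabilityMeasure κ]

/-- Both functions equal 1 + i u E[X] up to o(u). Comparing with an exponential instead of the
Taylor polynomial keeps the factors in the unit disc, as `norm_prod_sub_prod_le` needs. -/
lemma charFun_sub_exp_isLittleO_one (hX : Integrable X κ) :
    (fun u : ℝ => charFun (κ.map X) u - Complex.exp (((u * ∫ w, X w ∂κ : ℝ) : ℂ) * Complex.I))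
      =o[𝓝 0] fun u => u := by
  have hm := hX.aemeasurable
  have : IsProbabilityMeasure (κ.map X) := Measure.isProbabilityMeasure_map hm
  have hL : MemLp id ((1 : ℕ) : ENNReal) (κ.map X) := by
    rw [Nat.cast_one, memLp_one_iff_integrable]
    exact (integrable_map_measure (by fun_prop) hm).2 (by simpa using hX)
  have h1 := taylor_isLittleO_univ (contDiff_charFun hL) (x₀ := (0 : ℝ))
  have hd : HasDerivAt
      (fun u : ℝ => Complex.exp (((u * ∫ w, X w ∂κ : ℝ) : ℂ) * Complex.I))
      ((∫ w, X w ∂κ : ℝ) * Complex.I) 0 := by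
    have h0 : HasDerivAt (fun u : ℝ => ((u * ∫ w, X w ∂κ : ℝ) : ℂ) * Complex.I)
        (((1 * ∫ w, X w ∂κ : ℝ) : ℂ) * Complex.I) 0 :=
      (((hasDerivAt_id (0 : ℝ)).mul_const _).ofReal_comp).mul_const _
    simpa using h0.cexp
  simp only [pow_one] at h1
  have h3 := h1.sub hd.isLittleO
  simp only [sub_zero] at h3
  have hmid : ∫ x, x ∂(κ.map X) = ∫ w, X w ∂κ := integral_map hm (by fun_prop)
  refine (Asymptotics.IsLittleO.congr_left h3 fun u => ?_)
  rw [taylorWithinEval_charFun_zero hL]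
  simp [Finset.sum_range_succ, hmid]
  ring

/-- For centred X both functions equal 1 - u² E[X²]/2 up to o(u²). -/
lemma charFun_sub_exp_isLittleO_two (hX : MemLp X 2 κ) (h0 : ∫ w, X w ∂κ = 0) :
    (fun u : ℝ => charFun (κ.map X) u - Complex.exp (-((u ^ 2 * (∫ w, X w ^ 2 ∂κ) / 2 : ℝ) : ℂ)))
      =o[𝓝 0] fun u => u ^ 2 := by
  have hm := hX.aestronglyMeasurable.aemeasurable
  have : IsProbabilityMeasure (κ.map X) := Measure.isProbabilityMeasure_map hm
  have hL : MemLp id ((2 : ℕ) : ENNReal) (κ.map X) :=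
    (memLp_map_measure_iff (by fun_prop) hm).2 (by simpa using hX)
  have h1 := taylor_isLittleO_univ (contDiff_charFun hL) (x₀ := (0 : ℝ))
  have hd : HasDerivAt (fun x : ℝ => Complex.exp (-((x * (∫ w, X w ^ 2 ∂κ) / 2 : ℝ) : ℂ)))
      (-(((∫ w, X w ^ 2 ∂κ) / 2 : ℝ) : ℂ)) 0 := by
    have h0 : HasDerivAt (fun x : ℝ => -((x * (∫ w, X w ^ 2 ∂κ) / 2 : ℝ) : ℂ))
        (-((1 * (∫ w, X w ^ 2 ∂κ) / 2 : ℝ) : ℂ)) 0 :=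
      (((((hasDerivAt_id (0 : ℝ)).mul_const _)).div_const 2).ofReal_comp).neg
    simpa using h0.cexp
  have ht : Tendsto (fun u : ℝ => u ^ 2) (𝓝 0) (𝓝 0) := by
    have : Continuous fun u : ℝ => u ^ 2 := by fun_prop
    simpa using this.tendsto 0
  -- The Gaussian factor is a function of u², so its first derivative already gives an error o(u²).
  have h2 := hd.isLittleO.comp_tendsto ht
  have h3 := h1.sub (h2.congr_right (g₂ := fun u : ℝ => (u - 0) ^ 2) fun u => by simp)
  simp only [sub_zero] at h3
  have hmid : ∫ x, x ∂(κ.map X) = ∫ w, X w ∂κ := integral_map hm (by fun_prop)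
  have hmid2 : ∫ x, x ^ 2 ∂(κ.map X) = ∫ w, X w ^ 2 ∂κ := integral_map hm (by fun_prop)
  refine (Asymptotics.IsLittleO.congr_left h3 fun u => ?_)
  rw [taylorWithinEval_charFun_zero hL]
  simp [Finset.sum_range_succ, hmid, hmid2, h0, mul_pow]
  ring

lemma tendsto_nat_mul_norm_one (hX : Integrable X κ) (t : ℝ) :
    Tendsto (fun n : ℕ => (n : ℝ) * ‖∫ w, Complex.exp ((((n : ℝ)⁻¹ * t * X w : ℝ) : ℂ) * Complex.I) ∂κ
      - Complex.exp ((((n : ℝ)⁻¹ * t * ∫ w, X w ∂κ : ℝ) : ℂ) * Complex.I)‖) atTop (𝓝 0) := by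
  simp_rw [integral_cexp_eq_charFun hX.aemeasurable]
  have hu : Tendsto (fun n : ℕ => (n : ℝ)⁻¹ * t) atTop (𝓝 0) := by
    simpa using (tendsto_inv_atTop_nhds_zero_nat (𝕜 := ℝ)).mul_const t
  have h := ((charFun_sub_exp_isLittleO_one hX).comp_tendsto hu)
  have h2 : (fun n : ℕ => (n : ℝ)⁻¹ * t) =O[atTop] fun n : ℕ => (n : ℝ)⁻¹ := by
    simpa [mul_comm] using Asymptotics.isBigO_const_mul_self t (fun n : ℕ => (n : ℝ)⁻¹) atTop
  have h3 := (h.trans_isBigO h2).norm_left.tendsto_div_nhds_zero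
  refine h3.congr fun n => ?_
  simp [mul_comm]

lemma tendsto_nat_mul_norm_two (hX : MemLp X 2 κ) (h0 : ∫ w, X w ∂κ = 0) (t : ℝ) :
    Tendsto (fun n : ℕ => (n : ℝ) * ‖∫ w, Complex.exp ((((√n)⁻¹ * t * X w : ℝ) : ℂ) * Complex.I) ∂κ
      - Complex.exp (-(((n : ℝ)⁻¹ * (t ^ 2 / 2 * ∫ w, X w ^ 2 ∂κ) : ℝ) : ℂ))‖) atTop (𝓝 0) := by
  simp_rw [integral_cexp_eq_charFun hX.aestronglyMeasurable.aemeasurable]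
  have hu : Tendsto (fun n : ℕ => (√n)⁻¹ * t) atTop (𝓝 0) := by
    have := (tendsto_inv_atTop_zero.comp <| Real.tendsto_sqrt_atTop.comp <|
      tendsto_natCast_atTop_atTop (R := ℝ)).mul_const t
    simpa using this
  have h := ((charFun_sub_exp_isLittleO_two hX h0).comp_tendsto hu)
  have hsq : ∀ n : ℕ, ((√n)⁻¹ * t) ^ 2 = t ^ 2 * (n : ℝ)⁻¹ := by
    intro n
    rw [mul_pow, inv_pow, Real.sq_sqrt (Nat.cast_nonneg n), mul_comm]
  have h2 : (fun n : ℕ => ((√n)⁻¹ * t) ^ 2) =O[atTop] fun n : ℕ => (n : ℝ)⁻¹ := by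
    simp_rw [hsq]
    exact Asymptotics.isBigO_const_mul_self (t ^ 2) (fun n : ℕ => (n : ℝ)⁻¹) atTop
  have h3 := (h.trans_isBigO h2).norm_left.tendsto_div_nhds_zero
  refine h3.congr fun n => ?_
  simp only [Function.comp_apply, hsq]
  rw [div_inv_eq_mul, mul_comm]
  congr 5
  norm_cast
  ring

end Taylor

lemma tendstoInDistribution_of_charFun {Ω Ω' : Type*} [MeasurableSpace Ω] [MeasurableSpace Ω']
    {P : Measure Ω} [IsProbabilityMeasure P] {P' : Measure Ω'} [IsProbabilityMeasure P']
    {X : ℕ → Ω → ℝ} {Z : Ω' → ℝ} (hX : ∀ n, Measurable (X n)) (hZ : Measurable Z)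
    (h : ∀ t : ℝ, Tendsto (fun n => ∫ ω, Complex.exp (((t * X n ω : ℝ) : ℂ) * Complex.I) ∂P) atTop
      (𝓝 (charFun (P'.map Z) t))) :
    TendstoInDistribution X atTop Z (fun _ => P) P' where
  forall_aemeasurable n := (hX n).aemeasurable
  aemeasurable_limit := hZ.aemeasurable
  tendsto := by
    refine ProbabilityMeasure.tendsto_iff_tendsto_charFun.2 fun t => ?_
    simp only [ProbabilityMeasure.coe_mk]
    refine (h t).congr fun n => ?_
    rw [integral_cexp_eq_charFun (hX n).aemeasurable]

/-! ### The joint law of participants, strata and assignments -/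

section Stratified

variable {𝒵 : Type u} [MeasurableSpace 𝒵] {Q : Measure (Participant 𝒵)} {𝒮 : Type w} {S : 𝒵 → 𝒮}

lemma measurableSet_stratum (hS : ∀ s, MeasurableSet (S ⁻¹' {s})) (s : 𝒮) :
    MeasurableSet (stratum S s) :=
  (measurable_snd.comp measurable_snd) (hS s)

lemma Assumption1.stratum_ne_zero (h1 : Assumption1 Q S) (s : 𝒮) : Q (stratum S s) ≠ 0 := by
  intro h
  have := h1.stratum_pos s
  simp [measureReal_def, h] at this

lemma Assumption1.isProbabilityMeasure_cond [IsFiniteMeasure Q] (h1 : Assumption1 Q S) (s : 𝒮) :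
    IsProbabilityMeasure (cond Q (stratum S s)) :=
  cond_isProbabilityMeasure (h1.stratum_ne_zero s)

lemma memLp_cond {Ω : Type*} [MeasurableSpace Ω] {μ : Measure Ω} {f : Ω → ℝ} {p : ENNReal}
    (h : MemLp f p μ) (s : Set Ω) : MemLp f p (cond μ s) := by
  by_cases h0 : μ s = 0
  · simp [cond_eq_zero_of_meas_eq_zero h0]
  · exact (h.restrict s).smul_measure (ENNReal.inv_ne_top.2 h0)

lemma integrable_cond {Ω : Type*} [MeasurableSpace Ω] {μ : Measure Ω} {f : Ω → ℝ}
    (h : Integrable f μ) (s : Set Ω) : Integrable f (cond μ s) := by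
  rw [← memLp_one_iff_integrable] at h ⊢
  exact memLp_cond h s

/-- Multiplying by the mass removes the case distinction for null events: there both sides vanish.
-/
lemma measureReal_smul_integral_cond {Ω E : Type*} [NormedAddCommGroup E] [NormedSpace ℝ E]
    [MeasurableSpace Ω] {μ : Measure Ω}
    [IsFiniteMeasure μ] (f : Ω → E) (s : Set Ω) :
    μ.real s • ∫ w, f w ∂(cond μ s) = ∫ w in s, f w ∂μ := by
  rw [ProbabilityTheory.cond, integral_smul_measure, ENNReal.toReal_inv, smul_smul]
  by_cases h0 : μ.real s = 0
  · rw [measureReal_eq_zero_iff] at h0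
    simp [Measure.restrict_eq_zero.2 h0]
  · rw [measureReal_def] at *
    rw [mul_inv_cancel₀ h0, one_smul]

variable [Fintype 𝒮]

lemma sum_integral_stratum (hS : ∀ s, MeasurableSet (S ⁻¹' {s})) {f : Participant 𝒵 → ℝ}
    (hf : Integrable f Q) : ∑ s, ∫ w in stratum S s, f w ∂Q = ∫ w, f w ∂Q := by
  rw [← integral_iUnion_fintype (fun s => measurableSet_stratum hS s) _ (fun s => hf.integrableOn)]
  · have : ⋃ s, stratum (𝒵 := 𝒵) S s = Set.univ := by
      ext w
      simp [stratum]
    rw [this, setIntegral_univ]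
  · intro s t hst
    rw [Function.onFun, Set.disjoint_left]
    intro w hw hw'
    exact hst (Eq.trans (Eq.symm hw) hw')

lemma sum_stratum_mul_integral_cond [IsFiniteMeasure Q] (hS : ∀ s, MeasurableSet (S ⁻¹' {s}))
    {f : Participant 𝒵 → ℝ} (hf : Integrable f Q) :
    ∑ s, Q.real (stratum S s) * ∫ w, f w ∂(cond Q (stratum S s)) = ∫ w, f w ∂Q := by
  rw [← sum_integral_stratum hS hf]
  exact Finset.sum_congr rfl fun s _ => measureReal_smul_integral_cond f _

/-- The type of strata carries no σ-algebra; since it is finite, measurability of the level sets of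
S suffices once it is given the discrete one. -/
lemma measurable_comp_stratum (hS : ∀ s, MeasurableSet (S ⁻¹' {s})) {β : Type*} [MeasurableSpace β]
    (h : 𝒮 → β) : Measurable fun w : Participant 𝒵 => h (S w.2.2) := by
  let _ : MeasurableSpace 𝒮 := ⊤
  have : DiscreteMeasurableSpace 𝒮 := ⟨fun _ => trivial⟩
  have hSm : Measurable S := measurable_to_countable' hS
  exact (measurable_of_countable h).comp (hSm.comp (measurable_snd.comp measurable_snd))

lemma integral_comp_stratum [IsFiniteMeasure Q] (hS : ∀ s, MeasurableSet (S ⁻¹' {s}))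
    (h : 𝒮 → ℝ) :
    ∫ w, h (S w.2.2) ∂Q = ∑ s, Q.real (stratum S s) * h s := by
  have hi : Integrable (fun w : Participant 𝒵 => h (S w.2.2)) Q := by
    refine Integrable.of_bound (C := ∑ s, |h s|)
      (measurable_comp_stratum hS h).aestronglyMeasurable (ae_of_all _ fun w => ?_)
    exact Finset.single_le_sum (f := fun s => |h s|) (fun s _ => abs_nonneg _) (Finset.mem_univ _)
  rw [← sum_integral_stratum hS hi]
  refine Finset.sum_congr rfl fun s _ => ?_
  rw [setIntegral_congr_fun (measurableSet_stratum hS s) (g := fun _ => h s)]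
  · simp
  · intro w hw
    simp only [show S w.2.2 = s from hw]

end Stratified

section Laws

variable {𝒵 : Type u} [MeasurableSpace 𝒵] {Q : Measure (Participant 𝒵)} [IsProbabilityMeasure Q]
  {𝒮 : Type w} [Fintype 𝒮] [DecidableEq 𝒮] {S : 𝒵 → 𝒮} (T : Trial.{u, v} Q)

lemma measurable_strata_comp (hS : ∀ s, MeasurableSet (S ⁻¹' {s})) (n : ℕ) {β : Type*}
    [MeasurableSpace β] (g : (Fin n → Bool) → (Fin n → 𝒮) → β) :
    Measurable fun ω => g (T.A n ω) (T.strata S n ω) := by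
  let _ : MeasurableSpace 𝒮 := ⊤
  have : DiscreteMeasurableSpace 𝒮 := ⟨fun _ => trivial⟩
  have hσ : Measurable (T.strata S n) := measurable_pi_lambda _ fun i =>
    (measurable_comp_stratum hS id).comp ((measurable_pi_apply i).comp (T.measurable_W n))
  exact (measurable_of_countable fun y : (Fin n → Bool) × (Fin n → 𝒮) => g y.1 y.2).comp
    ((T.measurable_A n).prodMk hσ)

lemma measurableSet_strata_eq (hS : ∀ s, MeasurableSet (S ⁻¹' {s})) (n : ℕ) (σ : Fin n → 𝒮) :
    MeasurableSet {ω | T.strata S n ω = σ} := by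
  have := measurable_strata_comp T hS n (fun _ σ' => decide (σ' = σ))
  simpa [Set.preimage] using this (measurableSet_singleton true)

lemma integral_eq_sum_strata (hS : ∀ s, MeasurableSet (S ⁻¹' {s})) (n : ℕ) {E : Type*}
    [NormedAddCommGroup E] [NormedSpace ℝ E] {F : T.Ω → E} (hF : Integrable F T.P) :
    ∫ ω, F ω ∂T.P = ∑ σ : Fin n → 𝒮, T.P.real {ω | T.strata S n ω = σ} •
      ∫ ω, F ω ∂(cond T.P {ω | T.strata S n ω = σ}) := by
  simp_rw [measureReal_smul_integral_cond]
  rw [← integral_iUnion_fintype (fun σ => measurableSet_strata_eq T hS n σ) _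
    (fun s => hF.integrableOn)]
  · have : ⋃ σ, {ω | T.strata S n ω = σ} = Set.univ := by
      ext w
      simp
    rw [this, setIntegral_univ]
  · intro s t hst
    rw [Function.onFun, Set.disjoint_left]
    intro w hw hw'
    exact hst (Eq.trans (Eq.symm hw) hw')

/-- The tower property. Since the strata take finitely many values, it is a finite decomposition
over them. -/
lemma integral_integral_cond_strata (hS : ∀ s, MeasurableSet (S ⁻¹' {s})) (n : ℕ)
    {F : T.Ω → ℝ} (hF : Integrable F T.P) :
    ∫ ω, (∫ ω', F ω' ∂(cond T.P {ω' | T.strata S n ω' = T.strata S n ω})) ∂T.P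
      = ∫ ω, F ω ∂T.P := by
  have hm : Measurable fun ω =>
      ∫ ω', F ω' ∂(cond T.P {ω' | T.strata S n ω' = T.strata S n ω}) :=
    measurable_strata_comp T hS n
      (fun _ σ => ∫ ω', F ω' ∂(cond T.P {ω' | T.strata S n ω' = σ}))
  have hb : Integrable (fun ω =>
      ∫ ω', F ω' ∂(cond T.P {ω' | T.strata S n ω' = T.strata S n ω})) T.P := by
    refine Integrable.of_bound (C := ∑ σ : Fin n → 𝒮,
      ‖∫ ω', F ω' ∂(cond T.P {ω' | T.strata S n ω' = σ})‖) hm.aestronglyMeasurable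
      (ae_of_all _ fun ω => ?_)
    exact Finset.single_le_sum
      (f := fun σ => ‖∫ ω', F ω' ∂(cond T.P {ω' | T.strata S n ω' = σ})‖)
      (fun _ _ => norm_nonneg _) (Finset.mem_univ _)
  rw [integral_eq_sum_strata T hS n hb, integral_eq_sum_strata T hS n hF]
  refine Finset.sum_congr rfl fun σ _ => ?_
  simp_rw [measureReal_smul_integral_cond]
  rw [setIntegral_congr_fun (measurableSet_strata_eq T hS n σ)
    (g := fun _ => ∫ ω', F ω' ∂(cond T.P {ω' | T.strata S n ω' = σ}))]
  · rw [setIntegral_const, measureReal_smul_integral_cond]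
  · intro ω hω
    simp only [show T.strata S n ω = σ from hω]

/-- The conditioning event is a box in the coordinates of `T.W n`, so conditioning an i.i.d. vector
on it conditions each coordinate separately. -/
lemma map_cond_strata (hS : ∀ s, MeasurableSet (S ⁻¹' {s})) (h1 : Assumption1 Q S) (n : ℕ)
    (σ : Fin n → 𝒮) :
    (cond T.P {ω | T.strata S n ω = σ}).map (T.W n) =
      Measure.pi fun i => cond Q (stratum S (σ i)) := by
  have hE := measurableSet_strata_eq T hS n σ
  have : ∀ i, IsProbabilityMeasure (cond Q (stratum S (σ i))) := fun i =>
    h1.isProbabilityMeasure_cond (σ i)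
  have hEeq : {ω | T.strata S n ω = σ}
      = T.W n ⁻¹' (Set.univ.pi fun i => stratum S (σ i)) := by
    ext ω
    simp only [Set.mem_ofPred_eq, Set.mem_preimage, Set.mem_univ_pi, stratum]
    exact funext_iff
  have hpi : ∀ B : Fin n → Set (Participant 𝒵), (∀ i, MeasurableSet (B i)) →
      T.P (T.W n ⁻¹' (Set.univ.pi B)) = ∏ i, Q (B i) := by
    intro B hB
    rw [← Measure.map_apply (T.measurable_W n) (MeasurableSet.univ_pi hB), T.iid n, Measure.pi_pi]
  symm
  refine Measure.pi_eq fun B hB => ?_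
  rw [Measure.map_apply (T.measurable_W n) (MeasurableSet.univ_pi hB), cond_apply hE, hEeq,
    ← Set.preimage_inter, Set.pi_inter_distrib.symm,
    hpi _ fun i => (measurableSet_stratum hS (σ i)),
    hpi _ fun i => (measurableSet_stratum hS (σ i)).inter (hB i)]
  simp_rw [cond_apply (measurableSet_stratum hS _)]
  rw [Finset.prod_mul_distrib, ENNReal.prod_inv_distrib]
  -- Inversion in `ENNReal` commutes with this product because no stratum is null.
  exact fun i _ j _ _ => Or.inl (h1.stratum_ne_zero _)

lemma integral_prod_iid (n : ℕ) (f : Participant 𝒵 → ℂ) (hf : Measurable f) :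
    ∫ ω, ∏ i, f (T.W n ω i) ∂T.P = (∫ w, f w ∂Q) ^ n := by
  have h : ∫ y, ∏ i, f (y i) ∂(T.P.map (T.W n)) = (∫ w, f w ∂Q) ^ n := by
    rw [T.iid n, integral_fintype_prod_eq_pow, Fintype.card_fin]
  rw [← h, integral_map (T.measurable_W n).aemeasurable]
  exact (Finset.measurable_prod _ fun i _ =>
    hf.comp (measurable_pi_apply i)).aestronglyMeasurable

lemma measurable_bool_comp {Ω β γ : Type*} [MeasurableSpace Ω] [MeasurableSpace β]
    [MeasurableSpace γ] {f : Bool → β → γ} (hf : ∀ a, Measurable (f a)) {A : Ω → Bool} {W : Ω → β}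
    (hA : Measurable A) (hW : Measurable W) : Measurable fun ω => f (A ω) (W ω) :=
  (measurable_from_prod_countable_right (f := fun y : Bool × β => f y.1 y.2) hf).comp
    (hA.prodMk hW)

lemma measurable_prod_assigned (n : ℕ) {f : Bool → Participant 𝒵 → ℂ}
    (hf : ∀ a, Measurable (f a)) :
    Measurable fun ω => ∏ i, f (T.A n ω i) (T.W n ω i) :=
  Finset.measurable_prod _ fun i _ => measurable_bool_comp hf
    ((measurable_pi_apply i).comp (T.measurable_A n))
    ((measurable_pi_apply i).comp (T.measurable_W n))

/-- Given the strata, participants and assignments are independent, so Fubini integrates the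
participants with the assignments frozen, and independence across participants factors the inner
integral. -/
lemma integral_cond_strata_prod (hS : ∀ s, MeasurableSet (S ⁻¹' {s})) (h1 : Assumption1 Q S)
    (hci : T.CondIndep S) (n : ℕ) (σ : Fin n → 𝒮) (g : (Fin n → Bool) → ℂ)
    (hg : ∀ α, ‖g α‖ ≤ 1)
    (f : Bool → Participant 𝒵 → ℂ) (hf : ∀ a, Measurable (f a)) (hf1 : ∀ a w, ‖f a w‖ ≤ 1) :
    ∫ ω, g (T.A n ω) * ∏ i, f (T.A n ω i) (T.W n ω i) ∂(cond T.P {ω | T.strata S n ω = σ}) =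
      ∫ ω, g (T.A n ω) * ∏ i, (∫ w, f (T.A n ω i) w ∂(cond Q (stratum S (σ i))))
        ∂(cond T.P {ω | T.strata S n ω = σ}) := by
  set μ := cond T.P {ω | T.strata S n ω = σ}
  have : ∀ i, IsProbabilityMeasure (cond Q (stratum S (σ i))) := fun i =>
    h1.isProbabilityMeasure_cond (σ i)
  have hind := (indepFun_iff_map_prod_eq_prod_map_map (μ := μ) (T.measurable_W n).aemeasurable
    (T.measurable_A n).aemeasurable).1 (hci n σ)
  let Φ : (Fin n → Participant 𝒵) × (Fin n → Bool) → ℂ := fun y =>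
    g y.2 * ∏ i, f (y.2 i) (y.1 i)
  have hΦm : Measurable Φ := by
    refine measurable_from_prod_countable_left fun α => ?_
    have hp : Measurable fun y : Fin n → Participant 𝒵 => ∏ i, f (α i) (y i) :=
      Finset.measurable_prod _ fun i _ => (hf (α i)).comp (measurable_pi_apply i)
    exact hp.const_mul (g α)
  have hΦ1 : ∀ y, ‖Φ y‖ ≤ 1 := by
    intro y
    rw [norm_mul, norm_prod]
    exact mul_le_one₀ (hg _) (Finset.prod_nonneg fun _ _ => norm_nonneg _)
      (Finset.prod_le_one (fun _ _ => norm_nonneg _) fun _ _ => hf1 _ _)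
  have hL : ∫ ω, g (T.A n ω) * ∏ i, f (T.A n ω i) (T.W n ω i) ∂μ
      = ∫ y, Φ y ∂(μ.map fun ω => (T.W n ω, T.A n ω)) := by
    rw [integral_map ((T.measurable_W n).prodMk (T.measurable_A n)).aemeasurable
      hΦm.aestronglyMeasurable]
  rw [hL, hind, integral_prod_symm _
    (Integrable.of_bound hΦm.aestronglyMeasurable 1 (ae_of_all _ hΦ1))]
  rw [integral_map (T.measurable_A n).aemeasurable
    (measurable_of_countable _).aestronglyMeasurable]
  refine integral_congr_ae (ae_of_all _ fun ω => ?_)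
  simp only [Φ]
  rw [integral_const_mul, map_cond_strata T hS h1 n σ,
    integral_fintype_prod_eq_prod (fun i => f (T.A n ω i))]

lemma integral_prod_assigned (hS : ∀ s, MeasurableSet (S ⁻¹' {s})) (h1 : Assumption1 Q S)
    (hci : T.CondIndep S) (n : ℕ) (g : (Fin n → 𝒮) → ℂ) (hg : ∀ σ, ‖g σ‖ ≤ 1)
    (f : Bool → Participant 𝒵 → ℂ) (hf : ∀ a, Measurable (f a)) (hf1 : ∀ a w, ‖f a w‖ ≤ 1) :
    ∫ ω, g (T.strata S n ω) * ∏ i, f (T.A n ω i) (T.W n ω i) ∂T.P =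
      ∫ ω, g (T.strata S n ω) *
        ∏ i, (∫ w, f (T.A n ω i) w ∂(cond Q (stratum S (T.strata S n ω i)))) ∂T.P := by
  have : ∀ s, IsProbabilityMeasure (cond Q (stratum S s)) := h1.isProbabilityMeasure_cond
  have hc : ∀ a s, ‖∫ w, f a w ∂(cond Q (stratum S s))‖ ≤ 1 := by
    intro a s
    refine (norm_integral_le_of_norm_le_const (C := 1) (ae_of_all _ (hf1 a))).trans ?_
    simp
  have hprod : ∀ {n : ℕ} (z : Fin n → ℂ), (∀ i, ‖z i‖ ≤ 1) → ‖∏ i, z i‖ ≤ 1 := by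
    intro n z hz
    rw [norm_prod]
    exact Finset.prod_le_one (fun _ _ => norm_nonneg _) fun i _ => hz i
  rw [integral_eq_sum_strata T hS n, integral_eq_sum_strata T hS n]
  · refine Finset.sum_congr rfl fun σ _ => ?_
    congr 1
    have hae : ∀ᵐ ω ∂(cond T.P {ω | T.strata S n ω = σ}), T.strata S n ω = σ :=
      ae_cond_mem (measurableSet_strata_eq T hS n σ)
    calc _ = ∫ ω, g σ * ∏ i, f (T.A n ω i) (T.W n ω i)
            ∂(cond T.P {ω | T.strata S n ω = σ}) := by
          refine integral_congr_ae ?_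
          filter_upwards [hae] with ω hω
          rw [hω]
      _ = ∫ ω, g σ * ∏ i, (∫ w, f (T.A n ω i) w ∂(cond Q (stratum S (σ i))))
            ∂(cond T.P {ω | T.strata S n ω = σ}) :=
          integral_cond_strata_prod T hS h1 hci n σ (fun _ => g σ) (fun _ => hg σ) f hf hf1
      _ = _ := by
          refine integral_congr_ae ?_
          filter_upwards [hae] with ω hω
          rw [hω]
  · refine Integrable.of_bound (C := 1) (Measurable.aestronglyMeasurable ?_)
      (ae_of_all _ fun ω => ?_)
    · exact measurable_strata_comp T hS n (fun α σ => g σ *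
        ∏ i, (∫ w, f (α i) w ∂(cond Q (stratum S (σ i)))))
    · rw [norm_mul]
      exact mul_le_one₀ (hg _) (norm_nonneg _) (hprod _ fun i => hc _ _)
  · refine Integrable.of_bound (C := 1) (Measurable.aestronglyMeasurable ?_)
      (ae_of_all _ fun ω => ?_)
    · exact (measurable_strata_comp T hS n (fun _ σ => g σ)).mul (measurable_prod_assigned T n hf)
    · rw [norm_mul]
      exact mul_le_one₀ (hg _) (norm_nonneg _) (hprod _ fun i => hf1 _ _)

/-- The common engine of the weak law and the central limit theorem: conditional integrals may be
replaced by any approximations `e` whose error is o(1/n) in each of the finitely many cells. The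
factor `g` is a spectator that later carries the strata scores. -/
lemma tendsto_integral_prod_assigned_sub (hS : ∀ s, MeasurableSet (S ⁻¹' {s}))
    (h1 : Assumption1 Q S) (hci : T.CondIndep S) (g : (n : ℕ) → (Fin n → 𝒮) → ℂ)
    (hg : ∀ n σ, ‖g n σ‖ ≤ 1) (f : ℕ → Bool → Participant 𝒵 → ℂ)
    (hf : ∀ n a, Measurable (f n a)) (hf1 : ∀ n a w, ‖f n a w‖ ≤ 1) (e : ℕ → Bool → 𝒮 → ℂ)
    (he : ∀ n a s, ‖e n a s‖ ≤ 1)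
    (h : ∀ a s, Tendsto (fun n : ℕ =>
      (n : ℝ) * ‖∫ w, f n a w ∂(cond Q (stratum S s)) - e n a s‖) atTop (𝓝 0)) :
    Tendsto (fun n => ∫ ω, g n (T.strata S n ω) * ∏ i, f n (T.A n ω i) (T.W n ω i) ∂T.P
      - ∫ ω, g n (T.strata S n ω) * ∏ i, e n (T.A n ω i) (T.strata S n ω i) ∂T.P)
      atTop (𝓝 0) := by
  have : ∀ s, IsProbabilityMeasure (cond Q (stratum S s)) := h1.isProbabilityMeasure_cond
  have hc : ∀ n a s, ‖∫ w, f n a w ∂(cond Q (stratum S s))‖ ≤ 1 := by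
    intro n a s
    refine (norm_integral_le_of_norm_le_const (C := 1) (ae_of_all _ (hf1 n a))).trans ?_
    simp
  have hprod : ∀ {n : ℕ} (z : Fin n → ℂ), (∀ i, ‖z i‖ ≤ 1) → ‖∏ i, z i‖ ≤ 1 := by
    intro n z hz
    rw [norm_prod]
    exact Finset.prod_le_one (fun _ _ => norm_nonneg _) fun i _ => hz i
  have hsum : Tendsto (fun n : ℕ => ∑ a, ∑ s,
      (n : ℝ) * ‖∫ w, f n a w ∂(cond Q (stratum S s)) - e n a s‖) atTop (𝓝 0) := by
    have := tendsto_finsetSum (Finset.univ : Finset Bool) fun a _ =>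
      tendsto_finsetSum (Finset.univ : Finset 𝒮) fun s _ => h a s
    simpa using this
  refine squeeze_zero_norm (fun n => ?_) hsum
  have hI : ∀ z : Bool → 𝒮 → ℂ, (∀ a s, ‖z a s‖ ≤ 1) →
      Integrable (fun ω => g n (T.strata S n ω) *
        ∏ i, z (T.A n ω i) (T.strata S n ω i)) T.P := by
    intro z hz
    refine Integrable.of_bound (C := 1) (Measurable.aestronglyMeasurable ?_)
      (ae_of_all _ fun ω => ?_)
    · exact measurable_strata_comp T hS n (fun α σ => g n σ * ∏ i, z (α i) (σ i))
    · rw [norm_mul]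
      exact mul_le_one₀ (hg _ _) (norm_nonneg _) (hprod _ fun i => hz _ _)
  rw [integral_prod_assigned T hS h1 hci n (g n) (hg n) (f n) (hf n) (hf1 n),
    ← integral_sub (hI _ (hc n)) (hI _ (he n))]
  refine (norm_integral_le_of_norm_le_const (C := ∑ a, ∑ s,
      (n : ℝ) * ‖∫ w, f n a w ∂(cond Q (stratum S s)) - e n a s‖)
      (ae_of_all _ fun ω => ?_)).trans (by simp)
  rw [← mul_sub, norm_mul]
  refine (mul_le_of_le_one_left (norm_nonneg _) (hg _ _)).trans ?_
  refine (norm_prod_sub_prod_le Finset.univ _ _ (fun i => hc n _ _) (fun i => he n _ _)).trans ?_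
  have hle : ∀ i : Fin n, ‖∫ w, f n (T.A n ω i) w ∂(cond Q (stratum S (T.strata S n ω i)))
      - e n (T.A n ω i) (T.strata S n ω i)‖ ≤
      ∑ a, ∑ s, ‖∫ w, f n a w ∂(cond Q (stratum S s)) - e n a s‖ := by
    intro i
    refine le_trans ?_ (Finset.single_le_sum
      (f := fun a => ∑ s, ‖∫ w, f n a w ∂(cond Q (stratum S s)) - e n a s‖)
      (fun _ _ => Finset.sum_nonneg fun _ _ => norm_nonneg _) (Finset.mem_univ (T.A n ω i)))
    exact Finset.single_le_sum
      (f := fun s => ‖∫ w, f n (T.A n ω i) w ∂(cond Q (stratum S s)) - e n (T.A n ω i) s‖)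
      (fun _ _ => norm_nonneg _) (Finset.mem_univ _)
  refine (Finset.sum_le_sum fun i _ => hle i).trans ?_
  simp [Finset.mul_sum]

end Laws

/-! ### Laws of large numbers and the central limit theorem -/

section LimitTheorems

variable {𝒵 : Type u} [MeasurableSpace 𝒵] {Q : Measure (Participant 𝒵)} [IsProbabilityMeasure Q]
  {𝒮 : Type w} [Fintype 𝒮] [DecidableEq 𝒮] {S : 𝒵 → 𝒮} (T : Trial.{u, v} Q)

/-- The constant is treated as a random variable on a one-point space, so that Lévy's continuity
theorem applies. -/
lemma tendsto_probFilter_of_charFun {Ω : Type*} [MeasurableSpace Ω] {P : Measure Ω}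
    [IsProbabilityMeasure P] {X : ℕ → Ω → ℝ} {c : ℝ} (hX : ∀ n, Measurable (X n))
    (h : ∀ t : ℝ, Tendsto (fun n => ∫ ω, Complex.exp (((t * X n ω : ℝ) : ℂ) * Complex.I) ∂P) atTop
      (𝓝 (Complex.exp (((t * c : ℝ) : ℂ) * Complex.I)))) :
    Tendsto (fun z : ℕ × Ω => X z.1 z.2) (probFilter P) (𝓝 c) := by
  refine tendsto_probFilter_of_tendstoInDistribution (P' := Measure.dirac ()) hX
    (tendstoInDistribution_of_charFun hX measurable_const fun t => ?_)
  have : charFun ((Measure.dirac ()).map fun _ => c) t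
      = Complex.exp (((t * c : ℝ) : ℂ) * Complex.I) := by
    rw [← integral_cexp_eq_charFun (by fun_prop)]
    simp
  rw [this]
  exact h t

lemma cexp_sum_eq_prod {n : ℕ} (t r : ℝ) (z : Fin n → ℝ) :
    Complex.exp (((t * (r * ∑ i, z i) : ℝ) : ℂ) * Complex.I)
      = ∏ i, Complex.exp (((r * t * z i : ℝ) : ℂ) * Complex.I) := by
  rw [← Complex.exp_sum, ← Finset.sum_mul]
  congr 2
  push_cast
  rw [Finset.mul_sum, Finset.mul_sum]
  exact Finset.sum_congr rfl fun i _ => by ring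

lemma measurable_sum_assigned (n : ℕ) {ψ : Bool → Participant 𝒵 → ℝ}
    (hψ : ∀ a, Measurable (ψ a)) :
    Measurable fun ω => ∑ i, ψ (T.A n ω i) (T.W n ω i) :=
  Finset.measurable_sum _ fun i _ => measurable_bool_comp hψ
    ((measurable_pi_apply i).comp (T.measurable_A n))
    ((measurable_pi_apply i).comp (T.measurable_W n))

/-- A weak law through characteristic functions. Only the law of `T.W n` is prescribed for each n,
with no coupling between different n, so an almost sure law is out of reach. -/
lemma tendsto_average_strata (hS : ∀ s, MeasurableSet (S ⁻¹' {s})) (h : 𝒮 → ℝ) :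
    Tendsto (fun z : ℕ × T.Ω => (z.1 : ℝ)⁻¹ * ∑ i, h (T.strata S z.1 z.2 i)) (probFilter T.P)
      (𝓝 (∑ s, Q.real (stratum S s) * h s)) := by
  have hmh : Measurable fun w : Participant 𝒵 => h (S w.2.2) := measurable_comp_stratum hS h
  have hX : Integrable (fun w : Participant 𝒵 => h (S w.2.2)) Q :=
    Integrable.of_bound (C := ∑ s, |h s|) hmh.aestronglyMeasurable (ae_of_all _ fun w =>
      Finset.single_le_sum (f := fun s => |h s|) (fun s _ => abs_nonneg _) (Finset.mem_univ _))
  refine tendsto_probFilter_of_charFun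
    (X := fun n ω => (n : ℝ)⁻¹ * ∑ i, h (T.strata S n ω i)) (fun n => ?_) fun t => ?_
  · exact measurable_strata_comp T hS n (fun _ σ => (n : ℝ)⁻¹ * ∑ i, h (σ i))
  rw [← integral_comp_stratum hS h]
  simp_rw [cexp_sum_eq_prod]
  have hid : ∀ n : ℕ, ∫ ω, ∏ i, Complex.exp ((((n : ℝ)⁻¹ * t * h (T.strata S n ω i) : ℝ) : ℂ)
      * Complex.I) ∂T.P
      = (∫ w, Complex.exp ((((n : ℝ)⁻¹ * t * h (S w.2.2) : ℝ) : ℂ) * Complex.I) ∂Q) ^ n := fun n =>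
    integral_prod_iid T n
      (fun w => Complex.exp ((((n : ℝ)⁻¹ * t * h (S w.2.2) : ℝ) : ℂ) * Complex.I))
        (measurable_comp_stratum hS fun s =>
          Complex.exp ((((n : ℝ)⁻¹ * t * h s : ℝ) : ℂ) * Complex.I))
  simp_rw [hid]
  rw [tendsto_iff_norm_sub_tendsto_zero]
  refine squeeze_zero' (Eventually.of_forall fun _ => norm_nonneg _) ?_
    (tendsto_nat_mul_norm_one hX t)
  filter_upwards [eventually_gt_atTop 0] with n hn
  have hn' : (n : ℂ) ≠ 0 := Nat.cast_ne_zero.2 hn.ne'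
  have he : Complex.exp (((t * ∫ w, h (S w.2.2) ∂Q : ℝ) : ℂ) * Complex.I) =
      Complex.exp ((((n : ℝ)⁻¹ * t * ∫ w, h (S w.2.2) ∂Q : ℝ) : ℂ) * Complex.I) ^ n := by
    rw [← Complex.exp_nat_mul]
    congr 1
    push_cast
    field_simp
  rw [he]
  have := norm_prod_sub_prod_le (Finset.univ : Finset (Fin n))
    (fun _ => ∫ w, Complex.exp ((((n : ℝ)⁻¹ * t * h (S w.2.2) : ℝ) : ℂ) * Complex.I) ∂Q)
    (fun _ => Complex.exp ((((n : ℝ)⁻¹ * t * ∫ w, h (S w.2.2) ∂Q : ℝ) : ℂ) * Complex.I))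
    (fun _ => (norm_integral_le_of_norm_le_const (C := 1)
      (ae_of_all _ fun _ => norm_cexp_ofReal_mul_I_le _)).trans (by simp))
    (fun _ => norm_cexp_ofReal_mul_I_le _)
  simpa using this

lemma Trial.nS_eq (n : ℕ) (ω : T.Ω) (s : 𝒮) :
    (T.sample S n ω).nS s = ∑ i, if T.strata S n ω i = s then (1 : ℝ) else 0 := rfl

lemma Trial.nA_eq (n : ℕ) (ω : T.Ω) (s : 𝒮) :
    (T.sample S n ω).nA s =
      ∑ i, if T.A n ω i = true ∧ T.strata S n ω i = s then (1 : ℝ) else 0 := by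
  refine Finset.sum_congr rfl fun i _ => ?_
  simp only [toReal, Sample.indS, Trial.sample]
  by_cases h : T.A n ω i = true <;> by_cases h' : T.strata S n ω i = s <;> simp [h, h']

lemma tendsto_nS_div (hS : ∀ s, MeasurableSet (S ⁻¹' {s})) (s : 𝒮) :
    Tendsto (fun z : ℕ × T.Ω => (T.sample S z.1 z.2).nS s / z.1) (probFilter T.P)
      (𝓝 (Q.real (stratum S s))) := by
  have := tendsto_average_strata T hS (fun s' => if s' = s then 1 else 0)
  simpa [Trial.nS_eq, div_eq_inv_mul] using this

lemma tendsto_nA_div (hS : ∀ s, MeasurableSet (S ⁻¹' {s})) (h1 : Assumption1 Q S) {pA : 𝒮 → ℝ}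
    (h2 : Assumption2 T S pA) (s : 𝒮) :
    Tendsto (fun z : ℕ × T.Ω => (T.sample S z.1 z.2).nA s / z.1) (probFilter T.P)
      (𝓝 (Q.real (stratum S s) * pA s)) := by
  have hs := tendsto_nS_div T hS s
  have := hs.mul (tendsto_probFilter_iff.2 (h2.propensity s))
  refine this.congr' ?_
  filter_upwards [hs.eventually_ne (h1.stratum_pos s).ne'] with z hz
  have : (T.sample S z.1 z.2).nS s ≠ 0 := fun h => hz (by rw [h, zero_div])
  rw [div_mul_div_comm, mul_comm ((T.sample S z.1 z.2).nS s), mul_div_mul_right _ _ this]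

/-- The limit of cell averages with cell means `k`. -/
def cellMix (Q : Measure (Participant 𝒵)) (S : 𝒵 → 𝒮) (pA : 𝒮 → ℝ) (k : Bool → 𝒮 → ℝ) : ℝ :=
  ∑ s, Q.real (stratum S s) * (pA s * k true s + (1 - pA s) * k false s)

/-- Such an average depends on the data only through n(s)/n and n_A(s)/n, whose limits are known. -/
lemma tendsto_average_cells (hS : ∀ s, MeasurableSet (S ⁻¹' {s})) (h1 : Assumption1 Q S)
    {pA : 𝒮 → ℝ} (h2 : Assumption2 T S pA) (k : Bool → 𝒮 → ℝ) :
    Tendsto (fun z : ℕ × T.Ω => (z.1 : ℝ)⁻¹ * ∑ i, k (T.A z.1 z.2 i) (T.strata S z.1 z.2 i))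
      (probFilter T.P) (𝓝 (cellMix Q S pA k)) := by
  have hlim : Tendsto (fun z : ℕ × T.Ω => ∑ s, ((T.sample S z.1 z.2).nA s / z.1 * k true s +
      ((T.sample S z.1 z.2).nS s / z.1 - (T.sample S z.1 z.2).nA s / z.1) * k false s))
      (probFilter T.P) (𝓝 (∑ s, (Q.real (stratum S s) * pA s * k true s +
        (Q.real (stratum S s) - Q.real (stratum S s) * pA s) * k false s))) := by
    refine tendsto_finsetSum _ fun s _ => ?_
    exact ((tendsto_nA_div T hS h1 h2 s).mul_const _).add
      (((tendsto_nS_div T hS s).sub (tendsto_nA_div T hS h1 h2 s)).mul_const _)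
  have hc : cellMix Q S pA k = ∑ s, (Q.real (stratum S s) * pA s * k true s +
        (Q.real (stratum S s) - Q.real (stratum S s) * pA s) * k false s) :=
    Finset.sum_congr rfl fun s _ => by ring
  rw [hc]
  refine hlim.congr fun z => ?_
  have hi : ∀ i, k (T.A z.1 z.2 i) (T.strata S z.1 z.2 i) = ∑ s,
      ((if T.A z.1 z.2 i = true ∧ T.strata S z.1 z.2 i = s then (1 : ℝ) else 0) * k true s +
      ((if T.strata S z.1 z.2 i = s then (1 : ℝ) else 0) -
        (if T.A z.1 z.2 i = true ∧ T.strata S z.1 z.2 i = s then (1 : ℝ) else 0)) * k false s) := by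
    intro i
    rw [Finset.sum_eq_single (T.strata S z.1 z.2 i)]
    · cases h : T.A z.1 z.2 i <;> simp
    · intro s _ hs
      simp [hs.symm]
    · simp
  simp_rw [hi]
  rw [Finset.sum_comm, Finset.mul_sum]
  refine Finset.sum_congr rfl fun s _ => ?_
  rw [Trial.nA_eq, Trial.nS_eq, Finset.sum_add_distrib, ← Finset.sum_mul, ← Finset.sum_mul,
    Finset.sum_sub_distrib]
  ring

/-- Weak law for observed data under covariate-adaptive assignment: the characteristic function is
first reduced to the average of the cell means `k`, which converges by `tendsto_average_cells`. -/
theorem tendsto_average_assigned (hS : ∀ s, MeasurableSet (S ⁻¹' {s})) (h1 : Assumption1 Q S)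
    {pA : 𝒮 → ℝ} (h2 : Assumption2 T S pA) {ψ : Bool → Participant 𝒵 → ℝ}
    (hψ : ∀ a, Measurable (ψ a)) (hi : ∀ a, Integrable (ψ a) Q) :
    Tendsto (fun z : ℕ × T.Ω => (z.1 : ℝ)⁻¹ * ∑ i, ψ (T.A z.1 z.2 i) (T.W z.1 z.2 i))
      (probFilter T.P)
      (𝓝 (cellMix Q S pA fun a s => ∫ w, ψ a w ∂(cond Q (stratum S s)))) := by
  have hp : ∀ s, IsProbabilityMeasure (cond Q (stratum S s)) := h1.isProbabilityMeasure_cond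
  set k : Bool → 𝒮 → ℝ := fun a s => ∫ w, ψ a w ∂(cond Q (stratum S s)) with hk
  refine tendsto_probFilter_of_charFun
    (X := fun n ω => (n : ℝ)⁻¹ * ∑ i, ψ (T.A n ω i) (T.W n ω i))
    (fun n => (measurable_sum_assigned T n hψ).const_mul _) fun t => ?_
  have hd := tendsto_integral_prod_assigned_sub T hS h1 h2.condIndep (fun _ _ => 1)
    (by simp) (fun n a w => Complex.exp ((((n : ℝ)⁻¹ * t * ψ a w : ℝ) : ℂ) * Complex.I))
    (fun n a => by have := hψ a; fun_prop) (fun n a w => norm_cexp_ofReal_mul_I_le _)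
    (fun n a s => Complex.exp ((((n : ℝ)⁻¹ * t * k a s : ℝ) : ℂ) * Complex.I))
    (fun n a s => norm_cexp_ofReal_mul_I_le _)
    (fun a s => tendsto_nat_mul_norm_one (integrable_cond (hi a) _) t)
  simp only [one_mul, ← cexp_sum_eq_prod] at hd
  have hcont : Continuous fun x : ℝ => Complex.exp (((t * x : ℝ) : ℂ) * Complex.I) := by fun_prop
  have hb := tendsto_integral_mul_sub_of_probFilter (P := T.P) (G := fun _ _ => 1)
    (B := fun n ω => Complex.exp (((t * ((n : ℝ)⁻¹ *
      ∑ i, k (T.A n ω i) (T.strata S n ω i)) : ℝ) : ℂ) * Complex.I))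
    (fun n => aestronglyMeasurable_const)
    (fun n => (measurable_strata_comp T hS n (fun α σ => Complex.exp (((t * ((n : ℝ)⁻¹ *
      ∑ i, k (α i) (σ i)) : ℝ) : ℂ) * Complex.I))).aestronglyMeasurable)
    (by simp) (fun n ω => norm_cexp_ofReal_mul_I_le _)
    ((hcont.tendsto _).comp (tendsto_average_cells T hS h1 h2 k))
  have h3 := (hd.add hb).add_const (Complex.exp (((t * cellMix Q S pA k : ℝ) : ℂ) * Complex.I))
  simpa using h3

/-- Two sources of noise add up: deviations from the cell means, which are independent given strata
and assignments, and the random strata. The first contributes a conditional variance that becomes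
deterministic in the limit, so no central limit theorem for the assignments themselves is needed. -/
theorem tendstoInDistribution_sum_assigned (hS : ∀ s, MeasurableSet (S ⁻¹' {s}))
    (h1 : Assumption1 Q S) {pA : 𝒮 → ℝ} (h2 : Assumption2 T S pA)
    {ψ : Bool → Participant 𝒵 → ℝ} (hψ : ∀ a, Measurable (ψ a)) (hi : ∀ a, MemLp (ψ a) 2 Q)
    (h0 : ∀ a s, ∫ w, ψ a w ∂(cond Q (stratum S s)) = 0) {h : 𝒮 → ℝ}
    (hh : ∑ s, Q.real (stratum S s) * h s = 0) :
    TendstoInDistribution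
      (fun (n : ℕ) ω => (√n)⁻¹ * ∑ i, (ψ (T.A n ω i) (T.W n ω i) + h (T.strata S n ω i))) atTop
      (id : ℝ → ℝ) (fun _ => T.P)
      (gaussianReal 0 (cellMix Q S pA (fun a s => ∫ w, ψ a w ^ 2 ∂(cond Q (stratum S s)))
        + ∑ s, Q.real (stratum S s) * h s ^ 2).toNNReal) := by
  have hp : ∀ s, IsProbabilityMeasure (cond Q (stratum S s)) := h1.isProbabilityMeasure_cond
  set k : Bool → 𝒮 → ℝ := fun a s => ∫ w, ψ a w ^ 2 ∂(cond Q (stratum S s)) with hk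
  have hk0 : ∀ a s, 0 ≤ k a s := fun a s => integral_nonneg fun _ => sq_nonneg _
  have hmh : Measurable fun w : Participant 𝒵 => h (S w.2.2) := measurable_comp_stratum hS h
  have hX : MemLp (fun w : Participant 𝒵 => h (S w.2.2)) 2 Q :=
    MemLp.of_bound hmh.aestronglyMeasurable (∑ s, |h s|) (ae_of_all _ fun w =>
      Finset.single_le_sum (f := fun s => |h s|) (fun s _ => abs_nonneg _) (Finset.mem_univ _))
  have hX0 : ∫ w, h (S w.2.2) ∂Q = 0 := by rw [integral_comp_stratum hS h, hh]
  have hX2 : ∫ w, h (S w.2.2) ^ 2 ∂Q = ∑ s, Q.real (stratum S s) * h s ^ 2 :=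
    integral_comp_stratum hS fun s => h s ^ 2
  have hmix : 0 ≤ cellMix Q S pA k := Finset.sum_nonneg fun s _ =>
    mul_nonneg measureReal_nonneg (add_nonneg (mul_nonneg (h2.pA_mem s).1.le (hk0 _ _))
      (mul_nonneg (sub_nonneg.2 (h2.pA_mem s).2.le) (hk0 _ _)))
  have hv : 0 ≤ ∑ s, Q.real (stratum S s) * h s ^ 2 := Finset.sum_nonneg fun s _ =>
    mul_nonneg measureReal_nonneg (sq_nonneg _)
  refine tendstoInDistribution_of_charFun (fun n => ?_) measurable_id fun t => ?_
  · refine Measurable.const_mul ?_ _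
    simp_rw [Finset.sum_add_distrib]
    exact (measurable_sum_assigned T n hψ).add
      (measurable_strata_comp T hS n (fun _ σ => ∑ i, h (σ i)))
  set v := ∑ s, Q.real (stratum S s) * h s ^ 2 with hvdef
  rw [Measure.map_id, charFun_gaussianReal]
  -- The part of the characteristic function that depends on the strata alone; it stays outside the
  -- conditional computation.
  set g : (n : ℕ) → (Fin n → 𝒮) → ℂ := fun n σ =>
    ∏ i, Complex.exp ((((√n)⁻¹ * t * h (σ i) : ℝ) : ℂ) * Complex.I) with hg
  have hg1 : ∀ n σ, ‖g n σ‖ ≤ 1 := by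
    intro n σ
    rw [hg, norm_prod]
    exact Finset.prod_le_one (fun _ _ => norm_nonneg _) fun i _ => norm_cexp_ofReal_mul_I_le _
  have hd := tendsto_integral_prod_assigned_sub T hS h1 h2.condIndep g hg1
    (fun n a w => Complex.exp ((((√n)⁻¹ * t * ψ a w : ℝ) : ℂ) * Complex.I))
    (fun n a => by have := hψ a; fun_prop) (fun n a w => norm_cexp_ofReal_mul_I_le _)
    (fun n a s => Complex.exp (-(((n : ℝ)⁻¹ * (t ^ 2 / 2 * k a s) : ℝ) : ℂ)))
    (fun n a s => norm_cexp_neg_ofReal_le (by have := hk0 a s; positivity))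
    (fun a s => tendsto_nat_mul_norm_two (memLp_cond (hi a) _) (h0 a s) t)
  have hB : ∀ (n : ℕ) (ω : T.Ω), ∏ i, Complex.exp (-(((n : ℝ)⁻¹ *
      (t ^ 2 / 2 * k (T.A n ω i) (T.strata S n ω i)) : ℝ) : ℂ)) =
      Complex.exp (-((t ^ 2 / 2 * ((n : ℝ)⁻¹ *
        ∑ i, k (T.A n ω i) (T.strata S n ω i)) : ℝ) : ℂ)) := by
    intro n ω
    rw [← Complex.exp_sum, Finset.sum_neg_distrib]
    congr 2
    push_cast
    rw [Finset.mul_sum, Finset.mul_sum]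
    exact Finset.sum_congr rfl fun i _ => by ring
  simp only [hB] at hd
  have hcont : Continuous fun x : ℝ => Complex.exp (-((t ^ 2 / 2 * x : ℝ) : ℂ)) := by fun_prop
  -- The product of the Gaussian factors is a bounded continuous function of the cell average of
  -- `k`, hence converges in probability and leaves the integral.
  have hb := tendsto_integral_mul_sub_of_probFilter (P := T.P)
    (G := fun n ω => g n (T.strata S n ω))
    (B := fun n ω => Complex.exp (-((t ^ 2 / 2 * ((n : ℝ)⁻¹ *
        ∑ i, k (T.A n ω i) (T.strata S n ω i)) : ℝ) : ℂ)))
    (fun n => (measurable_strata_comp T hS n (fun _ σ => g n σ)).aestronglyMeasurable)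
    (fun n => (measurable_strata_comp T hS n (fun α σ => Complex.exp (-((t ^ 2 / 2 *
      ((n : ℝ)⁻¹ * ∑ i, k (α i) (σ i)) : ℝ) : ℂ)))).aestronglyMeasurable)
    (fun n ω => hg1 n _) (fun n ω => norm_cexp_neg_ofReal_le (by
      have : 0 ≤ ∑ i, k (T.A n ω i) (T.strata S n ω i) := Finset.sum_nonneg fun i _ => hk0 _ _
      positivity))
    ((hcont.tendsto _).comp (tendsto_average_cells T hS h1 h2 k))
  -- The classical i.i.d. central limit theorem for the strata scores, in the form of an n-th power.
  have hgl : Tendsto (fun n => ∫ ω, g n (T.strata S n ω) ∂T.P) atTop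
      (𝓝 (Complex.exp (-((t ^ 2 / 2 * v : ℝ) : ℂ)))) := by
    have hid : ∀ n : ℕ, ∫ ω, g n (T.strata S n ω) ∂T.P
        = (∫ w, Complex.exp ((((√n)⁻¹ * t * h (S w.2.2) : ℝ) : ℂ) * Complex.I) ∂Q) ^ n :=
      fun n => integral_prod_iid T n
        (fun w => Complex.exp ((((√n)⁻¹ * t * h (S w.2.2) : ℝ) : ℂ) * Complex.I))
        (measurable_comp_stratum hS fun s =>
          Complex.exp ((((√n)⁻¹ * t * h s : ℝ) : ℂ) * Complex.I))
    simp_rw [hid]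
    rw [tendsto_iff_norm_sub_tendsto_zero]
    refine squeeze_zero' (Eventually.of_forall fun _ => norm_nonneg _) ?_
      (tendsto_nat_mul_norm_two hX hX0 t)
    filter_upwards [eventually_gt_atTop 0] with n hn
    have hn' : (n : ℂ) ≠ 0 := Nat.cast_ne_zero.2 hn.ne'
    have he : Complex.exp (-((t ^ 2 / 2 * v : ℝ) : ℂ)) =
        Complex.exp (-(((n : ℝ)⁻¹ * (t ^ 2 / 2 * v) : ℝ) : ℂ)) ^ n := by
      rw [← Complex.exp_nat_mul]
      congr 1
      push_cast
      field_simp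
    rw [he, hX2]
    have := norm_prod_sub_prod_le (Finset.univ : Finset (Fin n))
      (fun _ => ∫ w, Complex.exp ((((√n)⁻¹ * t * h (S w.2.2) : ℝ) : ℂ) * Complex.I) ∂Q)
      (fun _ => Complex.exp (-(((n : ℝ)⁻¹ * (t ^ 2 / 2 * v) : ℝ) : ℂ)))
      (fun _ => (norm_integral_le_of_norm_le_const (C := 1)
        (ae_of_all _ fun _ => norm_cexp_ofReal_mul_I_le _)).trans (by simp))
      (fun _ => norm_cexp_neg_ofReal_le (by positivity))
    simpa using this
  have h3 := (hd.add hb).add (hgl.const_mul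
    (Complex.exp (-((t ^ 2 / 2 * cellMix Q S pA k : ℝ) : ℂ))))
  have hlim : Complex.exp (t * (0 : ℝ) * Complex.I - ((cellMix Q S pA k + v).toNNReal : ℝ)
      * t ^ 2 / 2) = 0 + 0 + Complex.exp (-((t ^ 2 / 2 * cellMix Q S pA k : ℝ) : ℂ)) *
      Complex.exp (-((t ^ 2 / 2 * v : ℝ) : ℂ)) := by
    rw [Real.coe_toNNReal _ (add_nonneg hmix hv), ← Complex.exp_add, zero_add, zero_add]
    congr 1
    push_cast
    ring
  have hlim' := hlim.symm
  push_cast at hlim' h3 ⊢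
  rw [hlim'] at h3
  refine h3.congr fun n => ?_
  have hexp : ∀ ω, Complex.exp ((t * ((√n)⁻¹ *
      ∑ i, (ψ (T.A n ω i) (T.W n ω i) + h (T.strata S n ω i)) : ℝ) : ℂ) * Complex.I) =
      g n (T.strata S n ω) *
        ∏ i, Complex.exp ((((√n)⁻¹ * t * ψ (T.A n ω i) (T.W n ω i) : ℝ) : ℂ) * Complex.I) := by
    intro ω
    rw [← Complex.ofReal_mul, cexp_sum_eq_prod, hg, ← Finset.prod_mul_distrib]
    refine Finset.prod_congr rfl fun i _ => ?_
    rw [← Complex.exp_add]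
    congr 1
    push_cast
    ring
  push_cast at hexp
  simp_rw [hexp]
  simp
end LimitTheorems

/-! ### Algebra of the estimators -/

/-- Injectivity on the normal equations makes Z'X invertible, so exhibiting one solution identifies
the estimator without computing an inverse. -/
lemma ivEstimator_eq_of_normal_equations {n : ℕ} {k : Type*} [Fintype k] [DecidableEq k]
    {Z X : Matrix (Fin n) k ℝ} {Y : Fin n → ℝ} (hinj : ∀ c, Zᵀ *ᵥ (X *ᵥ c) = 0 → c = 0)
    {c : k → ℝ} (hc : Zᵀ *ᵥ (X *ᵥ c) = Zᵀ *ᵥ Y) : ivEstimator Z X Y = c := by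
  have hdet : IsUnit (Zᵀ * X).det := by
    rw [isUnit_iff_ne_zero]
    intro h
    obtain ⟨v, hv, hv0⟩ := Matrix.exists_mulVec_eq_zero_iff.2 h
    exact hv (hinj v (by rw [Matrix.mulVec_mulVec, hv0]))
  rw [ivEstimator, ← hc, Matrix.mulVec_mulVec c, Matrix.mulVec_mulVec,
    Matrix.nonsing_inv_mul _ hdet, Matrix.one_mulVec]

@[simp] lemma toReal_true : toReal true = 1 := rfl

@[simp] lemma toReal_false : toReal false = 0 := rfl

lemma toReal_sq (b : Bool) : toReal b ^ 2 = toReal b := by cases b <;> simp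

namespace Sample

variable {𝒮 : Type w} [Fintype 𝒮] [DecidableEq 𝒮] {n : ℕ} (x : Sample 𝒮 n)

/-- The sum of `g (D_i) (Y_i)` over the participants with `A_i = a` and `S_i = s`. -/
def cellSum (a : Bool) (s : 𝒮) (g : Bool → ℝ → ℝ) : ℝ :=
  ∑ i, if x.A i = a ∧ x.S i = s then g (x.D i) (x.Y i) else 0

lemma cellSum_add (a : Bool) (s : 𝒮) (g g' : Bool → ℝ → ℝ) :
    x.cellSum a s (fun d y => g d y + g' d y) = x.cellSum a s g + x.cellSum a s g' := by
  rw [cellSum, cellSum, cellSum, ← Finset.sum_add_distrib]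
  exact Finset.sum_congr rfl fun i _ => by split_ifs <;> simp

lemma cellSum_const_mul (a : Bool) (s : 𝒮) (c : ℝ) (g : Bool → ℝ → ℝ) :
    x.cellSum a s (fun d y => c * g d y) = c * x.cellSum a s g := by
  rw [cellSum, cellSum, Finset.mul_sum]
  exact Finset.sum_congr rfl fun i _ => by split_ifs <;> simp

/-- The number of participants with `A_i = a` and `S_i = s`. -/
def cellCount (a : Bool) (s : 𝒮) : ℝ := x.cellSum a s fun _ _ => 1

/-- The number of participants with `A_i = a`, `D_i = 1` and `S_i = s`. -/
def cellTreated (a : Bool) (s : 𝒮) : ℝ := x.cellSum a s fun d _ => toReal d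

/-- The sum of the outcomes of the participants with `A_i = a` and `S_i = s`. -/
def cellOutcome (a : Bool) (s : 𝒮) : ℝ := x.cellSum a s fun _ y => y

lemma sum_indS_mul (s : 𝒮) (g : Bool → ℝ → ℝ) :
    ∑ i, x.indS i s * g (x.D i) (x.Y i) = x.cellSum true s g + x.cellSum false s g := by
  rw [cellSum, cellSum, ← Finset.sum_add_distrib]
  refine Finset.sum_congr rfl fun i _ => ?_
  by_cases h : x.S i = s <;> cases h' : x.A i <;> simp [indS, h]

lemma sum_toReal_indS_mul (s : 𝒮) (g : Bool → ℝ → ℝ) :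
    ∑ i, toReal (x.A i) * x.indS i s * g (x.D i) (x.Y i) = x.cellSum true s g := by
  rw [cellSum]
  refine Finset.sum_congr rfl fun i _ => ?_
  by_cases h : x.S i = s <;> cases h' : x.A i <;> simp [indS, h]

lemma nS_eq_cellCount (s : 𝒮) : x.nS s = x.cellCount true s + x.cellCount false s := by
  simpa [nS, cellCount] using x.sum_indS_mul s fun _ _ => 1

lemma nA_eq_cellCount (s : 𝒮) : x.nA s = x.cellCount true s := by
  simpa [nA, cellCount] using x.sum_toReal_indS_mul s fun _ _ => 1

lemma nD_eq_cellTreated (s : 𝒮) : x.nD s = x.cellTreated true s + x.cellTreated false s := by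
  rw [cellTreated, cellTreated, ← sum_indS_mul]
  exact Finset.sum_congr rfl fun i _ => mul_comm _ _

lemma nAD_eq_cellTreated (s : 𝒮) : x.nAD s = x.cellTreated true s := by
  rw [cellTreated, ← sum_toReal_indS_mul]
  exact Finset.sum_congr rfl fun i _ => by ring

lemma piD1Hat_eq (s : 𝒮) : x.piD1Hat s = x.cellTreated true s / x.cellCount true s := by
  rw [piD1Hat, nAD_eq_cellTreated, nA_eq_cellCount]

lemma piD0Hat_eq (s : 𝒮) : x.piD0Hat s = x.cellTreated false s / x.cellCount false s := by
  rw [piD0Hat, nAD_eq_cellTreated, nA_eq_cellCount, nS_eq_cellCount, nD_eq_cellTreated]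
  simp

/-- All cells are nonempty and the first stage is positive in every stratum. -/
structure Regular : Prop where
  count_pos : ∀ a s, 0 < x.cellCount a s
  piD1Hat_pos : ∀ s, 0 < x.piD1Hat s
  piD0Hat_lt : ∀ s, x.piD0Hat s < 1
  firstStage_pos : ∀ s, 0 < x.piD1Hat s - x.piD0Hat s

variable {x}

lemma Regular.nS_pos (hx : x.Regular) (s : 𝒮) : 0 < x.nS s := by
  rw [nS_eq_cellCount]
  exact add_pos (hx.count_pos _ _) (hx.count_pos _ _)

lemma Regular.natCast_ne_zero (hx : x.Regular) (s : 𝒮) : (n : ℝ) ≠ 0 := by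
  rintro h
  have hn : n = 0 := by exact_mod_cast h
  subst hn
  have := hx.count_pos true s
  simp [cellCount, cellSum] at this

variable (x)

/-! #### The fully saturated regression -/

lemma matSat_mulVec (V : Fin n → Bool) (c : 𝒮 ⊕ 𝒮 → ℝ) (i : Fin n) :
    (x.matSat V *ᵥ c) i = c (Sum.inl (x.S i)) + toReal (V i) * c (Sum.inr (x.S i)) := by
  simp [matSat, Matrix.mulVec, dotProduct, indS]

lemma matSat_transpose_mulVec_inl (V : Fin n → Bool) (y : Fin n → ℝ) (s : 𝒮) :
    ((x.matSat V)ᵀ *ᵥ y) (Sum.inl s) = ∑ i, x.indS i s * y i := by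
  simp [matSat, Matrix.mulVec, dotProduct]

lemma matSat_transpose_mulVec_inr (V : Fin n → Bool) (y : Fin n → ℝ) (s : 𝒮) :
    ((x.matSat V)ᵀ *ᵥ y) (Sum.inr s) = ∑ i, toReal (V i) * x.indS i s * y i := by
  simp [matSat, Matrix.mulVec, dotProduct]

lemma matSat_normal_inl (c : 𝒮 ⊕ 𝒮 → ℝ) (s : 𝒮) :
    ((x.matSat x.A)ᵀ *ᵥ (x.matSat x.D *ᵥ c)) (Sum.inl s) =
      (c (Sum.inl s) * x.cellCount true s + c (Sum.inr s) * x.cellTreated true s) +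
      (c (Sum.inl s) * x.cellCount false s + c (Sum.inr s) * x.cellTreated false s) := by
  rw [matSat_transpose_mulVec_inl]
  have := x.sum_indS_mul s fun d _ => c (Sum.inl s) * 1 + c (Sum.inr s) * toReal d
  rw [cellSum_add, cellSum_add] at this
  simp only [cellSum_const_mul] at this
  rw [cellCount, cellTreated, cellCount, cellTreated, ← this]
  refine Finset.sum_congr rfl fun i _ => ?_
  rw [matSat_mulVec]
  by_cases h : x.S i = s
  · simp [h, mul_comm]
  · simp [indS, h]

lemma matSat_normal_inr (c : 𝒮 ⊕ 𝒮 → ℝ) (s : 𝒮) :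
    ((x.matSat x.A)ᵀ *ᵥ (x.matSat x.D *ᵥ c)) (Sum.inr s) =
      c (Sum.inl s) * x.cellCount true s + c (Sum.inr s) * x.cellTreated true s := by
  rw [matSat_transpose_mulVec_inr]
  have := x.sum_toReal_indS_mul s fun d _ => c (Sum.inl s) * 1 + c (Sum.inr s) * toReal d
  rw [cellSum_add] at this
  simp only [cellSum_const_mul] at this
  rw [cellCount, cellTreated, ← this]
  refine Finset.sum_congr rfl fun i _ => ?_
  rw [matSat_mulVec]
  by_cases h : x.S i = s
  · simp [h, mul_comm]
  · simp [indS, h]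

variable {x}

/-- The normal equations decouple into one 2 × 2 system per stratum, equivalent to vanishing
residual sums in both cells. Up to sign its determinant is the product of the cell counts and the
first stage; the slope is the Wald ratio. -/
lemma Regular.sat_eq (hx : x.Regular) (s : 𝒮) :
    x.betaSatStratum s =
        (x.cellOutcome true s / x.cellCount true s - x.cellOutcome false s / x.cellCount false s)
          / (x.piD1Hat s - x.piD0Hat s) ∧
      (∀ a, x.gammaSat s * x.cellCount a s + x.betaSatStratum s * x.cellTreated a s
        = x.cellOutcome a s) := by
  let b : 𝒮 → ℝ := fun s =>
    (x.cellOutcome true s / x.cellCount true s - x.cellOutcome false s / x.cellCount false s)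
          / (x.piD1Hat s - x.piD0Hat s)
  -- The intercept is chosen to solve the equation of the cell A = 1; the Wald ratio then makes the
  -- cell A = 0 consistent with it.
  let c : 𝒮 → ℝ := fun s => (x.cellOutcome true s - b s * x.cellTreated true s) / x.cellCount true s
  have hb : ∀ s, b s * (x.cellTreated true s / x.cellCount true s
      - x.cellTreated false s / x.cellCount false s) =
      x.cellOutcome true s / x.cellCount true s - x.cellOutcome false s / x.cellCount false s := by
    intro s
    rw [← piD1Hat_eq, ← piD0Hat_eq]
    exact div_mul_cancel₀ _ (hx.firstStage_pos s).ne'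
  have h1 : ∀ s, c s * x.cellCount true s + b s * x.cellTreated true s = x.cellOutcome true s := by
    intro s
    have := (hx.count_pos true s).ne'
    simp only [c]
    field_simp
    ring
  have h0 : ∀ s, c s * x.cellCount false s + b s * x.cellTreated false s
      = x.cellOutcome false s := by
    intro s
    have hn1 := (hx.count_pos true s).ne'
    have hn0 := (hx.count_pos false s).ne'
    have := hb s
    simp only [c]
    field_simp at this ⊢
    linear_combination (-1 : ℝ) * this
  have key : ivEstimator (x.matSat x.A) (x.matSat x.D) x.Y = Sum.elim c b := by
    refine ivEstimator_eq_of_normal_equations (fun v hv => ?_) ?_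
    · have e1 : ∀ s, v (Sum.inl s) * x.cellCount true s + v (Sum.inr s) * x.cellTreated true s = 0 :=
        fun s => by rw [← matSat_normal_inr, hv]; rfl
      have e0 : ∀ s, v (Sum.inl s) * x.cellCount false s
          + v (Sum.inr s) * x.cellTreated false s = 0 := fun s => by
        have := x.matSat_normal_inl v s
        rw [hv, e1 s, zero_add] at this
        exact this.symm
      have hr : ∀ s, v (Sum.inr s) = 0 := by
        intro s
        have hn1 := (hx.count_pos true s).ne'
        have hn0 := (hx.count_pos false s).ne'
        have hp := (hx.firstStage_pos s).ne'
        rw [piD1Hat_eq, piD0Hat_eq] at hp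
        refine (mul_eq_zero.1 (?_ : v (Sum.inr s) * (x.cellTreated true s / x.cellCount true s
          - x.cellTreated false s / x.cellCount false s) = 0)).resolve_right hp
        have e1 := e1 s
        have e0 := e0 s
        field_simp
        linear_combination x.cellCount false s * e1 - x.cellCount true s * e0
      funext k
      rcases k with s | s
      · have e1 := e1 s
        rw [hr s, zero_mul, add_zero] at e1
        exact (mul_eq_zero.1 e1).resolve_right (hx.count_pos true s).ne'
      · exact hr s
    · funext k
      rcases k with s | s
      · rw [matSat_normal_inl, matSat_transpose_mulVec_inl, x.sum_indS_mul s fun _ y => y]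
        simp only [Sum.elim_inl, Sum.elim_inr]
        rw [h1, h0, cellOutcome, cellOutcome]
      · rw [matSat_normal_inr, matSat_transpose_mulVec_inr, x.sum_toReal_indS_mul s fun _ y => y]
        simp only [Sum.elim_inl, Sum.elim_inr]
        rw [h1, cellOutcome]
  have hb' : x.betaSatStratum s = b s := by rw [betaSatStratum, key, Sum.elim_inr]
  have hc' : x.gammaSat s = c s := by rw [gammaSat, key, Sum.elim_inl]
  refine ⟨hb', fun a => ?_⟩
  rw [hb', hc']
  cases a
  · exact h0 s
  · exact h1 s

/-- The first stage in the weight of a stratum cancels the denominator of its Wald ratio. -/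
lemma Regular.betaSat_eq (hx : x.Regular) :
    x.betaSat = (∑ s, x.nS s / n * (x.cellOutcome true s / x.cellCount true s -
      x.cellOutcome false s / x.cellCount false s)) / x.probCHat := by
  rw [betaSat, Finset.sum_div]
  refine Finset.sum_congr rfl fun s _ => ?_
  rw [(hx.sat_eq s).1, probSCHat]
  have := (hx.firstStage_pos s).ne'
  field_simp

/-! #### The strata fixed effects regression -/

variable (x)

lemma matSfe_mulVec (V : Fin n → Bool) (c : 𝒮 ⊕ Unit → ℝ) (i : Fin n) :
    (x.matSfe V *ᵥ c) i = c (Sum.inl (x.S i)) + toReal (V i) * c (Sum.inr ()) := by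
  simp [matSfe, Matrix.mulVec, dotProduct, indS]

lemma matSfe_transpose_mulVec_inl (V : Fin n → Bool) (y : Fin n → ℝ) (s : 𝒮) :
    ((x.matSfe V)ᵀ *ᵥ y) (Sum.inl s) = ∑ i, x.indS i s * y i := by
  simp [matSfe, Matrix.mulVec, dotProduct]

lemma matSfe_transpose_mulVec_inr (V : Fin n → Bool) (y : Fin n → ℝ) :
    ((x.matSfe V)ᵀ *ᵥ y) (Sum.inr ()) = ∑ s, ∑ i, toReal (V i) * x.indS i s * y i := by
  rw [Finset.sum_comm]
  simp [matSfe, Matrix.mulVec, dotProduct, indS]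

lemma matSfe_normal_inl (c : 𝒮 ⊕ Unit → ℝ) (s : 𝒮) :
    ((x.matSfe x.A)ᵀ *ᵥ (x.matSfe x.D *ᵥ c)) (Sum.inl s) =
      (c (Sum.inl s) * x.cellCount true s + c (Sum.inr ()) * x.cellTreated true s) +
      (c (Sum.inl s) * x.cellCount false s + c (Sum.inr ()) * x.cellTreated false s) := by
  rw [matSfe_transpose_mulVec_inl]
  have := x.sum_indS_mul s fun d _ => c (Sum.inl s) * 1 + c (Sum.inr ()) * toReal d
  rw [cellSum_add, cellSum_add] at this
  simp only [cellSum_const_mul] at this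
  rw [cellCount, cellTreated, cellCount, cellTreated, ← this]
  refine Finset.sum_congr rfl fun i _ => ?_
  rw [matSfe_mulVec]
  by_cases h : x.S i = s
  · simp [h, mul_comm]
  · simp [indS, h]

lemma matSfe_normal_inr (c : 𝒮 ⊕ Unit → ℝ) :
    ((x.matSfe x.A)ᵀ *ᵥ (x.matSfe x.D *ᵥ c)) (Sum.inr ()) =
      ∑ s, (c (Sum.inl s) * x.cellCount true s + c (Sum.inr ()) * x.cellTreated true s) := by
  rw [matSfe_transpose_mulVec_inr]
  refine Finset.sum_congr rfl fun s _ => ?_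
  have := x.sum_toReal_indS_mul s fun d _ => c (Sum.inl s) * 1 + c (Sum.inr ()) * toReal d
  rw [cellSum_add] at this
  simp only [cellSum_const_mul] at this
  rw [cellCount, cellTreated, ← this]
  refine Finset.sum_congr rfl fun i _ => ?_
  rw [matSfe_mulVec]
  by_cases h : x.S i = s
  · simp [h, mul_comm]
  · simp [indS, h]

/-- Within-stratum covariance sums with the assignment, for cell sums `f`. -/
def withinSum (f : Bool → 𝒮 → ℝ) : ℝ :=
  ∑ s, ((1 - x.nA s / x.nS s) * f true s - x.nA s / x.nS s * f false s)

variable {x}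

/-- Frisch-Waugh: each stratum equation determines its fixed effect, and substitution into the last
equation leaves a scalar equation between within-stratum covariances with the assignment. -/
lemma Regular.betaSfe_eq (hx : x.Regular) (hden : x.withinSum x.cellTreated ≠ 0) :
    x.betaSfe = x.withinSum x.cellOutcome / x.withinSum x.cellTreated := by
  have hq : ∀ s, x.nA s / x.nS s * (x.cellCount true s + x.cellCount false s)
      = x.cellCount true s := by
    intro s
    rw [nA_eq_cellCount, nS_eq_cellCount]
    exact div_mul_cancel₀ _ (add_pos (hx.count_pos _ _) (hx.count_pos _ _)).ne'
  have hN : ∀ s, x.cellCount true s + x.cellCount false s ≠ 0 := fun s =>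
    (add_pos (hx.count_pos _ _) (hx.count_pos _ _)).ne'
  set b := x.withinSum x.cellOutcome / x.withinSum x.cellTreated with hb
  let c : 𝒮 → ℝ := fun s => (x.cellOutcome true s + x.cellOutcome false s
    - b * (x.cellTreated true s + x.cellTreated false s))
      / (x.cellCount true s + x.cellCount false s)
  have hc : ∀ s, c s * (x.cellCount true s + x.cellCount false s) =
      x.cellOutcome true s + x.cellOutcome false s
        - b * (x.cellTreated true s + x.cellTreated false s) := fun s =>
    div_mul_cancel₀ _ (hN s)
  have key : ivEstimator (x.matSfe x.A) (x.matSfe x.D) x.Y = Sum.elim c (fun _ => b) := by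
    refine ivEstimator_eq_of_normal_equations (fun v hv => ?_) ?_
    · have e1 : ∀ s, v (Sum.inl s) * (x.cellCount true s + x.cellCount false s) +
          v (Sum.inr ()) * (x.cellTreated true s + x.cellTreated false s) = 0 := fun s => by
        have h := x.matSfe_normal_inl v s
        rw [hv, Pi.zero_apply] at h
        linarith
      have hr : v (Sum.inr ()) = 0 := by
        refine (mul_eq_zero.1 (?_ : v (Sum.inr ()) * x.withinSum x.cellTreated = 0)).resolve_right
          hden
        have h := x.matSfe_normal_inr v
        rw [hv, Pi.zero_apply] at h
        rw [h, withinSum, Finset.mul_sum]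
        refine Finset.sum_congr rfl fun s _ => ?_
        -- Subtracting n_A(s)/n(s) times the stratum equation eliminates the fixed effect.
        linear_combination v (Sum.inl s) * hq s - x.nA s / x.nS s * e1 s
      funext k
      rcases k with s | _
      · have e1 := e1 s
        rw [hr, zero_mul, add_zero] at e1
        exact (mul_eq_zero.1 e1).resolve_right (hN s)
      · exact hr
    · funext k
      rcases k with s | _
      · rw [matSfe_normal_inl, matSfe_transpose_mulVec_inl, x.sum_indS_mul s fun _ y => y]
        simp only [Sum.elim_inl, Sum.elim_inr]
        have := hc s
        simp only [cellOutcome] at this ⊢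
        linarith
      · rw [matSfe_normal_inr, matSfe_transpose_mulVec_inr]
        simp only [Sum.elim_inl, Sum.elim_inr]
        simp_rw [x.sum_toReal_indS_mul _ fun _ y => y]
        have hbb : b * x.withinSum x.cellTreated = x.withinSum x.cellOutcome :=
          div_mul_cancel₀ _ hden
        rw [← sub_eq_zero, ← Finset.sum_sub_distrib]
        have h0 : b * x.withinSum x.cellTreated - x.withinSum x.cellOutcome = 0 := sub_eq_zero.2 hbb
        rw [withinSum, withinSum, Finset.mul_sum, ← Finset.sum_sub_distrib] at h0
        rw [← h0]
        refine Finset.sum_congr rfl fun s _ => ?_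
        have h2 := hc s
        simp only [cellOutcome] at h2 ⊢
        linear_combination (-c s) * hq s + x.nA s / x.nS s * h2
  rw [betaSfe, key, Sum.elim_inr]

/-! #### The two sample regression -/

lemma matTwoS_mulVec (V : Fin n → Bool) (c : Unit ⊕ Unit → ℝ) (i : Fin n) :
    (matTwoS V *ᵥ c) i = c (Sum.inl ()) + toReal (V i) * c (Sum.inr ()) := by
  simp [matTwoS, Matrix.mulVec, dotProduct]

variable (x)

lemma sum_eq_sum_cellSum (g : Bool → ℝ → ℝ) :
    ∑ i, g (x.D i) (x.Y i) = ∑ s, x.cellSum true s g + ∑ s, x.cellSum false s g := by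
  rw [← Finset.sum_add_distrib]
  simp_rw [← sum_indS_mul]
  rw [Finset.sum_comm]
  exact Finset.sum_congr rfl fun i _ => by simp [indS]

lemma sum_toReal_eq_sum_cellSum (g : Bool → ℝ → ℝ) :
    ∑ i, toReal (x.A i) * g (x.D i) (x.Y i) = ∑ s, x.cellSum true s g := by
  simp_rw [← sum_toReal_indS_mul]
  rw [Finset.sum_comm]
  exact Finset.sum_congr rfl fun i _ => by simp [indS]

/-- The share of participants with `A_i = 1`. -/
def assignedShare : ℝ := (∑ s, x.cellCount true s) / n

/-- Covariance sums with the assignment, for cell sums `f`. -/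
def totalSum (f : Bool → 𝒮 → ℝ) : ℝ :=
  ∑ s, ((1 - x.assignedShare) * f true s - x.assignedShare * f false s)

lemma natCast_eq_sum_cellCount :
    (n : ℝ) = ∑ s, x.cellCount true s + ∑ s, x.cellCount false s := by
  simpa [cellCount] using x.sum_eq_sum_cellSum fun _ _ => 1

variable {x}

lemma totalSum_eq (f : Bool → 𝒮 → ℝ) : x.totalSum f =
    (1 - x.assignedShare) * ∑ s, f true s - x.assignedShare * ∑ s, f false s := by
  rw [totalSum, Finset.sum_sub_distrib, Finset.mul_sum, Finset.mul_sum]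

/-- The same elimination with a single intercept: the slope is a ratio of covariances with the
assignment over the whole sample. -/
lemma betaTwoS_eq (hn : (n : ℝ) ≠ 0) (hden : x.totalSum x.cellTreated ≠ 0) :
    x.betaTwoS = x.totalSum x.cellOutcome / x.totalSum x.cellTreated := by
  have hq : x.assignedShare * n = ∑ s, x.cellCount true s := div_mul_cancel₀ _ hn
  have tl : ∀ y : Fin n → ℝ, ((matTwoS x.A)ᵀ *ᵥ y) (Sum.inl ()) = ∑ i, y i := fun y => by
    simp [matTwoS, Matrix.mulVec, dotProduct]
  have tr : ∀ y : Fin n → ℝ, ((matTwoS x.A)ᵀ *ᵥ y) (Sum.inr ()) = ∑ i, toReal (x.A i) * y i :=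
    fun y => by simp [matTwoS, Matrix.mulVec, dotProduct]
  have nl : ∀ c, ((matTwoS x.A)ᵀ *ᵥ (matTwoS x.D *ᵥ c)) (Sum.inl ()) =
      c (Sum.inl ()) * n +
        c (Sum.inr ()) * (∑ s, x.cellTreated true s + ∑ s, x.cellTreated false s) := by
    intro c
    rw [tl, x.natCast_eq_sum_cellCount]
    have := x.sum_eq_sum_cellSum fun d _ => c (Sum.inl ()) * 1 + c (Sum.inr ()) * toReal d
    simp only [cellSum_add, cellSum_const_mul, Finset.sum_add_distrib, ← Finset.mul_sum] at this
    simp only [matTwoS_mulVec, Finset.sum_add_distrib, ← Finset.sum_mul]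
    simp only [cellCount, cellTreated]
    have h1 : ∑ _i : Fin n, c (Sum.inl ()) = c (Sum.inl ()) * ∑ _i : Fin n, (1 : ℝ) := by
      simp [mul_comm]
    linarith
  have nr : ∀ c, ((matTwoS x.A)ᵀ *ᵥ (matTwoS x.D *ᵥ c)) (Sum.inr ()) =
      c (Sum.inl ()) * ∑ s, x.cellCount true s + c (Sum.inr ()) * ∑ s, x.cellTreated true s := by
    intro c
    rw [tr]
    have := x.sum_toReal_eq_sum_cellSum fun d _ => c (Sum.inl ()) * 1 + c (Sum.inr ()) * toReal d
    simp only [cellSum_add, cellSum_const_mul, Finset.sum_add_distrib, ← Finset.mul_sum] at this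
    simp only [cellCount, cellTreated]
    rw [← this]
    refine Finset.sum_congr rfl fun i _ => ?_
    rw [matTwoS_mulVec]
    ring
  rw [totalSum_eq] at hden
  rw [totalSum_eq, totalSum_eq]
  set b := ((1 - x.assignedShare) * ∑ s, x.cellOutcome true s
      - x.assignedShare * ∑ s, x.cellOutcome false s) / ((1 - x.assignedShare) *
      ∑ s, x.cellTreated true s - x.assignedShare * ∑ s, x.cellTreated false s) with hb
  have hbb : b * ((1 - x.assignedShare) * ∑ s, x.cellTreated true s
      - x.assignedShare * ∑ s, x.cellTreated false s) = (1 - x.assignedShare) *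
      ∑ s, x.cellOutcome true s - x.assignedShare * ∑ s, x.cellOutcome false s :=
    div_mul_cancel₀ _ hden
  let c : ℝ := (∑ s, x.cellOutcome true s + ∑ s, x.cellOutcome false s -
    b * (∑ s, x.cellTreated true s + ∑ s, x.cellTreated false s)) / n
  have hc : c * n = ∑ s, x.cellOutcome true s + ∑ s, x.cellOutcome false s -
    b * (∑ s, x.cellTreated true s + ∑ s, x.cellTreated false s) := div_mul_cancel₀ _ hn
  have key : ivEstimator (matTwoS x.A) (matTwoS x.D) x.Y = Sum.elim (fun _ => c) (fun _ => b) := by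
    refine ivEstimator_eq_of_normal_equations (fun v hv => ?_) ?_
    · have e1 := nl v
      have e2 := nr v
      rw [hv, Pi.zero_apply] at e1 e2
      have hr : v (Sum.inr ()) = 0 := by
        refine (mul_eq_zero.1 (?_ : v (Sum.inr ()) * ((1 - x.assignedShare) *
          ∑ s, x.cellTreated true s - x.assignedShare * ∑ s, x.cellTreated false s)
            = 0)).resolve_right hden
        linear_combination (-1 : ℝ) * e2 + x.assignedShare * e1 + v (Sum.inl ()) * hq
      funext k
      rcases k with _ | _
      · rw [hr, zero_mul, add_zero] at e1
        exact (mul_eq_zero.1 e1.symm).resolve_right hn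
      · exact hr
    · funext k
      rcases k with _ | _
      · rw [nl, tl, x.sum_eq_sum_cellSum fun _ y => y]
        simp only [Sum.elim_inl, Sum.elim_inr]
        simp only [cellOutcome] at hc ⊢
        linarith
      · rw [nr, tr, x.sum_toReal_eq_sum_cellSum fun _ y => y]
        simp only [Sum.elim_inl, Sum.elim_inr]
        simp only [cellOutcome] at hc hbb ⊢
        linear_combination (-c) * hq + x.assignedShare * hc + hbb
  rw [betaTwoS, key, Sum.elim_inr]

end Sample

/-- The variance of `Y - β D` within a cell in terms of the residuals of the saturated
regression. -/
lemma cell_variance_identity {N C L LT q qT γ b β p z : ℝ} (hN : N ≠ 0) (hp : p = C / N)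
    (hL : γ * N + b * C = L) (hz : z = ((L - LT) - γ * (N - C)) / N) :
    ((q - qT) - 2 * γ * (L - LT) + γ ^ 2 * (N - C)) / N
      + (qT - 2 * (γ + b) * LT + (γ + b) ^ 2 * C) / N
      - 2 * z * (b - β) + (1 - p) * p * (b - β) ^ 2
      = (q - 2 * β * LT + β ^ 2 * C) / N - ((L - β * C) / N) ^ 2 := by
  subst hz hp hL
  field_simp
  ring

/-! ### Plug-in formulas as empirical variances within cells. -/

namespace Sample

variable {𝒮 : Type w} [Fintype 𝒮] [DecidableEq 𝒮] {n : ℕ} (x : Sample 𝒮 n)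

/-- A vanishing sum of nonnegative treatment indicators forces each of them to vanish. -/
lemma cellSum_toReal_mul_eq_zero {a : Bool} {s : 𝒮} (h : x.cellTreated a s = 0)
    (g : Bool → ℝ → ℝ) : x.cellSum a s (fun d y => toReal d * g d y) = 0 := by
  rw [cellTreated, cellSum, Finset.sum_eq_zero_iff_of_nonneg fun i _ => by
    split_ifs
    · cases x.D i <;> simp
    · exact le_rfl] at h
  refine Finset.sum_eq_zero fun i hi => ?_
  have := h i hi
  split_ifs at this ⊢
  · simp [this]
  · rfl

lemma cellSum_one_sub_toReal_mul_eq_zero {a : Bool} {s : 𝒮}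
    (h : x.cellCount a s = x.cellTreated a s)
    (g : Bool → ℝ → ℝ) : x.cellSum a s (fun d y => (1 - toReal d) * g d y) = 0 := by
  have h' : x.cellSum a s (fun d _ => 1 - toReal d) = 0 := by
    have := x.cellSum_add a s (fun _ _ => 1) (fun d _ => (-1) * toReal d)
    rw [cellSum_const_mul] at this
    rw [cellCount, cellTreated] at h
    have e : (fun (d : Bool) (_ : ℝ) => 1 - toReal d) = fun d _ => 1 + (-1) * toReal d := by
      funext d y; ring
    rw [e, this]
    linarith
  rw [cellSum, Finset.sum_eq_zero_iff_of_nonneg fun i _ => by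
    split_ifs
    · cases x.D i <;> simp
    · exact le_rfl] at h'
  refine Finset.sum_eq_zero fun i hi => ?_
  have := h' i hi
  split_ifs at this ⊢
  · simp [this]
  · rfl

/-- The sum of `D_i Y_i` over a cell. -/
def cellTreatedOutcome (a : Bool) (s : 𝒮) : ℝ := x.cellSum a s fun d y => toReal d * y

/-- The sum of `Y_i ^ 2` over a cell. -/
def cellSq (a : Bool) (s : 𝒮) : ℝ := x.cellSum a s fun _ y => y ^ 2

/-- The sum of `D_i Y_i ^ 2` over a cell. -/
def cellTreatedSq (a : Bool) (s : 𝒮) : ℝ := x.cellSum a s fun d y => toReal d * y ^ 2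

lemma resid_eq (i : Fin n) :
    x.resid i = x.Y i - x.gammaSat (x.S i) - toReal (x.D i) * x.betaSatStratum (x.S i) := by
  simp [resid, indS]

lemma residMoment_eq (b : ℕ) (d a : Bool) (s : 𝒮) : x.residMoment b d a s =
    1 / n * x.cellSum a s fun d' y => if d' = d then
      (y - x.gammaSat s - toReal d' * x.betaSatStratum s) ^ b else 0 := by
  rw [residMoment, cellSum]
  congr 1
  refine Finset.sum_congr rfl fun i _ => ?_
  rw [resid_eq]
  by_cases h1 : x.D i = d <;> by_cases h2 : x.A i = a <;> by_cases h3 : x.S i = s <;>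
    simp [h1, h2, h3]

lemma residMoment_one_true (a : Bool) (s : 𝒮) : x.residMoment 1 true a s =
    1 / n * (x.cellTreatedOutcome a s
      - (x.gammaSat s + x.betaSatStratum s) * x.cellTreated a s) := by
  rw [residMoment_eq]
  have h : (fun (d' : Bool) (y : ℝ) => if d' = true then
      (y - x.gammaSat s - toReal d' * x.betaSatStratum s) ^ 1 else 0)
      = fun d' y => toReal d' * y + (-(x.gammaSat s + x.betaSatStratum s)) * toReal d' := by
    funext d' y
    cases d' <;> simp
    ring
  rw [h, cellSum_add, cellSum_const_mul, cellTreatedOutcome, cellTreated]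
  ring

lemma residMoment_one_false (a : Bool) (s : 𝒮) : x.residMoment 1 false a s =
    1 / n * ((x.cellOutcome a s - x.cellTreatedOutcome a s)
      - x.gammaSat s * (x.cellCount a s - x.cellTreated a s)) := by
  rw [residMoment_eq]
  have h : (fun (d' : Bool) (y : ℝ) => if d' = false then
      (y - x.gammaSat s - toReal d' * x.betaSatStratum s) ^ 1 else 0)
      = fun d' y => ((y + (-1) * (toReal d' * y)) + (-x.gammaSat s) * 1)
        + x.gammaSat s * toReal d' := by
    funext d' y
    cases d' <;> simp
    ring
  rw [h, cellSum_add, cellSum_add, cellSum_add, cellSum_const_mul, cellSum_const_mul,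
    cellSum_const_mul, cellTreatedOutcome, cellTreated, cellOutcome, cellCount]
  ring

lemma residMoment_two_true (a : Bool) (s : 𝒮) : x.residMoment 2 true a s =
    1 / n * (x.cellTreatedSq a s
      - 2 * (x.gammaSat s + x.betaSatStratum s) * x.cellTreatedOutcome a s
      + (x.gammaSat s + x.betaSatStratum s) ^ 2 * x.cellTreated a s) := by
  rw [residMoment_eq]
  have h : (fun (d' : Bool) (y : ℝ) => if d' = true then
      (y - x.gammaSat s - toReal d' * x.betaSatStratum s) ^ 2 else 0)
      = fun d' y => (toReal d' * y ^ 2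
        + (-2 * (x.gammaSat s + x.betaSatStratum s)) * (toReal d' * y))
        + (x.gammaSat s + x.betaSatStratum s) ^ 2 * toReal d' := by
    funext d' y
    cases d' <;> simp
    ring
  rw [h, cellSum_add, cellSum_add, cellSum_const_mul, cellSum_const_mul, cellTreatedSq,
    cellTreatedOutcome, cellTreated]
  ring

lemma residMoment_two_false (a : Bool) (s : 𝒮) : x.residMoment 2 false a s =
    1 / n * ((x.cellSq a s - x.cellTreatedSq a s)
      - 2 * x.gammaSat s * (x.cellOutcome a s - x.cellTreatedOutcome a s)
      + x.gammaSat s ^ 2 * (x.cellCount a s - x.cellTreated a s)) := by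
  rw [residMoment_eq]
  have h : (fun (d' : Bool) (y : ℝ) => if d' = false then
      (y - x.gammaSat s - toReal d' * x.betaSatStratum s) ^ 2 else 0)
      = fun d' y => ((((y ^ 2 + (-1) * (toReal d' * y ^ 2)) + (-2 * x.gammaSat s) * y)
        + (2 * x.gammaSat s) * (toReal d' * y)) + x.gammaSat s ^ 2 * 1)
        + (-x.gammaSat s ^ 2) * toReal d' := by
    funext d' y
    cases d' <;> simp
    ring
  rw [h]
  simp only [cellSum_add, cellSum_const_mul]
  rw [cellSq, cellTreatedSq, cellTreatedOutcome, cellTreated, cellOutcome, cellCount]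
  ring

/-- Serves the degenerate samples in which a plug-in formula divides by zero: the sums it multiplies
are then zero as well, so the default value of the quotient does no harm. -/
lemma cell_eq_of_treated_eq_zero {a : Bool} {s : 𝒮} (h : x.cellTreated a s = 0) :
    x.cellTreatedOutcome a s = 0 ∧ x.cellTreatedSq a s = 0 :=
  ⟨x.cellSum_toReal_mul_eq_zero h fun _ y => y, x.cellSum_toReal_mul_eq_zero h fun _ y => y ^ 2⟩

lemma cell_eq_of_count_eq_treated {a : Bool} {s : 𝒮} (h : x.cellCount a s = x.cellTreated a s) :
    x.cellOutcome a s = x.cellTreatedOutcome a s ∧ x.cellSq a s = x.cellTreatedSq a s := by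
  have h1 := x.cellSum_one_sub_toReal_mul_eq_zero h fun _ y => y
  have h2 := x.cellSum_one_sub_toReal_mul_eq_zero h fun _ y => y ^ 2
  have e1 : (fun (d : Bool) (y : ℝ) => (1 - toReal d) * y)
      = fun d y => y + (-1) * (toReal d * y) := by funext d y; ring
  have e2 : (fun (d : Bool) (y : ℝ) => (1 - toReal d) * y ^ 2)
      = fun d y => y ^ 2 + (-1) * (toReal d * y ^ 2) := by funext d y; ring
  rw [e1, cellSum_add, cellSum_const_mul] at h1
  rw [e2, cellSum_add, cellSum_const_mul] at h2
  exact ⟨by rw [cellOutcome, cellTreatedOutcome]; linarith,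
    by rw [cellSq, cellTreatedSq]; linarith⟩

/-- The empirical variance of `Y - β D` in a cell. -/
def cellVar (β : ℝ) (a : Bool) (s : 𝒮) : ℝ :=
  (x.cellSq a s - 2 * β * x.cellTreatedOutcome a s + β ^ 2 * x.cellTreated a s) / x.cellCount a s
    - ((x.cellOutcome a s - β * x.cellTreated a s) / x.cellCount a s) ^ 2

variable {x}

/-- The estimated always-taker variance and the squared difference of the complier and always-taker
means enter Π_1 twice and cancel. What remains are the second residual moments of the cell A = 1 and
z, the sum of its untreated residuals over its size, and `cell_variance_identity` reassembles them
into a variance. -/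
theorem Regular.Pi1_primitivesHat (hx : x.Regular) (β : ℝ) (s : 𝒮) :
    Pi1 (x.primitivesHat s) β = x.cellVar β true s := by
  have hn := hx.natCast_ne_zero s
  have hN := (hx.count_pos true s).ne'
  have hp := (hx.firstStage_pos s).ne'
  have hp1 := (hx.piD1Hat_pos s).ne'
  have hL := (hx.sat_eq s).2 true
  have hpe := x.piD1Hat_eq s
  set N := x.cellCount true s
  set C := x.cellTreated true s
  set L := x.cellOutcome true s
  set LT := x.cellTreatedOutcome true s with hLT
  set q := x.cellSq true s with hq
  set qT := x.cellTreatedSq true s with hqT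
  set γ := x.gammaSat s
  set b := x.betaSatStratum s
  set p := x.piD1Hat s
  set p0 := x.piD0Hat s
  set mN := x.meanY0NTHat s with hmN
  set mA := x.meanY1ATHat s
  set m0 := x.meanY0CHat s with hm0
  have hm1 : x.meanY1CHat s = b + m0 := rfl
  have hdeg : N = C → L = LT ∧ q = qT := x.cell_eq_of_count_eq_treated
  -- This is the definition of the estimated untreated complier mean, solved for H.
  have hH : p0 * (b + m0 - mA) - p * (m0 - mN) = mN - γ := by
    have : (p - p0) * m0 = γ + p0 * b - (1 - p) * mN - p0 * mA := by
      rw [hm0, meanY0CHat, one_div, mul_inv_cancel_left₀ hp]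
    linear_combination (-1 : ℝ) * this
  -- Residuals sum to zero in the cell, so the treated ones sum to minus the untreated ones; this is
  -- why the difference of the two moments is scaled by n/2. Without never-takers in the cell both
  -- sides are zero.
  have hmNT : (N - C) * (mN - γ) = L - LT - γ * (N - C) := by
    by_cases h : N = C
    · rw [(hdeg h).1, h]; ring
    · have h' : N - C ≠ 0 := sub_ne_zero.2 h
      rw [hmN, meanY0NTHat, residMoment_one_false, residMoment_one_true, nA_eq_cellCount,
        nAD_eq_cellTreated]
      change (N - C) * ((n / 2 / (N - C) * (1 / n * ((L - LT) - γ * (N - C)) -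
        1 / n * (LT - (γ + b) * C)) + γ) - γ) = _
      field_simp
      linear_combination hL
  have hz : (1 - p) * (mN - γ) = ((L - LT) - γ * (N - C)) / N := by
    rw [← hmNT, hpe]
    field_simp
  have hvN : (1 - p) * x.varY0NTHat s = ((q - qT) - 2 * γ * (L - LT) + γ ^ 2 * (N - C)) / N
      - (1 - p) * (mN - γ) ^ 2 := by
    rw [varY0NTHat, hm1, hH, residMoment_two_false, nA_eq_cellCount, nAD_eq_cellTreated, mul_sub,
      hpe]
    congr 1
    by_cases h : N = C
    · rw [(hdeg h).1, (hdeg h).2, h]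
      have : C ≠ 0 := h ▸ hN
      simp [div_self this]
    · have h' : N - C ≠ 0 := sub_ne_zero.2 h
      change (1 - C / N) * (n / (N - C) * (1 / n * ((q - qT) - 2 * γ * (L - LT)
        + γ ^ 2 * (N - C)))) = _
      field_simp
  have hvC : (p - p0) * x.varY1CHat s = (qT - 2 * (γ + b) * LT + (γ + b) ^ 2 * C) / N
      - (1 - p) ^ 2 / p * (mN - γ) ^ 2 - p0 * (p - p0) / p * (b + m0 - mA) ^ 2
      - p0 * x.varY1ATHat s := by
    rw [varY1CHat, hm1, hH, residMoment_two_true, nA_eq_cellCount, one_div,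
      mul_inv_cancel_left₀ hp]
    change n / N * (1 / n * (qT - 2 * (γ + b) * LT + (γ + b) ^ 2 * C)) - _ - _ - _ = _
    congr 3
    field_simp
  have key := cell_variance_identity (q := q) (qT := qT) (β := β) hN hpe hL hz
  rw [Pi1, cellVar, ← key]
  change x.varY1ATHat s * p0 + x.varY0NTHat s * (1 - p) + x.varY1CHat s * (p - p0)
      + (b + m0 - mA) ^ 2 * (p0 * (p - p0) / p)
    + (1 - p) / p * (-p0 * (b + m0 - mA) + p * (m0 - mN) + p * (b - β)) ^ 2 = _
  -- The squared term of Π_1 depends on the estimated means only through H.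
  have hB : -p0 * (b + m0 - mA) + p * (m0 - mN) + p * (b - β) = -(mN - γ) + p * (b - β) := by
    linear_combination (-1 : ℝ) * hH
  rw [hB]
  have hpp : p * p⁻¹ = 1 := mul_inv_cancel₀ hp1
  rw [div_eq_mul_inv _ p] at hvC ⊢
  rw [div_eq_mul_inv _ p] at hvC ⊢
  linear_combination hvN + hvC + (1 - p) * ((mN - γ) ^ 2 - 2 * (mN - γ) * (b - β)
    + p * (b - β) ^ 2) * hpp

/-- The mirror image of `Regular.Pi1_primitivesHat`: now the never-taker terms cancel, G takes the
role of H, and the degenerate case is a control cell without treated participants. -/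
theorem Regular.Pi2_primitivesHat (hx : x.Regular) (β : ℝ) (s : 𝒮) :
    Pi2 (x.primitivesHat s) β = x.cellVar β false s := by
  have hn := hx.natCast_ne_zero s
  have hN := (hx.count_pos false s).ne'
  have hN1 := (hx.count_pos true s).ne'
  have hnS := (hx.nS_pos s).ne'
  have hp := (hx.firstStage_pos s).ne'
  have hp0 := (sub_pos.2 (hx.piD0Hat_lt s)).ne'
  have hL := (hx.sat_eq s).2 false
  have hpe := x.piD0Hat_eq s
  have hpe1 := x.piD1Hat_eq s
  have hnSe := x.nS_eq_cellCount s
  set N := x.cellCount false s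
  set C := x.cellTreated false s
  set L := x.cellOutcome false s
  set LT := x.cellTreatedOutcome false s with hLT
  set q := x.cellSq false s with hq
  set qT := x.cellTreatedSq false s with hqT
  set γ := x.gammaSat s
  set b := x.betaSatStratum s
  set p := x.piD1Hat s
  set p0 := x.piD0Hat s
  set mN := x.meanY0NTHat s
  set mA := x.meanY1ATHat s with hmA
  set m0 := x.meanY0CHat s with hm0
  have hm1 : x.meanY1CHat s = b + m0 := rfl
  have hdeg : C = 0 → LT = 0 ∧ qT = 0 := x.cell_eq_of_treated_eq_zero
  have hG : (1 - p0) * (b + m0 - mA) - (1 - p) * (m0 - mN) = γ + b - mA := by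
    have : (p - p0) * m0 = γ + p0 * b - (1 - p) * mN - p0 * mA := by
      rw [hm0, meanY0CHat, one_div, mul_inv_cancel_left₀ hp]
    linear_combination this
  have hmAT : C * (γ + b - mA) = (L - LT) - γ * (N - C) := by
    by_cases h : C = 0
    · rw [(hdeg h).1, h]
      linear_combination hL - b * h
    · rw [hmA, meanY1ATHat, residMoment_one_false, residMoment_one_true, nD_eq_cellTreated,
        nAD_eq_cellTreated, add_sub_cancel_left]
      change C * (γ + b - (n / 2 / C * (1 / n * (LT - (γ + b) * C) -
        1 / n * ((L - LT) - γ * (N - C))) + b + γ)) = _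
      field_simp
      linear_combination hL
  have hz : p0 * (γ + b - mA) = ((L - LT) - γ * (N - C)) / N := by
    rw [← hmAT, hpe]
    field_simp
  have hvA : p0 * x.varY1ATHat s = (qT - 2 * (γ + b) * LT + (γ + b) ^ 2 * C) / N
      - p0 * (γ + b - mA) ^ 2 := by
    rw [varY1ATHat, hm1, hG, residMoment_two_true, nA_eq_cellCount, mul_sub]
    congr 1
    -- The denominator in the estimator of the always-taker variance is the fraction of the sample
    -- with A = 0, D = 1 in this stratum.
    have hd : x.nS s / n * (1 - x.cellCount true s / x.nS s) * x.piD0Hat s = C / n := by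
      change x.nS s / n * (1 - x.cellCount true s / x.nS s) * p0 = C / n
      rw [hpe]
      field_simp
      rw [hnSe]
      ring
    rw [hd]
    change p0 * (1 / (C / n) * (1 / n * (qT - 2 * (γ + b) * LT + (γ + b) ^ 2 * C))) = _
    by_cases h : C = 0
    · rw [(hdeg h).1, (hdeg h).2, h]
      simp
    · rw [hpe]
      field_simp
  have hvC : (p - p0) * x.varY0CHat s = ((q - qT) - 2 * γ * (L - LT) + γ ^ 2 * (N - C)) / N
      - p0 ^ 2 / (1 - p0) * (γ + b - mA) ^ 2 - (1 - p) * (p - p0) / (1 - p0) * (m0 - mN) ^ 2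
      - (1 - p) * x.varY0NTHat s := by
    have hr : (x.nA s - x.nAD s) / x.nA s = 1 - p := by
      rw [nA_eq_cellCount, nAD_eq_cellTreated, hpe1]
      field_simp
    rw [varY0CHat, hm1, hG, hr, residMoment_two_false, nA_eq_cellCount, hnSe, add_sub_cancel_left,
      one_div, mul_inv_cancel_left₀ hp]
    change n / N * (1 / n * ((q - qT) - 2 * γ * (L - LT) + γ ^ 2 * (N - C))) - _ - _ - _ = _
    congr 3
    field_simp
  have key := cell_variance_identity (q := q) (qT := qT) (β := β) hN hpe hL hz
  rw [Pi2, cellVar, ← key]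
  change x.varY1ATHat s * p0 + x.varY0NTHat s * (1 - p) + x.varY0CHat s * (p - p0)
      + (m0 - mN) ^ 2 * ((1 - p) * (p - p0) / (1 - p0))
    + p0 / (1 - p0) * (-(1 - p0) * (b + m0 - mA) + (1 - p) * (m0 - mN) + (1 - p0) * (b - β)) ^ 2
      = _
  have hB : -(1 - p0) * (b + m0 - mA) + (1 - p) * (m0 - mN) + (1 - p0) * (b - β)
      = -(γ + b - mA) + (1 - p0) * (b - β) := by
    linear_combination (-1 : ℝ) * hG
  rw [hB]
  have hpp : (1 - p0) * (1 - p0)⁻¹ = 1 := mul_inv_cancel₀ hp0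
  rw [div_eq_mul_inv _ (1 - p0)] at hvC ⊢
  rw [div_eq_mul_inv _ (1 - p0)] at hvC ⊢
  linear_combination hvA + hvC + p0 * ((γ + b - mA) ^ 2 - 2 * (γ + b - mA) * (b - β)
    + (1 - p0) * (b - β) ^ 2) * hpp

end Sample

/-! ### The optimal propensities -/

/-- With r = √a and q = √b the optimum is r/(r + q), with value (r + q)². The excess at x is (r(1 -
x) - q x)²/(x(1 - x)), which vanishes only at the optimum. -/
lemma variance_lt_of_ne_optimum {a b x : ℝ} (ha : 0 < a) (hb : 0 < b) (hx : x ∈ Set.Ioo (0 : ℝ) 1)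
    (hne : x ≠ (1 + √(b / a))⁻¹) :
    a / (1 + √(b / a))⁻¹ + b / (1 - (1 + √(b / a))⁻¹) < a / x + b / (1 - x) := by
  obtain ⟨hx0, hx1⟩ := hx
  have hr : 0 < √a := Real.sqrt_pos.2 ha
  have hq : 0 < √b := Real.sqrt_pos.2 hb
  have hr2 : √a ^ 2 = a := Real.sq_sqrt ha.le
  have hq2 : √b ^ 2 = b := Real.sq_sqrt hb.le
  rw [Real.sqrt_div hb.le] at hne ⊢
  set r := √a
  set q := √b
  have hopt : (1 + q / r)⁻¹ = r / (r + q) := by field_simp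
  rw [hopt] at hne ⊢
  have h1 : 1 - r / (r + q) = q / (r + q) := by field_simp; ring
  rw [h1, ← hr2, ← hq2]
  have hval : r ^ 2 / (r / (r + q)) + q ^ 2 / (q / (r + q)) = (r + q) ^ 2 := by field_simp
  rw [hval]
  have hx1' : 0 < 1 - x := sub_pos.2 hx1
  have hd : r ^ 2 / x + q ^ 2 / (1 - x) - (r + q) ^ 2
      = (r * (1 - x) - q * x) ^ 2 / (x * (1 - x)) := by
    field_simp
    ring
  have hnz : r * (1 - x) - q * x ≠ 0 := by
    intro h
    apply hne
    rw [eq_div_iff (by positivity)]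
    linarith
  have : 0 < (r * (1 - x) - q * x) ^ 2 / (x * (1 - x)) := by positivity
  linarith

lemma optimum_mem_Ioo {a b : ℝ} (ha : 0 < a) (hb : 0 < b) :
    (1 + √(b / a))⁻¹ ∈ Set.Ioo (0 : ℝ) 1 := by
  have : 0 < √(b / a) := Real.sqrt_pos.2 (div_pos hb ha)
  exact ⟨by positivity, inv_lt_one_of_one_lt₀ (by linarith)⟩

section Formulas

variable {𝒮 : Type w} [Fintype 𝒮]

/-- Strata separate and only the first two summands involve the propensity, so the minimization is
one-dimensional in each stratum. -/
lemma Vsat_eq (θ : 𝒮 → Primitives) (β : ℝ) (pA : 𝒮 → ℝ) :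
    Vsat θ β pA = 1 / probC θ ^ 2 * ∑ s, ((θ s).p * (Pi1 (θ s) β / pA s)
      + (θ s).p * (Pi2 (θ s) β / (1 - pA s))
      + (θ s).p * (((θ s).piD1 - (θ s).piD0) * ((θ s).beta - β)) ^ 2) := by
  rw [Vsat, VY1, VY0, VD1, VD0, VH, ← mul_add, ← mul_add, ← mul_add, ← mul_add,
    ← Finset.sum_add_distrib, ← Finset.sum_add_distrib, ← Finset.sum_add_distrib,
    ← Finset.sum_add_distrib]
  congr 1
  refine Finset.sum_congr rfl fun s _ => ?_
  rw [Pi1, Pi2]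
  simp only [div_eq_mul_inv, mul_inv]
  ring

lemma Vsat_const_eq (θ : 𝒮 → Primitives) (β : ℝ) (x : ℝ) :
    Vsat θ β (fun _ => x) = 1 / probC θ ^ 2 * ((∑ s, (θ s).p * Pi1 (θ s) β) / x
      + (∑ s, (θ s).p * Pi2 (θ s) β) / (1 - x)
      + ∑ s, (θ s).p * (((θ s).piD1 - (θ s).piD0) * ((θ s).beta - β)) ^ 2) := by
  rw [Vsat_eq, Finset.sum_add_distrib, Finset.sum_add_distrib, Finset.sum_div, Finset.sum_div]
  simp only [mul_div_assoc]

lemma Vsat_optPropensity_lt {θ : 𝒮 → Primitives} {β : ℝ} (hp : ∀ s, 0 < (θ s).p)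
    (hC : 0 < probC θ) (h : ∀ s, 0 < Pi1 (θ s) β ∧ 0 < Pi2 (θ s) β) {pA : 𝒮 → ℝ}
    (hpA : ∀ s, pA s ∈ Set.Ioo (0 : ℝ) 1) (hne : pA ≠ fun s => optPropensity (θ s) β) :
    Vsat θ β (fun s => optPropensity (θ s) β) < Vsat θ β pA := by
  rw [Vsat_eq, Vsat_eq]
  refine mul_lt_mul_of_pos_left ?_ (by positivity)
  have hlt : ∀ s, pA s ≠ optPropensity (θ s) β →
      (θ s).p * (Pi1 (θ s) β / optPropensity (θ s) β)
      + (θ s).p * (Pi2 (θ s) β / (1 - optPropensity (θ s) β))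
      + (θ s).p * (((θ s).piD1 - (θ s).piD0) * ((θ s).beta - β)) ^ 2 <
      (θ s).p * (Pi1 (θ s) β / pA s) + (θ s).p * (Pi2 (θ s) β / (1 - pA s))
      + (θ s).p * (((θ s).piD1 - (θ s).piD0) * ((θ s).beta - β)) ^ 2 := by
    intro s hs
    have := mul_lt_mul_of_pos_left (variance_lt_of_ne_optimum (h s).1 (h s).2 (hpA s) hs) (hp s)
    rw [mul_add, mul_add] at this
    simpa [optPropensity] using this
  obtain ⟨s, hs⟩ := Function.ne_iff.1 hne
  refine Finset.sum_lt_sum (fun t _ => ?_) ⟨s, Finset.mem_univ s, hlt s hs⟩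
  by_cases ht : pA t = optPropensity (θ t) β
  · rw [ht]
  · exact (hlt t ht).le

lemma Vsat_optConstPropensity_lt {θ : 𝒮 → Primitives} {β : ℝ}
    (hC : 0 < probC θ) (h1 : 0 < ∑ s, (θ s).p * Pi1 (θ s) β)
    (h2 : 0 < ∑ s, (θ s).p * Pi2 (θ s) β) {x : ℝ} (hx : x ∈ Set.Ioo (0 : ℝ) 1)
    (hne : x ≠ optConstPropensity θ β) :
    Vsat θ β (fun _ => optConstPropensity θ β) < Vsat θ β (fun _ => x) := by
  rw [Vsat_const_eq, Vsat_const_eq]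
  refine mul_lt_mul_of_pos_left ?_ (by positivity)
  have := variance_lt_of_ne_optimum h1 h2 hx hne
  rw [optConstPropensity]
  linarith

end Formulas

/-! ### Population moments -/

/-- The function `g (D(a)) (Y(D(a)))` of the outcome that is observed under assignment `a`. -/
def observed {𝒵 : Type u} (g : Bool → ℝ → ℝ) (a : Bool) (w : Participant 𝒵) : ℝ :=
  g (w.2.1 a) (w.1 (w.2.1 a))

section Population

variable {𝒵 : Type u} [MeasurableSpace 𝒵]

lemma measurable_decision (a : Bool) : Measurable fun w : Participant 𝒵 => w.2.1 a :=
  (measurable_pi_apply a).comp (measurable_fst.comp measurable_snd)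

lemma measurable_outcome (d : Bool) : Measurable fun w : Participant 𝒵 => w.1 d :=
  (measurable_pi_apply d).comp measurable_fst

lemma measurable_observed {g : Bool → ℝ → ℝ} (hg : ∀ d, Measurable (g d)) (a : Bool) :
    Measurable (observed (𝒵 := 𝒵) g a) :=
  measurable_bool_comp (f := fun d (w : Participant 𝒵) => g d (w.1 d))
    (fun d => (hg d).comp (measurable_outcome d)) (measurable_decision a) measurable_id

lemma measurableSet_decision (a d : Bool) :
    MeasurableSet {w : Participant 𝒵 | w.2.1 a = d} :=
  (measurable_decision a) (measurableSet_singleton d)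

lemma measurableSet_compliers : MeasurableSet (compliers (𝒵 := 𝒵)) :=
  (measurableSet_decision false false).inter (measurableSet_decision true true)

lemma measurableSet_alwaysTakers : MeasurableSet (alwaysTakers (𝒵 := 𝒵)) :=
  (measurableSet_decision false true).inter (measurableSet_decision true true)

lemma measurableSet_neverTakers : MeasurableSet (neverTakers (𝒵 := 𝒵)) :=
  (measurableSet_decision false false).inter (measurableSet_decision true false)

lemma measurableSet_defiers : MeasurableSet (defiers (𝒵 := 𝒵)) :=
  (measurableSet_decision false true).inter (measurableSet_decision true false)

lemma memLp_observed {κ : Measure (Participant 𝒵)} [IsFiniteMeasure κ] {g : Bool → ℝ → ℝ}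
    {p : ENNReal} (hm : ∀ d, Measurable (g d)) (hg : ∀ d, MemLp (fun w => g d (w.1 d)) p κ)
    (a : Bool) : MemLp (observed g a) p κ := by
  have : MemLp (fun w : Participant 𝒵 => ‖g true (w.1 true)‖ + ‖g false (w.1 false)‖) p κ :=
    (hg true).norm.add (hg false).norm
  refine this.mono (measurable_observed hm a).aestronglyMeasurable (ae_of_all _ fun w => ?_)
  rw [Real.norm_of_nonneg (add_nonneg (norm_nonneg _) (norm_nonneg _)), observed]
  cases w.2.1 a <;> simp

/-! ### Decomposition of a law without defiers into compliance types. -/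

section Groups

variable {κ : Measure (Participant 𝒵)} [IsProbabilityMeasure κ]

/-- The event D(1) = 1 consists of always-takers and compliers; its complement consists of
never-takers and the null set of defiers. -/
lemma integral_eq_sum_groups (hdef : κ defiers = 0) {F : Participant 𝒵 → ℝ}
    (hF : Integrable F κ) :
    ∫ w, F w ∂κ = ∫ w in alwaysTakers, F w ∂κ + ∫ w in compliers, F w ∂κ
      + ∫ w in neverTakers, F w ∂κ := by
  have h1 := integral_add_compl (measurableSet_decision (𝒵 := 𝒵) true true) hF
  have e1 : {w : Participant 𝒵 | w.2.1 true = true} = alwaysTakers ∪ compliers := by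
    ext w
    cases h : w.2.1 false <;> cases h' : w.2.1 true <;> simp [alwaysTakers, compliers, h, h']
  have e2 : {w : Participant 𝒵 | w.2.1 true = true}ᶜ = neverTakers ∪ defiers := by
    ext w
    cases h : w.2.1 false <;> cases h' : w.2.1 true <;> simp [neverTakers, defiers, h, h']
  have d1 : Disjoint (alwaysTakers (𝒵 := 𝒵)) compliers := by
    rw [Set.disjoint_left]
    intro w h h'
    have := h.1.symm.trans h'.1
    simp at this
  have d2 : Disjoint (neverTakers (𝒵 := 𝒵)) defiers := by
    rw [Set.disjoint_left]
    intro w h h'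
    have := h.1.symm.trans h'.1
    simp at this
  rw [e2, e1, setIntegral_union d1 measurableSet_compliers hF.integrableOn hF.integrableOn,
    setIntegral_union d2 measurableSet_defiers hF.integrableOn hF.integrableOn,
    setIntegral_measure_zero _ hdef, add_zero] at h1
  exact h1.symm

lemma real_decision_true (a : Bool) (hdef : κ defiers = 0) :
    κ.real {w : Participant 𝒵 | w.2.1 a = true} =
      κ.real alwaysTakers + if a = true then κ.real compliers else 0 := by
  cases a
  · have e : {w : Participant 𝒵 | w.2.1 false = true} = alwaysTakers ∪ defiers := by
      ext w
      cases h : w.2.1 false <;> cases h' : w.2.1 true <;> simp [alwaysTakers, defiers, h, h']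
    have : κ.real {w : Participant 𝒵 | w.2.1 false = true} = κ.real alwaysTakers := by
      rw [e]
      refine le_antisymm ?_ (measureReal_mono Set.subset_union_left)
      refine (measureReal_union_le _ _).trans ?_
      simp [measureReal_def, hdef]
    simp [this]
  · have e : {w : Participant 𝒵 | w.2.1 true = true} = alwaysTakers ∪ compliers := by
      ext w
      cases h : w.2.1 false <;> cases h' : w.2.1 true <;> simp [alwaysTakers, compliers, h, h']
    rw [e, measureReal_union _ measurableSet_compliers]
    · simp
    · rw [Set.disjoint_left]
      intro w h h'
      have := h.1.symm.trans h'.1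
      simp at this

lemma sum_real_groups (hdef : κ defiers = 0) :
    κ.real alwaysTakers + κ.real compliers + κ.real neverTakers = 1 := by
  have := integral_eq_sum_groups hdef (integrable_const (1 : ℝ))
  simpa using this.symm

lemma setIntegral_sub_const {f : Participant 𝒵 → ℝ} (hf : Integrable f κ)
    (E : Set (Participant 𝒵)) (β : ℝ) :
    ∫ w in E, (f w - β) ∂κ = κ.real E * (condMean κ f E - β) := by
  rw [integral_sub hf.integrableOn (integrable_const β), setIntegral_const,
    ← measureReal_smul_integral_cond, condMean, smul_eq_mul, smul_eq_mul]
  ring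

/-- Variance plus squared bias on one type; for a null type the factor in front makes the default
values irrelevant. -/
lemma setIntegral_sub_const_sq {f : Participant 𝒵 → ℝ} (hf : MemLp f 2 κ)
    (E : Set (Participant 𝒵)) (β : ℝ) :
    ∫ w in E, (f w - β) ^ 2 ∂κ
      = κ.real E * (condVariance κ f E + (condMean κ f E - β) ^ 2) := by
  rw [← measureReal_smul_integral_cond, smul_eq_mul]
  by_cases h0 : κ E = 0
  · simp [measureReal_def, h0]
  have : IsProbabilityMeasure (cond κ E) := cond_isProbabilityMeasure h0
  have hf' := memLp_cond hf E
  have hi := hf'.integrable (by norm_num : (1 : ENNReal) ≤ 2)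
  have hv := variance_eq_sub hf'
  have e : ∀ w, (f w - β) ^ 2 = (f ^ 2) w - 2 * β * f w + β ^ 2 := fun w => by
    simp only [Pi.pow_apply]; ring
  simp_rw [e]
  have hsq : Integrable (f ^ 2) (cond κ E) := hf'.integrable_sq
  have hsub : Integrable (fun w => (f ^ 2) w - 2 * β * f w) (cond κ E) := hsq.sub (hi.const_mul _)
  rw [integral_add hsub (integrable_const _), integral_sub hsq (hi.const_mul _), integral_const_mul, condVariance, hv, condMean,
    integral_const, probReal_univ, one_smul]
  ring

end Groups

/-! ### Net outcomes within a stratum. -/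

section Strata

variable {Q : Measure (Participant 𝒵)} [IsProbabilityMeasure Q] {𝒮 : Type w} {S : 𝒵 → 𝒮}

/-- `Y(D(a)) - β D(a)` as a function of the decision and the outcome. -/
def netOutcome (β : ℝ) (d : Bool) (y : ℝ) : ℝ := y - β * toReal d

lemma measurable_netOutcome (β : ℝ) (d : Bool) : Measurable (netOutcome β d) := by
  unfold netOutcome
  fun_prop

lemma memLp_netOutcome {κ : Measure (Participant 𝒵)} [IsFiniteMeasure κ] (β : ℝ)
    (h : ∀ d, MemLp (fun w : Participant 𝒵 => w.1 d) 2 κ) (a : Bool) :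
    MemLp (observed (netOutcome β) a) 2 κ :=
  memLp_observed (measurable_netOutcome β) (fun d => (h d).sub (memLp_const _)) a

lemma condMean_inter (E : Set (Participant 𝒵)) (hS : ∀ s, MeasurableSet (S ⁻¹' {s}))
    (hE : MeasurableSet E) (f : Participant 𝒵 → ℝ) (s : 𝒮) :
    condMean Q f (E ∩ stratum S s) = condMean (cond Q (stratum S s)) f E := by
  rw [condMean, condMean, cond_cond_eq_cond_inter (measurableSet_stratum hS s) hE,
    Set.inter_comm]

lemma condVariance_inter (E : Set (Participant 𝒵)) (hS : ∀ s, MeasurableSet (S ⁻¹' {s}))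
    (hE : MeasurableSet E) (f : Participant 𝒵 → ℝ) (s : 𝒮) :
    condVariance Q f (E ∩ stratum S s) = condVariance (cond Q (stratum S s)) f E := by
  rw [condVariance, condVariance, cond_cond_eq_cond_inter (measurableSet_stratum hS s) hE,
    Set.inter_comm]

lemma Assumption1.cond_defiers (h1 : Assumption1 Q S) (s : 𝒮) :
    cond Q (stratum S s) defiers = 0 :=
  cond_absolutelyContinuous h1.no_defiers

lemma Assumption1.piD_eq (h1 : Assumption1 Q S) (s : 𝒮) :
    piD Q S true s = (cond Q (stratum S s)).real alwaysTakers
        + (cond Q (stratum S s)).real compliers ∧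
      piD Q S false s = (cond Q (stratum S s)).real alwaysTakers := by
  have := h1.isProbabilityMeasure_cond s
  rw [piD, piD, real_decision_true true (h1.cond_defiers s),
    real_decision_true false (h1.cond_defiers s)]
  simp

lemma condMean_sub {κ : Measure (Participant 𝒵)} [IsFiniteMeasure κ] {f g : Participant 𝒵 → ℝ}
    (hf : Integrable f κ) (hg : Integrable g κ) (E : Set (Participant 𝒵)) :
    condMean κ (fun w => f w - g w) E = condMean κ f E - condMean κ g E :=
  integral_sub (integrable_cond hf E) (integrable_cond hg E)

/-- On each type D(a) is constant, so the net outcome is Y(1) - β or Y(0). The subtracted zeros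
bring every term into the shape of `setIntegral_sub_const`. -/
lemma integral_netOutcome_groups {κ : Measure (Participant 𝒵)} [IsProbabilityMeasure κ]
    (hdef : κ defiers = 0) (h : ∀ d, MemLp (fun w : Participant 𝒵 => w.1 d) 2 κ) (β : ℝ) :
    (∫ w, observed (netOutcome β) true w ∂κ =
      κ.real alwaysTakers * (condMean κ (fun w => w.1 true) alwaysTakers - β)
      + κ.real compliers * (condMean κ (fun w => w.1 true) compliers - β)
      + κ.real neverTakers * (condMean κ (fun w => w.1 false) neverTakers - 0)) ∧
    (∫ w, observed (netOutcome β) false w ∂κ =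
      κ.real alwaysTakers * (condMean κ (fun w => w.1 true) alwaysTakers - β)
      + κ.real compliers * (condMean κ (fun w => w.1 false) compliers - 0)
      + κ.real neverTakers * (condMean κ (fun w => w.1 false) neverTakers - 0)) := by
  have hi : ∀ d, Integrable (fun w : Participant 𝒵 => w.1 d) κ := fun d =>
    (h d).integrable (by norm_num)
  have hR : ∀ a, Integrable (observed (netOutcome β) a) κ := fun a =>
    (memLp_netOutcome β h a).integrable (by norm_num)
  constructor
  · rw [integral_eq_sum_groups hdef (hR _), ← setIntegral_sub_const (hi _),
      ← setIntegral_sub_const (hi _), ← setIntegral_sub_const (hi _)]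
    congr 1
    · congr 1
      · refine setIntegral_congr_fun measurableSet_alwaysTakers fun w hw => ?_
        simp [observed, netOutcome, hw.2]
      · refine setIntegral_congr_fun measurableSet_compliers fun w hw => ?_
        simp [observed, netOutcome, hw.2]
    · refine setIntegral_congr_fun measurableSet_neverTakers fun w hw => ?_
      simp [observed, netOutcome, hw.2]
  · rw [integral_eq_sum_groups hdef (hR _), ← setIntegral_sub_const (hi _),
      ← setIntegral_sub_const (hi _), ← setIntegral_sub_const (hi _)]
    congr 1
    · congr 1
      · refine setIntegral_congr_fun measurableSet_alwaysTakers fun w hw => ?_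
        simp [observed, netOutcome, hw.1]
      · refine setIntegral_congr_fun measurableSet_compliers fun w hw => ?_
        simp [observed, netOutcome, hw.1]
    · refine setIntegral_congr_fun measurableSet_neverTakers fun w hw => ?_
      simp [observed, netOutcome, hw.1]

lemma integral_netOutcome_sq_groups {κ : Measure (Participant 𝒵)} [IsProbabilityMeasure κ]
    (hdef : κ defiers = 0) (h : ∀ d, MemLp (fun w : Participant 𝒵 => w.1 d) 2 κ) (β : ℝ) :
    (∫ w, observed (netOutcome β) true w ^ 2 ∂κ =
      κ.real alwaysTakers * (condVariance κ (fun w => w.1 true) alwaysTakers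
        + (condMean κ (fun w => w.1 true) alwaysTakers - β) ^ 2)
      + κ.real compliers * (condVariance κ (fun w => w.1 true) compliers
        + (condMean κ (fun w => w.1 true) compliers - β) ^ 2)
      + κ.real neverTakers * (condVariance κ (fun w => w.1 false) neverTakers
        + (condMean κ (fun w => w.1 false) neverTakers - 0) ^ 2)) ∧
    (∫ w, observed (netOutcome β) false w ^ 2 ∂κ =
      κ.real alwaysTakers * (condVariance κ (fun w => w.1 true) alwaysTakers
        + (condMean κ (fun w => w.1 true) alwaysTakers - β) ^ 2)
      + κ.real compliers * (condVariance κ (fun w => w.1 false) compliers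
        + (condMean κ (fun w => w.1 false) compliers - 0) ^ 2)
      + κ.real neverTakers * (condVariance κ (fun w => w.1 false) neverTakers
        + (condMean κ (fun w => w.1 false) neverTakers - 0) ^ 2)) := by
  have hR : ∀ a, Integrable (fun w => observed (netOutcome β) a w ^ 2) κ := fun a =>
    (memLp_netOutcome β h a).integrable_sq
  constructor
  · rw [integral_eq_sum_groups hdef (hR _), ← setIntegral_sub_const_sq (h _),
      ← setIntegral_sub_const_sq (h _), ← setIntegral_sub_const_sq (h _)]
    congr 1
    · congr 1
      · refine setIntegral_congr_fun measurableSet_alwaysTakers fun w hw => ?_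
        simp [observed, netOutcome, hw.2]
      · refine setIntegral_congr_fun measurableSet_compliers fun w hw => ?_
        simp [observed, netOutcome, hw.2]
    · refine setIntegral_congr_fun measurableSet_neverTakers fun w hw => ?_
      simp [observed, netOutcome, hw.2]
  · rw [integral_eq_sum_groups hdef (hR _), ← setIntegral_sub_const_sq (h _),
      ← setIntegral_sub_const_sq (h _), ← setIntegral_sub_const_sq (h _)]
    congr 1
    · congr 1
      · refine setIntegral_congr_fun measurableSet_alwaysTakers fun w hw => ?_
        simp [observed, netOutcome, hw.1]
      · refine setIntegral_congr_fun measurableSet_compliers fun w hw => ?_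
        simp [observed, netOutcome, hw.1]
    · refine setIntegral_congr_fun measurableSet_neverTakers fun w hw => ?_
      simp [observed, netOutcome, hw.1]

/-- The variance of `Y(D(a)) - β D(a)` given `S = s`. -/
def netVar (Q : Measure (Participant 𝒵)) (S : 𝒵 → 𝒮) (β : ℝ) (a : Bool) (s : 𝒮) : ℝ :=
  ∫ w, observed (netOutcome β) a w ^ 2 ∂(cond Q (stratum S s))
    - (∫ w, observed (netOutcome β) a w ∂(cond Q (stratum S s))) ^ 2

lemma Assumption1.primitives_beta (h1 : Assumption1 Q S) (s : 𝒮) :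
    (primitives Q S s).beta = (primitives Q S s).meanY1C - (primitives Q S s).meanY0C :=
  condMean_sub ((h1.second_moment true).integrable (by norm_num))
    ((h1.second_moment false).integrable (by norm_num)) _

/-- Always-takers and never-takers contribute equally to both means; only the compliers of the
stratum survive the subtraction. -/
lemma Assumption1.netMean_sub (h1 : Assumption1 Q S) (hS : ∀ s, MeasurableSet (S ⁻¹' {s}))
    (β : ℝ) (s : 𝒮) :
    ∫ w, observed (netOutcome β) true w ∂(cond Q (stratum S s))
      - ∫ w, observed (netOutcome β) false w ∂(cond Q (stratum S s)) =
    (piD Q S true s - piD Q S false s) * ((primitives Q S s).beta - β) := by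
  have := h1.isProbabilityMeasure_cond s
  obtain ⟨e1, e0⟩ := integral_netOutcome_groups (h1.cond_defiers s)
    (fun d => memLp_cond (h1.second_moment d) (stratum S s)) β
  rw [e1, e0, (h1.piD_eq s).1, (h1.piD_eq s).2, h1.primitives_beta]
  simp only [primitives]
  rw [condMean_inter _ hS measurableSet_compliers, condMean_inter _ hS measurableSet_compliers]
  ring

/-- The law in a stratum is a mixture of three types with weights e, c and 1 - e - c. Its first two
moments are weighted sums over the types, and the claim becomes a rational identity in the weights,
means and variances. -/
theorem Assumption1.Pi_primitives (h1 : Assumption1 Q S) (hS : ∀ s, MeasurableSet (S ⁻¹' {s}))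
    (β : ℝ) (s : 𝒮) :
    Pi1 (primitives Q S s) β = netVar Q S β true s ∧
      Pi2 (primitives Q S s) β = netVar Q S β false s := by
  have := h1.isProbabilityMeasure_cond s
  have hL := fun d => memLp_cond (h1.second_moment d) (stratum S s)
  obtain ⟨e1, e0⟩ := integral_netOutcome_groups (h1.cond_defiers s) hL β
  obtain ⟨f1, f0⟩ := integral_netOutcome_sq_groups (h1.cond_defiers s) hL β
  have hsum := sum_real_groups (h1.cond_defiers s)
  have hb := h1.primitives_beta s
  have hc := h1.compliers_pos s
  have hp := h1.piD_eq s
  rw [hp.1, hp.2, add_sub_cancel_left] at hc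
  rw [netVar, netVar, e1, e0, f1, f0, Pi1, Pi2, hb]
  simp only [primitives]
  rw [hp.1, hp.2]
  simp only [condMean_inter _ hS measurableSet_compliers,
    condMean_inter _ hS measurableSet_alwaysTakers, condMean_inter _ hS measurableSet_neverTakers,
    condVariance_inter _ hS measurableSet_compliers,
    condVariance_inter _ hS measurableSet_alwaysTakers,
    condVariance_inter _ hS measurableSet_neverTakers]
  set κ := cond Q (stratum S s)
  have he : 0 ≤ κ.real alwaysTakers := measureReal_nonneg
  have ht : 0 ≤ κ.real neverTakers := measureReal_nonneg
  set e := κ.real alwaysTakers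
  set c := κ.real compliers
  set t := κ.real neverTakers
  have ht' : t = 1 - e - c := by linarith
  -- Positive mass of compliers keeps the denominators π_1 and 1 - π_0 away from zero.
  have hp1 : e + c ≠ 0 := by positivity
  have hp0 : 1 - e ≠ 0 := by
    have : 0 < 1 - e := by linarith
    exact this.ne'
  rw [ht']
  generalize condMean κ (fun w => w.1 true) compliers = m1
  generalize condMean κ (fun w => w.1 false) compliers = m0
  generalize condMean κ (fun w => w.1 true) alwaysTakers = mA
  generalize condMean κ (fun w => w.1 false) neverTakers = mN
  constructor
  · field_simp
    ring
  · field_simp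
    ring

variable [Fintype 𝒮]

lemma Assumption1.probC_pos (h1 : Assumption1 Q S) : 0 < probC (primitives Q S) := by
  have : Nonempty (Participant 𝒵) := nonempty_of_isProbabilityMeasure Q
  have : Nonempty 𝒮 := ⟨S (Classical.arbitrary (Participant 𝒵)).2.2⟩
  exact Finset.sum_pos (fun s _ => mul_pos (h1.stratum_pos s) (h1.compliers_pos s))
    Finset.univ_nonempty

/-- By definition of β the variable Y(1) - Y(0) - β integrates to zero over the compliers; the sum
splits this integral by stratum. -/
lemma Assumption1.sum_late_eq_zero (h1 : Assumption1 Q S)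
    (hS : ∀ s, MeasurableSet (S ⁻¹' {s})) :
    ∑ s, Q.real (stratum S s) * ((piD Q S true s - piD Q S false s) *
      ((primitives Q S s).beta - late Q)) = 0 := by
  have hi : Integrable (fun w : Participant 𝒵 => w.1 true - w.1 false) Q :=
    ((h1.second_moment true).integrable (by norm_num)).sub
      ((h1.second_moment false).integrable (by norm_num))
  have h := sum_stratum_mul_integral_cond (Q := Q) hS
    ((hi.sub (integrable_const (late Q))).indicator (measurableSet_compliers (𝒵 := 𝒵)))
  have hz : ∫ w in compliers, (w.1 true - w.1 false - late Q) ∂Q = 0 := by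
    rw [setIntegral_sub_const hi, late, sub_self, mul_zero]
  rw [integral_indicator measurableSet_compliers] at h
  simp only [integral_indicator measurableSet_compliers, Pi.sub_apply] at h
  rw [hz] at h
  rw [← h]
  refine Finset.sum_congr rfl fun s _ => ?_
  have := h1.isProbabilityMeasure_cond s
  rw [setIntegral_sub_const (integrable_cond hi _), (h1.piD_eq s).1, (h1.piD_eq s).2,
    add_sub_cancel_left]
  simp only [primitives]
  rw [condMean_inter _ hS measurableSet_compliers]

end Strata

end Population

/-! ### Cell averages -/

section Cells

variable {𝒵 : Type u} [MeasurableSpace 𝒵] {Q : Measure (Participant 𝒵)} [IsProbabilityMeasure Q]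
  {𝒮 : Type w} [Fintype 𝒮] [DecidableEq 𝒮] {S : 𝒵 → 𝒮} (T : Trial.{u, v} Q)

/-- The contribution of a participant with assignment `a'` to the cell sum of `g`. -/
def cellTerm (S : 𝒵 → 𝒮) (a : Bool) (s : 𝒮) (g : Bool → ℝ → ℝ) (a' : Bool)
    (w : Participant 𝒵) : ℝ :=
  if a' = a ∧ S w.2.2 = s then observed g a' w else 0

lemma cellSum_sample (n : ℕ) (ω : T.Ω) (a : Bool) (s : 𝒮) (g : Bool → ℝ → ℝ) :
    (T.sample S n ω).cellSum a s g = ∑ i, cellTerm S a s g (T.A n ω i) (T.W n ω i) := rfl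

lemma cellTerm_eq_indicator (a : Bool) (s : 𝒮) (g : Bool → ℝ → ℝ) (a' : Bool) :
    cellTerm S a s g a' =
      if a' = a then (stratum S s).indicator (observed g a') else fun _ => 0 := by
  funext w
  by_cases h : a' = a <;> by_cases h' : S w.2.2 = s <;>
    simp [cellTerm, Set.indicator, stratum, h, h']

lemma measurable_cellTerm (hS : ∀ s, MeasurableSet (S ⁻¹' {s})) (a : Bool) (s : 𝒮)
    {g : Bool → ℝ → ℝ} (hg : ∀ d, Measurable (g d)) (a' : Bool) :
    Measurable (cellTerm S a s g a') := by
  rw [cellTerm_eq_indicator]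
  split_ifs
  · exact (measurable_observed hg a').indicator (measurableSet_stratum hS s)
  · exact measurable_const

lemma integrable_cellTerm (hS : ∀ s, MeasurableSet (S ⁻¹' {s})) (a : Bool) (s : 𝒮)
    {g : Bool → ℝ → ℝ} (hi : ∀ a, Integrable (observed g a) Q) (a' : Bool) :
    Integrable (cellTerm S a s g a') Q := by
  rw [cellTerm_eq_indicator]
  split_ifs
  · exact (hi a').indicator (measurableSet_stratum hS s)
  · exact integrable_zero _ _ _

lemma ae_cond_stratum (hS : ∀ s, MeasurableSet (S ⁻¹' {s})) (s : 𝒮) :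
    ∀ᵐ w ∂(cond Q (stratum S s)), S w.2.2 = s :=
  ae_cond_mem (measurableSet_stratum hS s)

lemma integral_cellTerm (hS : ∀ s, MeasurableSet (S ⁻¹' {s})) (a : Bool) (s : 𝒮)
    (g : Bool → ℝ → ℝ) (a' : Bool) (t : 𝒮) :
    ∫ w, cellTerm S a s g a' w ∂(cond Q (stratum S t)) =
      if a' = a ∧ t = s then ∫ w, observed g a w ∂(cond Q (stratum S s)) else 0 := by
  have : ∫ w, cellTerm S a s g a' w ∂(cond Q (stratum S t)) =
      ∫ w, (if a' = a ∧ t = s then observed g a' w else 0) ∂(cond Q (stratum S t)) := by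
    refine integral_congr_ae ?_
    filter_upwards [ae_cond_stratum hS t] with w hw
    rw [cellTerm, hw]
  rw [this]
  split_ifs with h
  · rw [h.1, h.2]
  · simp

lemma measurable_cellSum (hS : ∀ s, MeasurableSet (S ⁻¹' {s})) (n : ℕ) (a : Bool) (s : 𝒮)
    {g : Bool → ℝ → ℝ} (hg : ∀ d, Measurable (g d)) :
    Measurable fun ω => (T.sample S n ω).cellSum a s g :=
  measurable_sum_assigned T n (measurable_cellTerm hS a s hg)

/-- The limiting share of the participants of stratum `s` with `A = a`. -/
def share (pA : 𝒮 → ℝ) (a : Bool) (s : 𝒮) : ℝ := if a = true then pA s else 1 - pA s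

lemma Assumption2.share_pos {pA : 𝒮 → ℝ} (h2 : Assumption2 T S pA) (a : Bool) (s : 𝒮) :
    0 < share pA a s := by
  cases a
  · simpa [share] using (h2.pA_mem s).2
  · simpa [share] using (h2.pA_mem s).1

/-- The weak law applied to summands supported on one cell, so a single term of the mixture
survives. -/
theorem tendsto_cellSum_div (hS : ∀ s, MeasurableSet (S ⁻¹' {s})) (h1 : Assumption1 Q S)
    {pA : 𝒮 → ℝ} (h2 : Assumption2 T S pA) (a : Bool) (s : 𝒮) {g : Bool → ℝ → ℝ}
    (hg : ∀ d, Measurable (g d)) (hi : ∀ a, Integrable (observed g a) Q) :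
    Tendsto (fun z : ℕ × T.Ω => (T.sample S z.1 z.2).cellSum a s g / z.1) (probFilter T.P)
      (𝓝 (Q.real (stratum S s) * share pA a s *
        ∫ w, observed g a w ∂(cond Q (stratum S s)))) := by
  have h := tendsto_average_assigned T hS h1 h2 (measurable_cellTerm hS a s hg)
    (integrable_cellTerm hS a s hi)
  have hmix : cellMix Q S pA (fun a' t => ∫ w, cellTerm S a s g a' w ∂(cond Q (stratum S t)))
      = Q.real (stratum S s) * share pA a s * ∫ w, observed g a w ∂(cond Q (stratum S s)) := by
    simp only [integral_cellTerm hS, cellMix]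
    rw [Finset.sum_eq_single s]
    · cases a <;> simp [share] <;> ring
    · intro t _ ht
      simp [ht]
    · simp
  rw [hmix] at h
  refine h.congr fun z => ?_
  rw [cellSum_sample, div_eq_inv_mul]

lemma eventually_natCast_ne_zero : ∀ᶠ z : ℕ × T.Ω in probFilter T.P, (z.1 : ℝ) ≠ 0 := by
  filter_upwards [tendsto_fst_probFilter.eventually (eventually_gt_atTop 0)] with z hz
  exact Nat.cast_ne_zero.2 hz.ne'

theorem tendsto_cellCount_div (hS : ∀ s, MeasurableSet (S ⁻¹' {s})) (h1 : Assumption1 Q S)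
    {pA : 𝒮 → ℝ} (h2 : Assumption2 T S pA) (a : Bool) (s : 𝒮) :
    Tendsto (fun z : ℕ × T.Ω => (T.sample S z.1 z.2).cellCount a s / z.1) (probFilter T.P)
      (𝓝 (Q.real (stratum S s) * share pA a s)) := by
  have := h1.isProbabilityMeasure_cond s
  have h := tendsto_cellSum_div T hS h1 h2 a s (g := fun _ _ => 1) (fun _ => measurable_const)
    (fun a => integrable_const 1)
  simpa [observed, Sample.cellCount] using h

lemma eventually_cellCount_pos (hS : ∀ s, MeasurableSet (S ⁻¹' {s})) (h1 : Assumption1 Q S)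
    {pA : 𝒮 → ℝ} (h2 : Assumption2 T S pA) (a : Bool) (s : 𝒮) :
    ∀ᶠ z : ℕ × T.Ω in probFilter T.P, 0 < (T.sample S z.1 z.2).cellCount a s := by
  filter_upwards [(tendsto_cellCount_div T hS h1 h2 a s).eventually_const_lt
    (mul_pos (h1.stratum_pos s) (h2.share_pos T a s))] with z hz
  by_contra h
  exact absurd hz (not_lt.2 (div_nonpos_of_nonpos_of_nonneg (not_lt.1 h) (Nat.cast_nonneg _)))

theorem tendsto_cellMean (hS : ∀ s, MeasurableSet (S ⁻¹' {s})) (h1 : Assumption1 Q S)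
    {pA : 𝒮 → ℝ} (h2 : Assumption2 T S pA) (a : Bool) (s : 𝒮) {g : Bool → ℝ → ℝ}
    (hg : ∀ d, Measurable (g d)) (hi : ∀ a, Integrable (observed g a) Q) :
    Tendsto (fun z : ℕ × T.Ω => (T.sample S z.1 z.2).cellSum a s g /
      (T.sample S z.1 z.2).cellCount a s) (probFilter T.P)
      (𝓝 (∫ w, observed g a w ∂(cond Q (stratum S s)))) := by
  have hpos := mul_pos (h1.stratum_pos s) (h2.share_pos T a s)
  have h := (tendsto_cellSum_div T hS h1 h2 a s hg hi).div (tendsto_cellCount_div T hS h1 h2 a s)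
    hpos.ne'
  rw [mul_div_cancel_left₀ _ hpos.ne'] at h
  refine h.congr' ?_
  filter_upwards [eventually_natCast_ne_zero T] with z hz
  exact div_div_div_cancel_right₀ hz _ _

lemma integrable_observed_outcome (h1 : Assumption1 Q S) (a : Bool) :
    Integrable (observed (fun _ y => y) a) Q :=
  memLp_one_iff_integrable.1 (memLp_observed (fun _ => measurable_id)
    (fun d => (h1.second_moment d).mono_exponent (by norm_num)) a)

lemma integrable_observed_sq (h1 : Assumption1 Q S) (a : Bool) :
    Integrable (observed (fun _ y => y ^ 2) a) Q :=
  memLp_one_iff_integrable.1 (memLp_observed (fun _ => by fun_prop)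
    (fun d => memLp_one_iff_integrable.2 (h1.second_moment d).integrable_sq) a)

lemma integrable_observed_treated (a : Bool) :
    Integrable (observed (𝒵 := 𝒵) (fun d _ => toReal d) a) Q :=
  memLp_one_iff_integrable.1 (memLp_observed (fun _ => measurable_const)
    (fun _ => memLp_const _) a)

lemma integrable_observed_treated_outcome (h1 : Assumption1 Q S) (a : Bool) :
    Integrable (observed (fun d y => toReal d * y) a) Q :=
  memLp_one_iff_integrable.1 (memLp_observed (fun _ => by fun_prop)
    (fun d => ((h1.second_moment d).mono_exponent (by norm_num)).const_mul _) a)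

lemma integral_observed_treated (a : Bool) (s : 𝒮) :
    ∫ w, observed (fun d _ => toReal d) a w ∂(cond Q (stratum S s)) = piD Q S a s := by
  have : ∀ w : Participant 𝒵, observed (fun d _ => toReal d) a w =
      {w : Participant 𝒵 | w.2.1 a = true}.indicator (fun _ => (1 : ℝ)) w := by
    intro w
    cases h : w.2.1 a <;> simp [observed, h]
  simp_rw [this]
  rw [integral_indicator (measurableSet_decision a true)]
  simp [piD]

theorem tendsto_cellTreated_div_count (hS : ∀ s, MeasurableSet (S ⁻¹' {s}))
    (h1 : Assumption1 Q S) {pA : 𝒮 → ℝ} (h2 : Assumption2 T S pA) (a : Bool) (s : 𝒮) :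
    Tendsto (fun z : ℕ × T.Ω => (T.sample S z.1 z.2).cellTreated a s /
      (T.sample S z.1 z.2).cellCount a s) (probFilter T.P) (𝓝 (piD Q S a s)) := by
  rw [← integral_observed_treated]
  exact tendsto_cellMean T hS h1 h2 a s (fun _ => measurable_const) integrable_observed_treated

lemma Assumption1.piD_bounds (h1 : Assumption1 Q S) (s : 𝒮) :
    0 < piD Q S true s ∧ piD Q S false s < 1 := by
  have := h1.isProbabilityMeasure_cond s
  have h := h1.compliers_pos s
  have h0 : 0 ≤ piD Q S false s := measureReal_nonneg
  have h1 : piD Q S true s ≤ 1 := measureReal_le_one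
  exact ⟨by linarith, by linarith⟩

/-- Each requirement of regularity is a strict inequality that holds in the limit. This licenses the
exact formulas for the estimators in all later limits. -/
theorem eventually_regular (hS : ∀ s, MeasurableSet (S ⁻¹' {s})) (h1 : Assumption1 Q S)
    {pA : 𝒮 → ℝ} (h2 : Assumption2 T S pA) :
    ∀ᶠ z : ℕ × T.Ω in probFilter T.P, (T.sample S z.1 z.2).Regular := by
  have hπ := fun a s => tendsto_cellTreated_div_count T hS h1 h2 a s
  have e1 : ∀ᶠ z : ℕ × T.Ω in probFilter T.P, ∀ a s, 0 < (T.sample S z.1 z.2).cellCount a s :=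
    eventually_all.2 fun a => eventually_all.2 fun s => eventually_cellCount_pos T hS h1 h2 a s
  have e2 := eventually_all.2 fun s => (hπ true s).eventually_const_lt (h1.piD_bounds s).1
  have e3 := eventually_all.2 fun s => (hπ false s).eventually_lt_const (h1.piD_bounds s).2
  have e4 := eventually_all.2 fun s =>
    ((hπ true s).sub (hπ false s)).eventually_const_lt (h1.compliers_pos s)
  filter_upwards [e1, e2, e3, e4] with z h1 h2 h3 h4
  refine ⟨h1, fun s => ?_, fun s => ?_, fun s => ?_⟩
  · rw [Sample.piD1Hat_eq]; exact h2 s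
  · rw [Sample.piD0Hat_eq]; exact h3 s
  · rw [Sample.piD1Hat_eq, Sample.piD0Hat_eq]; exact h4 s

theorem tendsto_probCHat (hS : ∀ s, MeasurableSet (S ⁻¹' {s})) (h1 : Assumption1 Q S)
    {pA : 𝒮 → ℝ} (h2 : Assumption2 T S pA) :
    Tendsto (fun z : ℕ × T.Ω => (T.sample S z.1 z.2).probCHat) (probFilter T.P)
      (𝓝 (probC (primitives Q S))) := by
  refine tendsto_finsetSum _ fun s _ => (tendsto_nS_div T hS s).mul ?_
  simp_rw [Sample.piD1Hat_eq, Sample.piD0Hat_eq]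
  exact (tendsto_cellTreated_div_count T hS h1 h2 true s).sub
    (tendsto_cellTreated_div_count T hS h1 h2 false s)

/-- `E[Y(D(a)) - β D(a) | S = s]`. -/
def netMean (Q : Measure (Participant 𝒵)) (S : 𝒵 → 𝒮) (β : ℝ) (a : Bool) (s : 𝒮) : ℝ :=
  ∫ w, observed (netOutcome β) a w ∂(cond Q (stratum S s))

lemma Assumption1.netMean_eq (h1 : Assumption1 Q S) (β : ℝ) (a : Bool) (s : 𝒮) :
    netMean Q S β a s = ∫ w, observed (fun _ y => y) a w ∂(cond Q (stratum S s))
      - β * piD Q S a s := by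
  rw [← integral_observed_treated, ← integral_const_mul,
    ← integral_sub (integrable_cond (integrable_observed_outcome h1 a) _)
      ((integrable_cond (integrable_observed_treated a) _).const_mul β)]
  rfl

lemma Assumption1.netVar_eq (h1 : Assumption1 Q S) (β : ℝ) (a : Bool) (s : 𝒮) :
    netVar Q S β a s = ∫ w, observed (fun _ y => y ^ 2) a w ∂(cond Q (stratum S s))
      - 2 * β * ∫ w, observed (fun d y => toReal d * y) a w ∂(cond Q (stratum S s))
      + β ^ 2 * piD Q S a s - (∫ w, observed (fun _ y => y) a w ∂(cond Q (stratum S s))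
      - β * piD Q S a s) ^ 2 := by
  have h := h1.netMean_eq β a s
  rw [netMean] at h
  rw [netVar, h]
  congr 1
  have i1 := integrable_cond (integrable_observed_sq h1 a) (stratum S s)
  have i2 := (integrable_cond (integrable_observed_treated_outcome h1 a) (stratum S s)).const_mul
    (2 * β)
  have i3 := (integrable_cond (integrable_observed_treated (Q := Q) a) (stratum S s)).const_mul
    (β ^ 2)
  have i12 : Integrable (fun w => observed (fun _ y => y ^ 2) a w
    - 2 * β * observed (fun d y => toReal d * y) a w) (cond Q (stratum S s)) := i1.sub i2
  rw [← integral_observed_treated, ← integral_const_mul, ← integral_const_mul,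
    ← integral_sub i1 i2, ← integral_add i12 i3]
  refine integral_congr_ae (ae_of_all _ fun w => ?_)
  simp only [observed, netOutcome]
  have := toReal_sq (w.2.1 a)
  linear_combination β ^ 2 * this

lemma Assumption1.sum_netMean_sub (h1 : Assumption1 Q S) (hS : ∀ s, MeasurableSet (S ⁻¹' {s})) :
    ∑ s, Q.real (stratum S s) *
      (netMean Q S (late Q) true s - netMean Q S (late Q) false s) = 0 := by
  rw [← h1.sum_late_eq_zero hS]
  exact Finset.sum_congr rfl fun s _ => by rw [← h1.netMean_sub hS (late Q) s]; rfl

/-- The limit is the ratio of the intention-to-treat effect on outcomes to P(C). It equals β because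
the effects of the assignment on the net outcome average to zero. -/
theorem tendsto_betaSat (hS : ∀ s, MeasurableSet (S ⁻¹' {s})) (h1 : Assumption1 Q S)
    {pA : 𝒮 → ℝ} (h2 : Assumption2 T S pA) :
    Tendsto (fun z : ℕ × T.Ω => (T.sample S z.1 z.2).betaSat) (probFilter T.P)
      (𝓝 (late Q)) := by
  have hY := fun a s => tendsto_cellMean T hS h1 h2 a s (g := fun _ y => y)
    (fun _ => measurable_id) (integrable_observed_outcome h1)
  have h := (tendsto_finsetSum Finset.univ fun s _ => (tendsto_nS_div T hS s).mul
    ((hY true s).sub (hY false s))).div (tendsto_probCHat T hS h1 h2) h1.probC_pos.ne'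
  have hl : (∑ s, Q.real (stratum S s) *
      (∫ w, observed (fun _ y => y) true w ∂(cond Q (stratum S s)) -
        ∫ w, observed (fun _ y => y) false w ∂(cond Q (stratum S s)))) / probC (primitives Q S)
      = late Q := by
    rw [div_eq_iff h1.probC_pos.ne', ← sub_eq_zero, ← h1.sum_netMean_sub hS, probC,
      Finset.mul_sum, ← Finset.sum_sub_distrib]
    refine Finset.sum_congr rfl fun s _ => ?_
    rw [h1.netMean_eq, h1.netMean_eq]
    simp only [primitives]
    ring
  rw [hl] at h
  refine h.congr' ?_
  filter_upwards [eventually_regular T hS h1 h2] with z hz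
  exact hz.betaSat_eq.symm

theorem tendsto_cellVar (hS : ∀ s, MeasurableSet (S ⁻¹' {s})) (h1 : Assumption1 Q S)
    {pA : 𝒮 → ℝ} (h2 : Assumption2 T S pA) (a : Bool) (s : 𝒮) :
    Tendsto (fun z : ℕ × T.Ω => (T.sample S z.1 z.2).cellVar (T.sample S z.1 z.2).betaSat a s)
      (probFilter T.P) (𝓝 (netVar Q S (late Q) a s)) := by
  rw [h1.netVar_eq]
  have hb := tendsto_betaSat T hS h1 h2
  have hq := tendsto_cellMean T hS h1 h2 a s (g := fun _ y => y ^ 2) (fun _ => by fun_prop)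
    (integrable_observed_sq h1)
  have hLT := tendsto_cellMean T hS h1 h2 a s (g := fun d y => toReal d * y)
    (fun _ => by fun_prop) (integrable_observed_treated_outcome h1)
  have hL := tendsto_cellMean T hS h1 h2 a s (g := fun _ y => y) (fun _ => measurable_id)
    (integrable_observed_outcome h1)
  have hC := tendsto_cellTreated_div_count T hS h1 h2 a s
  have h := (((hq.sub ((hb.const_mul 2).mul hLT)).add ((hb.pow 2).mul hC))).sub
    ((hL.sub (hb.mul hC)).pow 2)
  refine h.congr fun z => ?_
  rw [Sample.cellVar, Sample.cellSq, Sample.cellTreatedOutcome, Sample.cellOutcome]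
  ring

/-! ### Consistency of the plug-in propensities -/

/-- Only Π_1 has to be positive: it is the denominator, while the square root is continuous at 0 and
1 plus a square root is never zero. -/
theorem tendsto_optPropensityHat (hS : ∀ s, MeasurableSet (S ⁻¹' {s})) (h1 : Assumption1 Q S)
    {pA : 𝒮 → ℝ} (h2 : Assumption2 T S pA) (s : 𝒮)
    (hpos : 0 < Pi1 (primitives Q S s) (late Q)) :
    Tendsto (fun z : ℕ × T.Ω => (T.sample S z.1 z.2).optPropensityHat s) (probFilter T.P)
      (𝓝 (optPropensity (primitives Q S s) (late Q))) := by
  have hP := h1.Pi_primitives hS (late Q) s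
  rw [optPropensity]
  rw [hP.1] at hpos ⊢
  rw [hP.2]
  have h := ((((tendsto_cellVar T hS h1 h2 false s).div (tendsto_cellVar T hS h1 h2 true s)
    hpos.ne').sqrt).const_add 1).inv₀ (by positivity)
  refine h.congr' ?_
  filter_upwards [eventually_regular T hS h1 h2] with z hz
  rw [Sample.optPropensityHat, optPropensity, hz.Pi1_primitivesHat, hz.Pi2_primitivesHat]
  rfl

theorem tendsto_optConstPropensityHat (hS : ∀ s, MeasurableSet (S ⁻¹' {s}))
    (h1 : Assumption1 Q S) {pA : 𝒮 → ℝ} (h2 : Assumption2 T S pA)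
    (hpos : 0 < ∑ s, (primitives Q S s).p * Pi1 (primitives Q S s) (late Q)) :
    Tendsto (fun z : ℕ × T.Ω => (T.sample S z.1 z.2).optConstPropensityHat) (probFilter T.P)
      (𝓝 (optConstPropensity (primitives Q S) (late Q))) := by
  have hP := h1.Pi_primitives hS (late Q)
  rw [optConstPropensity]
  simp_rw [fun s => (hP s).1] at hpos ⊢
  simp_rw [fun s => (hP s).2]
  have hsum := fun a => tendsto_finsetSum Finset.univ fun s (_ : s ∈ Finset.univ) =>
    (tendsto_nS_div T hS s).mul (tendsto_cellVar T hS h1 h2 a s)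
  have h := ((((hsum false).div (hsum true) hpos.ne').sqrt).const_add 1).inv₀ (by positivity)
  refine h.congr' ?_
  filter_upwards [eventually_regular T hS h1 h2] with z hz
  rw [Sample.optConstPropensityHat, optConstPropensity]
  simp_rw [hz.Pi1_primitivesHat, hz.Pi2_primitivesHat]
  rfl

end Cells

/-! ### Measurability of IV estimators -/

section Measurability

variable {Ω : Type*} [MeasurableSpace Ω]

lemma measurable_det {k : Type*} [Fintype k] [DecidableEq k] {M : Ω → Matrix k k ℝ}
    (hM : ∀ i j, Measurable fun ω => M ω i j) : Measurable fun ω => (M ω).det := by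
  simp_rw [Matrix.det_apply]
  exact Finset.measurable_sum _ fun σ _ =>
    (Finset.measurable_prod _ fun i _ => hM _ _).const_smul (Equiv.Perm.sign σ)

/-- Cramer's rule writes the entries as quotients of polynomials; the value 0 at singular matrices
agrees with measurable inversion in ℝ. -/
lemma measurable_matrix_inv {k : Type*} [Fintype k] [DecidableEq k] {M : Ω → Matrix k k ℝ}
    (hM : ∀ i j, Measurable fun ω => M ω i j) (i j : k) :
    Measurable fun ω => (M ω)⁻¹ i j := by
  simp_rw [Matrix.inv_def, Matrix.smul_apply, smul_eq_mul, Ring.inverse_eq_inv',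
    Matrix.adjugate_apply]
  refine (measurable_det hM).inv.mul (measurable_det fun i' j' => ?_)
  by_cases h : i' = j
  · simp [h]
  · simpa [h] using hM i' j'

lemma measurable_ivEstimator {n : ℕ} {k : Type*} [Fintype k] [DecidableEq k]
    {Z X : Ω → Matrix (Fin n) k ℝ} {Y : Ω → Fin n → ℝ}
    (hZ : ∀ i j, Measurable fun ω => Z ω i j) (hX : ∀ i j, Measurable fun ω => X ω i j)
    (hY : ∀ i, Measurable fun ω => Y ω i) (j : k) :
    Measurable fun ω => ivEstimator (Z ω) (X ω) (Y ω) j := by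
  simp only [ivEstimator, Matrix.mulVec, dotProduct]
  refine Finset.measurable_sum _ fun i _ => (measurable_matrix_inv (fun a b => ?_) j i).mul ?_
  · simp only [Matrix.mul_apply, Matrix.transpose_apply]
    exact Finset.measurable_sum _ fun l _ => (hZ l a).mul (hX l b)
  · exact Finset.measurable_sum _ fun l _ => (hZ l i).mul (hY l)

variable {𝒵 : Type u} [MeasurableSpace 𝒵] {Q : Measure (Participant 𝒵)} [IsProbabilityMeasure Q]
  {𝒮 : Type w} [Fintype 𝒮] [DecidableEq 𝒮] {S : 𝒵 → 𝒮} (T : Trial.{u, v} Q)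

lemma measurable_sample_observed (n : ℕ) (i : Fin n) {g : Bool → ℝ → ℝ}
    (hg : ∀ d, Measurable (g d)) :
    Measurable fun ω => g ((T.sample S n ω).D i) ((T.sample S n ω).Y i) :=
  measurable_bool_comp (measurable_observed hg) ((measurable_pi_apply i).comp (T.measurable_A n))
    ((measurable_pi_apply i).comp (T.measurable_W n))

lemma measurable_sample_A (n : ℕ) (i : Fin n) :
    Measurable fun ω => toReal ((T.sample S n ω).A i) :=
  (measurable_of_countable toReal).comp ((measurable_pi_apply i).comp (T.measurable_A n))

lemma measurable_sample_indS (hS : ∀ s, MeasurableSet (S ⁻¹' {s})) (n : ℕ) (i : Fin n) (s : 𝒮) :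
    Measurable fun ω => (T.sample S n ω).indS i s :=
  measurable_strata_comp T hS n fun _ σ => if σ i = s then (1 : ℝ) else 0

lemma measurable_nS (hS : ∀ s, MeasurableSet (S ⁻¹' {s})) (n : ℕ) (s : 𝒮) :
    Measurable fun ω => (T.sample S n ω).nS s :=
  Finset.measurable_sum _ fun i _ => measurable_sample_indS T hS n i s

lemma measurable_nA (hS : ∀ s, MeasurableSet (S ⁻¹' {s})) (n : ℕ) (s : 𝒮) :
    Measurable fun ω => (T.sample S n ω).nA s :=
  Finset.measurable_sum _ fun i _ =>
    (measurable_sample_A T n i).mul (measurable_sample_indS T hS n i s)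

lemma measurable_betaSatStratum (hS : ∀ s, MeasurableSet (S ⁻¹' {s})) (n : ℕ) (s : 𝒮) :
    Measurable fun ω => (T.sample S n ω).betaSatStratum s := by
  refine measurable_ivEstimator (fun i j => ?_) (fun i j => ?_)
    (fun i => measurable_sample_observed T n i (g := fun _ y => y) fun _ => measurable_id) _
  · cases j
    · exact measurable_sample_indS T hS n i _
    · exact (measurable_sample_A T n i).mul (measurable_sample_indS T hS n i _)
  · cases j
    · exact measurable_sample_indS T hS n i _
    · exact (measurable_sample_observed T n i (g := fun d _ => toReal d)
        fun _ => measurable_const).mul (measurable_sample_indS T hS n i _)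

lemma measurable_betaSfe (hS : ∀ s, MeasurableSet (S ⁻¹' {s})) (n : ℕ) :
    Measurable fun ω => (T.sample S n ω).betaSfe := by
  refine measurable_ivEstimator (fun i j => ?_) (fun i j => ?_)
    (fun i => measurable_sample_observed T n i (g := fun _ y => y) fun _ => measurable_id) _
  · cases j
    · exact measurable_sample_indS T hS n i _
    · exact measurable_sample_A T n i
  · cases j
    · exact measurable_sample_indS T hS n i _
    · exact measurable_sample_observed T n i (g := fun d _ => toReal d) fun _ => measurable_const

lemma measurable_betaTwoS (n : ℕ) : Measurable fun ω => (T.sample S n ω).betaTwoS := by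
  refine measurable_ivEstimator (fun i j => ?_) (fun i j => ?_)
    (fun i => measurable_sample_observed T n i (g := fun _ y => y) fun _ => measurable_id) _
  · cases j
    · exact measurable_const
    · exact measurable_sample_A T n i
  · cases j
    · exact measurable_const
    · exact measurable_sample_observed T n i (g := fun d _ => toReal d) fun _ => measurable_const

lemma measurable_probSCHat (hS : ∀ s, MeasurableSet (S ⁻¹' {s})) (n : ℕ) (s : 𝒮) :
    Measurable fun ω => (T.sample S n ω).probSCHat s := by
  simp only [Sample.probSCHat, Sample.piD1Hat_eq, Sample.piD0Hat_eq]
  have hT := fun a => measurable_cellSum T hS n a s (g := fun d _ => toReal d)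
    fun _ => measurable_const
  have hN := fun a => measurable_cellSum T hS n a s (g := fun _ _ => 1) fun _ => measurable_const
  exact ((measurable_nS T hS n s).div_const _).mul
    (((hT true).div (hN true)).sub ((hT false).div (hN false)))

lemma measurable_betaSat (hS : ∀ s, MeasurableSet (S ⁻¹' {s})) (n : ℕ) :
    Measurable fun ω => (T.sample S n ω).betaSat :=
  Finset.measurable_sum _ fun s _ => ((measurable_probSCHat T hS n s).div
    (Finset.measurable_sum _ fun t _ => measurable_probSCHat T hS n t)).mul
    (measurable_betaSatStratum T hS n s)

end Measurability

/-! ### Asymptotic normality of contrasts of cell means -/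

/-- Slutsky: the product converges in distribution to 0, hence in probability. -/
lemma tendsto_mul_of_tendstoInDistribution {Ω Ω' : Type*} [MeasurableSpace Ω] [MeasurableSpace Ω']
    {P : Measure Ω} {P' : Measure Ω'} [IsProbabilityMeasure P] [IsProbabilityMeasure P']
    {a U : ℕ → Ω → ℝ} {Z : Ω' → ℝ} (ha : ∀ n, Measurable (a n)) (hU : ∀ n, Measurable (U n))
    (h : Tendsto (fun z : ℕ × Ω => a z.1 z.2) (probFilter P) (𝓝 0))
    (hd : TendstoInDistribution U atTop Z (fun _ => P) P') :
    Tendsto (fun z : ℕ × Ω => a z.1 z.2 * U z.1 z.2) (probFilter P) (𝓝 0) := by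
  refine tendsto_probFilter_of_tendstoInDistribution (X := fun n ω => a n ω * U n ω) (P' := P')
    (fun n => (ha n).mul (hU n)) ?_
  have := hd.continuous_comp_prodMk_of_tendstoInMeasure_const (g := fun p : ℝ × ℝ => p.2 * p.1)
    (by fun_prop) (tendsto_probFilter_iff.1 h) fun n => (ha n).aemeasurable
  simpa using this

section Normality

variable {𝒵 : Type u} [MeasurableSpace 𝒵] {Q : Measure (Participant 𝒵)} [IsProbabilityMeasure Q]
  {𝒮 : Type w} [Fintype 𝒮] [DecidableEq 𝒮] {S : 𝒵 → 𝒮} (T : Trial.{u, v} Q)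

/-- `n^(-1/2) ∑ I{A_i = a, S_i = s} (Y_i - β D_i - E[Y(D(a)) - β D(a) | S = s])` at the LATE. -/
def cellScore (S : 𝒵 → 𝒮) (n : ℕ) (a : Bool) (s : 𝒮) (ω : T.Ω) : ℝ :=
  (√n)⁻¹ * (T.sample S n ω).cellSum a s
    fun d y => netOutcome (late Q) d y + -netMean Q S (late Q) a s

/-- The difference of the two values of `netMean` at the LATE. -/
def netEffect (Q : Measure (Participant 𝒵)) (S : 𝒵 → 𝒮) (s : 𝒮) : ℝ :=
  netMean Q S (late Q) true s - netMean Q S (late Q) false s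

/-- The score of the strata frequencies. -/
def strataScore (S : 𝒵 → 𝒮) (n : ℕ) (ω : T.Ω) : ℝ :=
  √n * ∑ s, (T.sample S n ω).nS s / n * netEffect Q S s

lemma measurable_cellScore (hS : ∀ s, MeasurableSet (S ⁻¹' {s})) (n : ℕ) (a : Bool) (s : 𝒮) :
    Measurable (cellScore T S n a s) :=
  (measurable_cellSum T hS n a s
    fun d => (measurable_netOutcome _ d).add measurable_const).const_mul _

lemma measurable_strataScore (hS : ∀ s, MeasurableSet (S ⁻¹' {s})) (n : ℕ) :
    Measurable (strataScore T S n) :=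
  (Finset.measurable_sum _ fun s _ =>
    ((measurable_nS T hS n s).div_const _).mul_const _).const_mul _

/-- Regroups a sum over participants by cells, so that the central limit theorem speaks about linear
combinations of scores. -/
lemma sum_cellScore_add_strataScore (c : Bool → 𝒮 → ℝ) (k : ℝ) (n : ℕ) (ω : T.Ω) :
    (√n)⁻¹ * ∑ i, (c (T.A n ω i) (T.strata S n ω i) *
        (observed (netOutcome (late Q)) (T.A n ω i) (T.W n ω i) -
          netMean Q S (late Q) (T.A n ω i) (T.strata S n ω i))
        + k * netEffect Q S (T.strata S n ω i)) =
      ∑ s, ∑ a, c a s * cellScore T S n a s ω + k * strataScore T S n ω := by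
  have h1 : ∀ i, c (T.A n ω i) (T.strata S n ω i) *
        (observed (netOutcome (late Q)) (T.A n ω i) (T.W n ω i) -
          netMean Q S (late Q) (T.A n ω i) (T.strata S n ω i)) =
      ∑ s, ∑ a, c a s * (if T.A n ω i = a ∧ T.strata S n ω i = s then
        observed (netOutcome (late Q)) (T.A n ω i) (T.W n ω i) +
          -netMean Q S (late Q) a s else 0) := by
    intro i
    rw [Finset.sum_eq_single (T.strata S n ω i), Finset.sum_eq_single (T.A n ω i)]
    · simp [sub_eq_add_neg]
    · intro a _ ha
      simp [ha.symm]
    · simp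
    · intro s _ hs
      simp [hs.symm]
    · simp
  have h2 : ∑ i, netEffect Q S (T.strata S n ω i) =
      ∑ s, (T.sample S n ω).nS s * netEffect Q S s := by
    simp_rw [Trial.nS_eq, Finset.sum_mul]
    rw [Finset.sum_comm]
    simp
  rw [Finset.sum_add_distrib, ← Finset.mul_sum, h2, mul_add, strataScore]
  congr 1
  · simp_rw [h1]
    rw [Finset.sum_comm, Finset.mul_sum]
    refine Finset.sum_congr rfl fun s _ => ?_
    rw [Finset.sum_comm, Finset.mul_sum]
    refine Finset.sum_congr rfl fun a _ => ?_
    rw [← Finset.mul_sum, cellScore, Sample.cellSum]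
    exact mul_left_comm _ _ _
  · rw [← Real.sqrt_div_self]
    simp_rw [Finset.mul_sum]
    exact Finset.sum_congr rfl fun s _ => by ring

/-- Allowing arbitrary coefficients is the Cramér-Wold form of joint normality, with all scores
asymptotically uncorrelated: the limit variance is a sum of squares. -/
theorem tendstoInDistribution_scores (hS : ∀ s, MeasurableSet (S ⁻¹' {s}))
    (h1 : Assumption1 Q S) {pA : 𝒮 → ℝ} (h2 : Assumption2 T S pA) (c : Bool → 𝒮 → ℝ) (k : ℝ) :
    TendstoInDistribution
      (fun (n : ℕ) ω => ∑ s, ∑ a, c a s * cellScore T S n a s ω + k * strataScore T S n ω) atTop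
      (id : ℝ → ℝ) (fun _ => T.P)
      (gaussianReal 0 (cellMix Q S pA (fun a s => c a s ^ 2 * netVar Q S (late Q) a s)
        + ∑ s, Q.real (stratum S s) * (k * netEffect Q S s) ^ 2).toNNReal) := by
  have hp : ∀ s, IsProbabilityMeasure (cond Q (stratum S s)) := h1.isProbabilityMeasure_cond
  have hL := memLp_netOutcome (late Q) h1.second_moment
  let ψ : Bool → Participant 𝒵 → ℝ := fun a w => c a (S w.2.2) *
    (observed (netOutcome (late Q)) a w - netMean Q S (late Q) a (S w.2.2))
  have hψ : ∀ a, Measurable (ψ a) := fun a => (measurable_comp_stratum hS (c a)).mul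
    ((measurable_observed (measurable_netOutcome _) a).sub
      (measurable_comp_stratum hS (netMean Q S (late Q) a)))
  have hbdd : ∀ f : 𝒮 → ℝ, ∀ s, ‖f s‖ ≤ ∑ s, ‖f s‖ := fun f s =>
    Finset.single_le_sum (f := fun s => ‖f s‖) (fun s _ => norm_nonneg _) (Finset.mem_univ s)
  have hi : ∀ a, MemLp (ψ a) 2 Q := fun a => by
    have hd : MemLp (fun w : Participant 𝒵 => observed (netOutcome (late Q)) a w
        - netMean Q S (late Q) a (S w.2.2)) 2 Q :=
      (hL a).sub (MemLp.of_bound (measurable_comp_stratum hS _).aestronglyMeasurable _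
        (ae_of_all _ fun w => hbdd _ _))
    refine MemLp.of_le_mul (c := ∑ s, ‖c a s‖) hd (hψ a).aestronglyMeasurable
      (ae_of_all _ fun w => ?_)
    rw [norm_mul]
    exact mul_le_mul_of_nonneg_right (hbdd _ _) (norm_nonneg _)
  have hon : ∀ a s, ∀ᵐ w ∂(cond Q (stratum S s)), ψ a w =
      c a s * (observed (netOutcome (late Q)) a w - netMean Q S (late Q) a s) := fun a s => by
    filter_upwards [ae_cond_stratum hS s] with w hw
    simp only [ψ, hw]
  have h0 : ∀ a s, ∫ w, ψ a w ∂(cond Q (stratum S s)) = 0 := fun a s => by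
    have i1 := integrable_cond ((hL a).integrable (by norm_num)) (stratum S s)
    rw [integral_congr_ae (hon a s), integral_const_mul, integral_sub i1 (integrable_const _)]
    simp [netMean]
  have hsq : ∀ a s, ∫ w, ψ a w ^ 2 ∂(cond Q (stratum S s)) =
      c a s ^ 2 * netVar Q S (late Q) a s := fun a s => by
    have i1 := (integrable_cond ((hL a).integrable (by norm_num)) (stratum S s)).const_mul
      (2 * netMean Q S (late Q) a s)
    have i2 := integrable_cond (hL a).integrable_sq (stratum S s)
    have : ∀ᵐ w ∂(cond Q (stratum S s)), ψ a w ^ 2 = c a s ^ 2 *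
        (observed (netOutcome (late Q)) a w ^ 2
          - 2 * netMean Q S (late Q) a s * observed (netOutcome (late Q)) a w
          + netMean Q S (late Q) a s ^ 2) := by
      filter_upwards [hon a s] with w hw
      rw [hw]
      ring
    have i21 : Integrable (fun w => observed (netOutcome (late Q)) a w ^ 2
        - 2 * netMean Q S (late Q) a s * observed (netOutcome (late Q)) a w)
        (cond Q (stratum S s)) := i2.sub i1
    rw [integral_congr_ae this, integral_const_mul,
      integral_add i21 (integrable_const _), integral_sub i2 i1, integral_const_mul]
    simp only [netVar, integral_const, probReal_univ, one_smul, netMean]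
    ring
  -- The strata score is centred exactly because β is the LATE.
  have hh : ∑ s, Q.real (stratum S s) * (k * netEffect Q S s) = 0 := by
    have := h1.sum_netMean_sub hS
    rw [← mul_zero k, ← this, Finset.mul_sum]
    exact Finset.sum_congr rfl fun s _ => by rw [netEffect]; ring
  have := tendstoInDistribution_sum_assigned T hS h1 h2 hψ hi h0
    (h := fun s => k * netEffect Q S s) hh
  simp only [hsq] at this
  convert this using 3 with n ω
  exact (sum_cellScore_add_strataScore T c k n _).symm

end Normality

/-! ### Asymptotic variances of the IV estimators -/

/-- The sign of the cell `A = a` in treatment-control contrasts. -/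
def contrast (a : Bool) : ℝ := if a = true then 1 else -1

@[simp] lemma contrast_true : contrast true = 1 := rfl

@[simp] lemma contrast_false : contrast false = -1 := rfl

section Estimators

variable {𝒵 : Type u} [MeasurableSpace 𝒵] {Q : Measure (Participant 𝒵)} [IsProbabilityMeasure Q]
  {𝒮 : Type w} [Fintype 𝒮] [DecidableEq 𝒮] {S : 𝒵 → 𝒮} (T : Trial.{u, v} Q)

lemma Assumption1.netVar_nonneg (h1 : Assumption1 Q S) (β : ℝ) (a : Bool) (s : 𝒮) :
    0 ≤ netVar Q S β a s := by
  have := h1.isProbabilityMeasure_cond s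
  have h := variance_eq_sub (memLp_cond (memLp_netOutcome β h1.second_moment a) (stratum S s))
  have h0 := variance_nonneg (observed (netOutcome β) a) (cond Q (stratum S s))
  rw [h] at h0
  exact h0

lemma Assumption1.netEffect_eq (h1 : Assumption1 Q S) (hS : ∀ s, MeasurableSet (S ⁻¹' {s}))
    (s : 𝒮) : netEffect Q S s =
      ((primitives Q S s).piD1 - (primitives Q S s).piD0) * ((primitives Q S s).beta - late Q) :=
  h1.netMean_sub hS (late Q) s

/-- Identifies V_sat with the limit variance of the scores for the coefficients ±1/(share · P(C))
and 1/P(C). -/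
lemma Assumption2.Vsat_eq_cellMix (h1 : Assumption1 Q S) (hS : ∀ s, MeasurableSet (S ⁻¹' {s}))
    {pA : 𝒮 → ℝ} (h2 : Assumption2 T S pA) :
    Vsat (primitives Q S) (late Q) pA =
      cellMix Q S pA (fun a s => (contrast a / (share pA a s * probC (primitives Q S))) ^ 2
          * netVar Q S (late Q) a s)
        + ∑ s, Q.real (stratum S s) * ((probC (primitives Q S))⁻¹ * netEffect Q S s) ^ 2 := by
  rw [Vsat_eq, cellMix, ← Finset.sum_add_distrib, Finset.mul_sum]
  refine Finset.sum_congr rfl fun s _ => ?_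
  rw [h1.netEffect_eq hS, (h1.Pi_primitives hS _ s).1, (h1.Pi_primitives hS _ s).2]
  have hC := h1.probC_pos.ne'
  have ht := (h2.pA_mem s).1.ne'
  have hf : 1 - pA s ≠ 0 := (sub_pos.2 (h2.pA_mem s).2).ne'
  simp only [share, contrast_true, contrast_false, if_true, Bool.false_eq_true, if_false]
  rw [show (primitives Q S s).p = Q.real (stratum S s) from rfl]
  field_simp

lemma Assumption2.Vsat_nonneg (h1 : Assumption1 Q S) (hS : ∀ s, MeasurableSet (S ⁻¹' {s}))
    {pA : 𝒮 → ℝ} (h2 : Assumption2 T S pA) : 0 ≤ Vsat (primitives Q S) (late Q) pA := by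
  rw [h2.Vsat_eq_cellMix T h1 hS, cellMix]
  refine add_nonneg (Finset.sum_nonneg fun s _ => mul_nonneg measureReal_nonneg ?_)
    (Finset.sum_nonneg fun s _ => mul_nonneg measureReal_nonneg (sq_nonneg _))
  have ht := (h2.pA_mem s).1.le
  have hf : 0 ≤ 1 - pA s := sub_nonneg.2 (h2.pA_mem s).2.le
  have := h1.netVar_nonneg (late Q) true s
  have := h1.netVar_nonneg (late Q) false s
  positivity

lemma cellScore_eq (n : ℕ) (a : Bool) (s : 𝒮) (ω : T.Ω) :
    cellScore T S n a s ω = (√n)⁻¹ * ((T.sample S n ω).cellOutcome a s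
      - late Q * (T.sample S n ω).cellTreated a s
      - netMean Q S (late Q) a s * (T.sample S n ω).cellCount a s) := by
  rw [cellScore, Sample.cellOutcome, Sample.cellTreated, Sample.cellCount,
    ← Sample.cellSum_const_mul _ a s (late Q), ← Sample.cellSum_const_mul _ a s (netMean _ _ _ _ _)]
  congr 1
  rw [eq_sub_iff_add_eq, eq_sub_iff_add_eq, ← Sample.cellSum_add, ← Sample.cellSum_add]
  congr 1
  funext d y
  rw [netOutcome]
  ring

/-- An exact expansion without remainder estimates. Each cell mean of Y - β D is its expectation
plus a multiple of the cell score; the expectations, weighted by ± k n(s)/n, form the strata score,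
and the deviation of the weights from this pattern forms the middle sum. -/
lemma sqrt_mul_ratio_sub_late (n : ℕ) (ω : T.Ω) (v : Bool → 𝒮 → ℝ) (k : ℝ)
    (hN : ∀ a s, (T.sample S n ω).cellCount a s ≠ 0) (hn : (n : ℝ) ≠ 0)
    {B : ℝ} (hB : B = ∑ s, ∑ a, v a s * ((T.sample S n ω).cellTreated a s /
      (T.sample S n ω).cellCount a s)) (hB0 : B ≠ 0) :
    √n * ((∑ s, ∑ a, v a s * ((T.sample S n ω).cellOutcome a s /
      (T.sample S n ω).cellCount a s)) / B - late Q) =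
      ∑ s, ∑ a, v a s / ((T.sample S n ω).cellCount a s / n) / B * cellScore T S n a s ω
      + ∑ s, ∑ a, √n * (v a s - k * contrast a * ((T.sample S n ω).nS s / n))
        * (netMean Q S (late Q) a s / B) + k / B * strataScore T S n ω := by
  have hr : √(n : ℝ) ≠ 0 := Real.sqrt_ne_zero'.2 (lt_of_le_of_ne n.cast_nonneg hn.symm)
  have hr2 : (n : ℝ) = √n * √n := (Real.mul_self_sqrt n.cast_nonneg).symm
  have hsub : (∑ s, ∑ a, v a s * ((T.sample S n ω).cellOutcome a s /
      (T.sample S n ω).cellCount a s)) / B - late Q =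
      (∑ s, ∑ a, v a s * (((T.sample S n ω).cellOutcome a s
        - late Q * (T.sample S n ω).cellTreated a s) / (T.sample S n ω).cellCount a s)) / B := by
    rw [div_sub' hB0]
    congr 1
    nth_rw 1 [hB]
    rw [Finset.sum_mul, ← Finset.sum_sub_distrib]
    refine Finset.sum_congr rfl fun s _ => ?_
    rw [Finset.sum_mul, ← Finset.sum_sub_distrib]
    exact Finset.sum_congr rfl fun a _ => by ring
  rw [hsub, strataScore, Finset.sum_div, Finset.mul_sum, Finset.mul_sum, Finset.mul_sum,
    ← Finset.sum_add_distrib, ← Finset.sum_add_distrib]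
  refine Finset.sum_congr rfl fun s _ => ?_
  have hcell : ∀ a, √n * (v a s * (((T.sample S n ω).cellOutcome a s
        - late Q * (T.sample S n ω).cellTreated a s) / (T.sample S n ω).cellCount a s) / B) =
      v a s / ((T.sample S n ω).cellCount a s / n) / B * cellScore T S n a s ω
      + √n * (v a s - k * contrast a * ((T.sample S n ω).nS s / n))
        * (netMean Q S (late Q) a s / B)
      + k / B * (√n * ((T.sample S n ω).nS s / n)) * (contrast a * netMean Q S (late Q) a s) := by
    intro a
    rw [cellScore_eq]
    have := hN a s
    generalize (T.sample S n ω).nS s / (n : ℝ) = p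
    rw [div_div_eq_mul_div, show v a s * (n : ℝ) = v a s * (√n * √n) by rw [← hr2]]
    field_simp
    ring
  rw [Finset.sum_div, Finset.mul_sum, Finset.sum_congr rfl fun a _ => hcell a,
    Finset.sum_add_distrib, Finset.sum_add_distrib, ← Finset.mul_sum]
  simp only [Fintype.sum_bool, contrast_true, contrast_false, netEffect]
  ring

/-- A cell score is itself asymptotically normal: take the indicator of one cell as coefficients.
Hence a vanishing factor kills it. -/
lemma tendsto_mul_cellScore (hS : ∀ s, MeasurableSet (S ⁻¹' {s})) (h1 : Assumption1 Q S)
    {pA : 𝒮 → ℝ} (h2 : Assumption2 T S pA) (a : Bool) (s : 𝒮) {f : ℕ → T.Ω → ℝ}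
    (hf : ∀ n, Measurable (f n))
    (h : Tendsto (fun z : ℕ × T.Ω => f z.1 z.2) (probFilter T.P) (𝓝 0)) :
    Tendsto (fun z : ℕ × T.Ω => f z.1 z.2 * cellScore T S z.1 a s z.2) (probFilter T.P) (𝓝 0) := by
  refine tendsto_mul_of_tendstoInDistribution (U := fun n => cellScore T S n a s) hf
    (fun n => measurable_cellScore T hS n a s) h ?_ (Z := id)
    (P' := gaussianReal 0 (cellMix Q S pA
        (fun a' s' => (if a' = a ∧ s' = s then 1 else 0) ^ 2 * netVar Q S (late Q) a' s')
        + ∑ s, Q.real (stratum S s) * (0 * netEffect Q S s) ^ 2).toNNReal)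
  have := tendstoInDistribution_scores T hS h1 h2 (fun a' s' => if a' = a ∧ s' = s then 1 else 0) 0
  convert this using 3 with n ω
  rw [Finset.sum_eq_single s, Finset.sum_eq_single a]
  · simp
  · intro a' _ ha
    simp [ha]
  · simp
  · intro s' _ hs
    simp [hs]
  · simp

lemma tendsto_mul_strataScore (hS : ∀ s, MeasurableSet (S ⁻¹' {s})) (h1 : Assumption1 Q S)
    {pA : 𝒮 → ℝ} (h2 : Assumption2 T S pA) {f : ℕ → T.Ω → ℝ} (hf : ∀ n, Measurable (f n))
    (h : Tendsto (fun z : ℕ × T.Ω => f z.1 z.2) (probFilter T.P) (𝓝 0)) :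
    Tendsto (fun z : ℕ × T.Ω => f z.1 z.2 * strataScore T S z.1 z.2) (probFilter T.P) (𝓝 0) := by
  have := tendstoInDistribution_scores T hS h1 h2 (fun _ _ => 0) 1
  simp only [zero_mul, Finset.sum_const_zero, zero_add, one_mul] at this
  exact tendsto_mul_of_tendstoInDistribution (U := fun n => strataScore T S n) hf
    (fun n => measurable_strataScore T hS n) h this

/-- The limit law does not depend on k or on the particular weights, only on their agreement with ±
k n(s)/n up to o_p(n^{-1/2}). This is why SAT, SFE and 2S share one variance. The ratio formula is
required only on regular samples with nonzero denominator, which have probability tending to one. -/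
theorem hasAsymptoticVariance_of_contrast (hS : ∀ s, MeasurableSet (S ⁻¹' {s}))
    (h1 : Assumption1 Q S) {pA : 𝒮 → ℝ} (h2 : Assumption2 T S pA)
    {b : (n : ℕ) → Sample 𝒮 n → ℝ} (hb : ∀ n, Measurable fun ω => b n (T.sample S n ω))
    {v : (n : ℕ) → Sample 𝒮 n → Bool → 𝒮 → ℝ}
    (hv : ∀ n a s, Measurable fun ω => v n (T.sample S n ω) a s) {k : ℝ} (hk : k ≠ 0)
    (hbal : ∀ a s, Tendsto (fun z : ℕ × T.Ω => √z.1 * (v z.1 (T.sample S z.1 z.2) a s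
      - k * contrast a * ((T.sample S z.1 z.2).nS s / z.1))) (probFilter T.P) (𝓝 0))
    (heq : ∀ (n : ℕ) (x : Sample 𝒮 n), x.Regular →
      (∑ s, ∑ a, v n x a s * (x.cellTreated a s / x.cellCount a s)) ≠ 0 →
      b n x = (∑ s, ∑ a, v n x a s * (x.cellOutcome a s / x.cellCount a s)) /
        ∑ s, ∑ a, v n x a s * (x.cellTreated a s / x.cellCount a s)) :
    T.HasAsymptoticVariance S b (late Q) (Vsat (primitives Q S) (late Q) pA) := by
  refine ⟨h2.Vsat_nonneg T h1 hS, ?_⟩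
  have hC := h1.probC_pos.ne'
  set C := probC (primitives Q S) with hCdef
  let B : (n : ℕ) → T.Ω → ℝ := fun n ω => ∑ s, ∑ a, v n (T.sample S n ω) a s *
    ((T.sample S n ω).cellTreated a s / (T.sample S n ω).cellCount a s)
  have hN : ∀ n a s, Measurable fun ω => (T.sample S n ω).cellCount a s := fun n a s =>
    measurable_cellSum T hS n a s (g := fun _ _ => 1)
    fun _ => measurable_const
  have hT : ∀ n a s, Measurable fun ω => (T.sample S n ω).cellTreated a s := fun n a s =>
    measurable_cellSum T hS n a s (g := fun d _ => toReal d)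
    fun _ => measurable_const
  have hBm : ∀ n, Measurable (B n) := fun n => Finset.measurable_sum _ fun s _ =>
    Finset.measurable_sum _ fun a _ => (hv n a s).mul ((hT n a s).div (hN n a s))
  have hreg := eventually_regular T hS h1 h2
  have hn := eventually_natCast_ne_zero T
  have hsqrt : Tendsto (fun z : ℕ × T.Ω => (√(z.1 : ℝ))⁻¹) (probFilter T.P) (𝓝 0) :=
    ((tendsto_inv_atTop_zero.comp Real.tendsto_sqrt_atTop).comp
      tendsto_natCast_atTop_atTop).comp tendsto_fst_probFilter
  have hvlim : ∀ a s, Tendsto (fun z : ℕ × T.Ω => v z.1 (T.sample S z.1 z.2) a s)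
      (probFilter T.P) (𝓝 (k * contrast a * Q.real (stratum S s))) := fun a s => by
    have h := (hsqrt.mul (hbal a s)).add ((tendsto_nS_div T hS s).const_mul (k * contrast a))
    rw [zero_mul, zero_add] at h
    refine h.congr' ?_
    filter_upwards [hn] with z hz
    have hr : √(z.1 : ℝ) ≠ 0 :=
      Real.sqrt_ne_zero'.2 (lt_of_le_of_ne (Nat.cast_nonneg _) hz.symm)
    rw [inv_mul_cancel_left₀ hr, sub_add_cancel]
  have hB : Tendsto (fun z : ℕ × T.Ω => B z.1 z.2) (probFilter T.P) (𝓝 (k * C)) := by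
    have h := tendsto_finsetSum Finset.univ fun s (_ : s ∈ Finset.univ) =>
      tendsto_finsetSum Finset.univ fun a (_ : a ∈ Finset.univ) =>
        (hvlim a s).mul (tendsto_cellTreated_div_count T hS h1 h2 a s)
    convert h using 2
    rw [hCdef, probC, Finset.mul_sum]
    refine Finset.sum_congr rfl fun s _ => ?_
    simp only [Fintype.sum_bool, contrast_true, contrast_false, primitives]
    ring
  have hkC : k * C ≠ 0 := mul_ne_zero hk hC
  have hmain := tendstoInDistribution_scores T hS h1 h2 (fun a s => contrast a / (share pA a s * C)) C⁻¹
  rw [← h2.Vsat_eq_cellMix T h1 hS] at hmain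
  refine tendstoInDistribution_of_tendstoInMeasure_sub _ _ hmain (tendsto_probFilter_iff.1 ?_)
    fun n => (((hb n).sub_const _).const_mul _).aemeasurable
  -- The random coefficients of the cell scores converge to those of the limit, so the difference is
  -- negligible by Slutsky.
  have r1 : Tendsto (fun z : ℕ × T.Ω => ∑ s, ∑ a, (v z.1 (T.sample S z.1 z.2) a s /
      ((T.sample S z.1 z.2).cellCount a s / z.1) / B z.1 z.2 - contrast a / (share pA a s * C)) *
      cellScore T S z.1 a s z.2) (probFilter T.P) (𝓝 (∑ s : 𝒮, ∑ a : Bool, 0)) := by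
    refine tendsto_finsetSum _ fun s _ => tendsto_finsetSum _ fun a _ => ?_
    refine tendsto_mul_cellScore T hS h1 h2 a s (f := fun n ω => v n (T.sample S n ω) a s /
      ((T.sample S n ω).cellCount a s / n) / B n ω - contrast a / (share pA a s * C))
      (fun n => (((hv n a s).div ((hN n a s).div_const _)).div (hBm n)).sub_const _) ?_
    have hsh := (h2.share_pos T a s).ne'
    have hst := (h1.stratum_pos s).ne'
    have h := (((hvlim a s).div (tendsto_cellCount_div T hS h1 h2 a s)
      (mul_ne_zero hst hsh)).div hB hkC).sub_const (contrast a / (share pA a s * C))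
    rwa [show k * contrast a * Q.real (stratum S s) / (Q.real (stratum S s) * share pA a s) /
      (k * C) - contrast a / (share pA a s * C) = 0 by field_simp; ring] at h
  -- The imbalance term, where the n^{-1/2} rate of the weights is used.
  have r2 : Tendsto (fun z : ℕ × T.Ω => ∑ s, ∑ a, √z.1 * (v z.1 (T.sample S z.1 z.2) a s
      - k * contrast a * ((T.sample S z.1 z.2).nS s / z.1)) *
      (netMean Q S (late Q) a s / B z.1 z.2)) (probFilter T.P)
      (𝓝 (∑ s : 𝒮, ∑ a : Bool, 0 * (netMean Q S (late Q) a s / (k * C)))) :=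
    tendsto_finsetSum _ fun s _ => tendsto_finsetSum _ fun a _ =>
      (hbal a s).mul (tendsto_const_nhds.div hB hkC)
  have r3 : Tendsto (fun z : ℕ × T.Ω => (k / B z.1 z.2 - C⁻¹) * strataScore T S z.1 z.2)
      (probFilter T.P) (𝓝 0) := by
    refine tendsto_mul_strataScore T hS h1 h2 (f := fun n ω => k / B n ω - C⁻¹)
      (fun n => ((hBm n).const_div _).sub_const _) ?_
    have h := ((tendsto_const_nhds (x := k)).div hB hkC).sub_const C⁻¹
    rwa [show k / (k * C) - C⁻¹ = 0 by field_simp; ring] at h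
  have r := (r1.add r2).add r3
  simp only [zero_mul, Finset.sum_const_zero, add_zero] at r
  refine r.congr' ?_
  filter_upwards [hreg, hn, hB.eventually_ne hkC] with z hz hzn hzB
  simp only [Pi.sub_apply]
  rw [heq z.1 _ hz hzB, sqrt_mul_ratio_sub_late T z.1 z.2 (v z.1 (T.sample S z.1 z.2)) k
    (fun a s => (hz.count_pos a s).ne') hzn (B := B z.1 z.2) rfl hzB]
  simp only [sub_mul, Finset.sum_sub_distrib]
  ring

/-- The SAT weights are ± n(s)/n without error, so no balance beyond consistency of the propensities
is needed. -/
theorem hasAsymptoticVariance_betaSat (hS : ∀ s, MeasurableSet (S ⁻¹' {s}))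
    (h1 : Assumption1 Q S) {pA : 𝒮 → ℝ} (h2 : Assumption2 T S pA) :
    T.HasAsymptoticVariance S (fun _ x => x.betaSat) (late Q)
      (Vsat (primitives Q S) (late Q) pA) := by
  refine hasAsymptoticVariance_of_contrast T hS h1 h2 (measurable_betaSat T hS)
    (v := fun n x a s => contrast a * (x.nS s / n)) (k := 1)
    (fun n a s => ((measurable_nS T hS n s).div_const _).const_mul _) one_ne_zero
    (fun a s => ?_) (fun n x hx _ => ?_)
  · simpa using tendsto_const_nhds
  · rw [hx.betaSat_eq, Sample.probCHat]
    simp only [Sample.probSCHat, Sample.piD1Hat_eq, Sample.piD0Hat_eq, Fintype.sum_bool,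
      contrast_true, contrast_false]
    congr 1 <;> exact Finset.sum_congr rfl fun s _ => by ring

lemma Sample.Regular.cellCount_eq {n : ℕ} {x : Sample 𝒮 n} (hx : x.Regular) (s : 𝒮) :
    x.cellCount true s = x.nA s / x.nS s * x.nS s ∧
      x.cellCount false s = (1 - x.nA s / x.nS s) * x.nS s := by
  have h := div_mul_cancel₀ (x.nA s) (hx.nS_pos s).ne'
  refine ⟨by rw [h, x.nA_eq_cellCount], ?_⟩
  rw [sub_mul, h, one_mul, x.nA_eq_cellCount, x.nS_eq_cellCount, add_sub_cancel_left]

/-- The weights of the strata fixed effects estimator. -/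
def Sample.sfeWeight {n : ℕ} (x : Sample 𝒮 n) (a : Bool) (s : 𝒮) : ℝ :=
  contrast a * (x.nS s / n * (x.nA s / x.nS s * (1 - x.nA s / x.nS s)))

lemma Sample.Regular.withinSum_eq {n : ℕ} {x : Sample 𝒮 n} (hx : x.Regular)
    (f : Bool → 𝒮 → ℝ) : x.withinSum f =
      n * ∑ s, ∑ a, x.sfeWeight a s * (f a s / x.cellCount a s) := by
  rw [Sample.withinSum, Finset.mul_sum]
  refine Finset.sum_congr rfl fun s _ => ?_
  have hn := hx.natCast_ne_zero s
  have ht := hx.count_pos true s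
  have hf := hx.count_pos false s
  have hs := hx.nS_pos s
  obtain ⟨et, ef⟩ := hx.cellCount_eq s
  rw [et] at ht
  rw [ef] at hf
  simp only [Fintype.sum_bool, Sample.sfeWeight, contrast_true, contrast_false, et, ef]
  generalize x.nA s / x.nS s = q at *
  have hq := (pos_of_mul_pos_left ht hs.le).ne'
  have hq' := (pos_of_mul_pos_left hf hs.le).ne'
  field_simp
  ring

/-- The weights of the two sample estimator. -/
def Sample.twoSWeight {n : ℕ} (x : Sample 𝒮 n) (a : Bool) (s : 𝒮) : ℝ :=
  (toReal a - x.assignedShare) * (x.cellCount a s / n)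

lemma Sample.Regular.totalSum_eq_weight {n : ℕ} {x : Sample 𝒮 n} (hx : x.Regular)
    (f : Bool → 𝒮 → ℝ) : x.totalSum f =
      n * ∑ s, ∑ a, x.twoSWeight a s * (f a s / x.cellCount a s) := by
  rw [Sample.totalSum, Finset.mul_sum]
  refine Finset.sum_congr rfl fun s _ => ?_
  have hn := hx.natCast_ne_zero s
  have ht := (hx.count_pos true s).ne'
  have hf := (hx.count_pos false s).ne'
  simp only [Fintype.sum_bool, Sample.twoSWeight, toReal_true, toReal_false]
  field_simp
  ring

/-- The propensities of the strata approach `pA` faster than `n^(-1/2)`. -/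
def StrongBalance (S : 𝒵 → 𝒮) (pA : ℝ) : Prop :=
  ∀ s, Tendsto (fun z : ℕ × T.Ω => √z.1 * ((T.sample S z.1 z.2).nA s / (T.sample S z.1 z.2).nS s
    - pA)) (probFilter T.P) (𝓝 0)

/-- With q = n_A(s)/n(s) the error of the weight is ± (n(s)/n)(q - π_A)(1 - q - π_A), which inherits
the fast rate of q. -/
theorem hasAsymptoticVariance_betaSfe (hS : ∀ s, MeasurableSet (S ⁻¹' {s}))
    (h1 : Assumption1 Q S) {pA : ℝ} (h2 : Assumption2 T S fun _ => pA)
    (hbal : StrongBalance T S pA) (hpA : pA ∈ Set.Ioo (0 : ℝ) 1) :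
    T.HasAsymptoticVariance S (fun _ x => x.betaSfe) (late Q)
      (Vsat (primitives Q S) (late Q) fun _ => pA) := by
  refine hasAsymptoticVariance_of_contrast T hS h1 h2 (measurable_betaSfe T hS)
    (v := fun n x a s => x.sfeWeight a s) (k := pA * (1 - pA))
    (fun n a s => ?_) (mul_pos hpA.1 (sub_pos.2 hpA.2)).ne' (fun a s => ?_) (fun n x hx hne => ?_)
  · have hq := (measurable_nA T hS n s).div (measurable_nS T hS n s)
    exact (((measurable_nS T hS n s).div_const _).mul (hq.mul (hq.const_sub 1))).const_mul _
  · have hq := tendsto_probFilter_iff.2 (h2.propensity s)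
    have h := ((tendsto_nS_div T hS s).const_mul (contrast a)).mul
      (((hq.const_sub 1).sub_const pA).mul (hbal s))
    rw [mul_zero, mul_zero] at h
    refine h.congr fun z => ?_
    rw [Sample.sfeWeight]
    ring
  -- Without strata the denominator is an empty sum, contradicting `hne`; a stratum is needed to see
  -- that n is nonzero.
  · rcases isEmpty_or_nonempty 𝒮 with h𝒮 | ⟨⟨s⟩⟩
    · simp at hne
    have hn := hx.natCast_ne_zero s
    rw [hx.betaSfe_eq (by rw [hx.withinSum_eq]; exact mul_ne_zero hn hne), hx.withinSum_eq,
      hx.withinSum_eq, mul_div_mul_left _ _ hn]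

/-- The overall share of assigned participants is an average of the stratum shares, hence also
converges to π_A faster than n^{-1/2}. The error of each weight is a combination of these two small
deviations. -/
theorem hasAsymptoticVariance_betaTwoS (hS : ∀ s, MeasurableSet (S ⁻¹' {s}))
    (h1 : Assumption1 Q S) {pA : ℝ} (h2 : Assumption2 T S fun _ => pA)
    (hbal : StrongBalance T S pA) (hpA : pA ∈ Set.Ioo (0 : ℝ) 1) :
    T.HasAsymptoticVariance S (fun _ x => x.betaTwoS) (late Q)
      (Vsat (primitives Q S) (late Q) fun _ => pA) := by
  have hreg := eventually_regular T hS h1 h2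
  have hnz := eventually_natCast_ne_zero T
  have hq := fun s => tendsto_probFilter_iff.2 (h2.propensity s)
  have hA : Tendsto (fun z : ℕ × T.Ω => √z.1 * ((T.sample S z.1 z.2).assignedShare - pA))
      (probFilter T.P) (𝓝 0) := by
    have h := tendsto_finsetSum Finset.univ fun s (_ : s ∈ Finset.univ) =>
      (tendsto_nS_div T hS s).mul (hbal s)
    simp only [mul_zero, Finset.sum_const_zero] at h
    refine h.congr' ?_
    filter_upwards [hreg, hnz] with z hz hn
    have hsum : ∑ s, (T.sample S z.1 z.2).nS s / z.1 = 1 := by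
      rw [← Finset.sum_div, div_eq_one_iff_eq hn, Sample.natCast_eq_sum_cellCount
        (T.sample S z.1 z.2), ← Finset.sum_add_distrib]
      exact Finset.sum_congr rfl fun s _ => Sample.nS_eq_cellCount _ s
    have hshare : (T.sample S z.1 z.2).assignedShare = ∑ s, (T.sample S z.1 z.2).nS s / z.1 *
        ((T.sample S z.1 z.2).nA s / (T.sample S z.1 z.2).nS s) := by
      rw [Sample.assignedShare, Finset.sum_div]
      refine Finset.sum_congr rfl fun s _ => ?_
      rw [(hz.cellCount_eq s).1]
      ring
    have hdiff : (T.sample S z.1 z.2).assignedShare - pA = ∑ s, (T.sample S z.1 z.2).nS s / z.1 *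
        ((T.sample S z.1 z.2).nA s / (T.sample S z.1 z.2).nS s - pA) := by
      simp_rw [mul_sub]
      rw [Finset.sum_sub_distrib, ← Finset.sum_mul, hsum, one_mul, hshare]
    rw [hdiff, Finset.mul_sum]
    exact Finset.sum_congr rfl fun s _ => by ring

  have hA' : Tendsto (fun z : ℕ × T.Ω => (T.sample S z.1 z.2).assignedShare)
      (probFilter T.P) (𝓝 (∑ s, Q.real (stratum S s) * share (fun _ => pA) true s)) := by
    refine (tendsto_finsetSum Finset.univ fun s _ =>
      tendsto_cellCount_div T hS h1 h2 true s).congr fun z => ?_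
    rw [Sample.assignedShare, Finset.sum_div]
  refine hasAsymptoticVariance_of_contrast T hS h1 h2 (measurable_betaTwoS T)
    (v := fun n x a s => x.twoSWeight a s) (k := pA * (1 - pA))
    (fun n a s => ?_) (mul_pos hpA.1 (sub_pos.2 hpA.2)).ne' (fun a s => ?_) (fun n x hx hne => ?_)
  · have hN : ∀ a s, Measurable fun ω => (T.sample S n ω).cellCount a s := fun a s =>
      measurable_cellSum T hS n a s (g := fun _ _ => 1) fun _ => measurable_const
    exact (((Finset.measurable_sum _ fun s _ => hN true s).div_const _).const_sub _).mul
      ((hN a s).div_const _)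
  · have hp := tendsto_nS_div T hS s
    cases a
    · have h := hp.mul (((hbal s).const_mul pA).sub (hA.mul ((hq s).const_sub 1)))
      simp only [mul_zero, zero_mul, sub_zero] at h
      refine h.congr' ?_
      filter_upwards [hreg] with z hz
      rw [Sample.twoSWeight, (hz.cellCount_eq s).2]
      simp only [toReal_false, contrast_false]
      ring
    · have h := hp.mul (((hbal s).mul (hA'.const_sub 1)).sub (hA.const_mul pA))
      simp only [mul_zero, zero_mul, sub_zero] at h
      refine h.congr' ?_
      filter_upwards [hreg] with z hz
      rw [Sample.twoSWeight, (hz.cellCount_eq s).1]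
      simp only [toReal_true, contrast_true]
      ring
  · rcases isEmpty_or_nonempty 𝒮 with h𝒮 | ⟨⟨s⟩⟩
    · simp at hne
    have hn := hx.natCast_ne_zero s
    rw [Sample.betaTwoS_eq hn (by rw [hx.totalSum_eq_weight]; exact mul_ne_zero hn hne),
      hx.totalSum_eq_weight, hx.totalSum_eq_weight, mul_div_mul_left _ _ hn]

/-! ### Vanishing imbalance -/

lemma integral_eval_pi_gaussianReal_zero {f : ℝ → ℝ} (hf : Continuous f) (s : 𝒮) :
    ∫ y : 𝒮 → ℝ, f (y s) ∂(Measure.pi fun _ => gaussianReal 0 0) = f 0 := by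
  have h := (measurePreserving_eval (fun _ : 𝒮 => gaussianReal 0 0) s).map_eq
  have hi := integral_map (μ := Measure.pi fun _ : 𝒮 => gaussianReal 0 0)
    (measurable_pi_apply s).aemeasurable (f := f) hf.aestronglyMeasurable
  rw [h, gaussianReal_zero_var, integral_dirac] at hi
  rw [gaussianReal_zero_var]
  exact hi.symm

/-- For τ = 0 the limit law is the point mass at 0. Testing against min(1, |y_s|) gives conditional
expectations that tend to 0 in probability; being bounded, they also do so in mean, and the tower
property removes the conditioning. -/
lemma Assumption3.strongBalance (hS : ∀ s, MeasurableSet (S ⁻¹' {s})) {pA : ℝ}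
    (h3 : Assumption3 T S pA fun _ => 0) : StrongBalance T S pA := by
  intro s
  let X : ℕ → T.Ω → ℝ := fun n ω =>
    √n * ((T.sample S n ω).nA s / (T.sample S n ω).nS s - pA)
  have hX : ∀ n, Measurable (X n) := fun n =>
    (((measurable_nA T hS n s).div (measurable_nS T hS n s)).sub_const _).const_mul _
  have hmin : ∀ x : ℝ, ‖min 1 |x|‖ ≤ 1 := fun x => by
    rw [Real.norm_of_nonneg (le_min zero_le_one (abs_nonneg x))]
    exact min_le_left _ _
  let f : BoundedContinuousFunction (𝒮 → ℝ) ℝ := BoundedContinuousFunction.ofNormedAddCommGroup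
    (fun y => min 1 |y s|) (by fun_prop) 1 fun y => hmin _
  have h := tendsto_probFilter_iff.2 (h3.normal f)
  have hf0 : ∫ y, f y ∂(Measure.pi fun s =>
      gaussianReal 0 ((0 : ℝ) * pA * (1 - pA) / Q.real (stratum S s)).toNNReal) = 0 := by
    simp only [zero_mul, zero_div, Real.toNNReal_zero]
    exact (integral_eval_pi_gaussianReal_zero (f := fun x => min 1 |x|) (by fun_prop) s).trans
      (by simp)
  rw [hf0] at h
  refine tendsto_probFilter_of_integral_min (X := X) hX ?_
  simp only [sub_zero]
  let G : ℕ → T.Ω → ℝ := fun n ω =>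
    ∫ ω', min 1 |X n ω'| ∂(cond T.P {ω' | T.strata S n ω' = T.strata S n ω})
  have hG : ∀ n ω, ‖G n ω‖ ≤ 1 := fun n ω => by
    by_cases h0 : T.P {ω' | T.strata S n ω' = T.strata S n ω} = 0
    · simp [G, cond_eq_zero_of_meas_eq_zero h0]
    · have := cond_isProbabilityMeasure h0
      refine (norm_integral_le_of_norm_le_const (ae_of_all _ fun ω' => hmin _)).trans ?_
      simp
  have hGm : ∀ n, Measurable (G n) := fun n => measurable_strata_comp T hS n fun _ σ =>
    ∫ ω', min 1 |X n ω'| ∂(cond T.P {ω' | T.strata S n ω' = σ})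
  -- Bounded convergence in probability, obtained from the complex lemma with constant factor 1 and
  -- limit 0.
  have hlim := tendsto_integral_mul_sub_of_probFilter (P := T.P) (G := fun _ _ => 1)
    (B := fun n ω => (G n ω : ℂ)) (c := 0) (fun _ => aestronglyMeasurable_const)
    (fun n => (Complex.measurable_ofReal.comp (hGm n)).aestronglyMeasurable) (by simp)
    (fun n ω => by rw [Complex.norm_real]; exact hG n ω)
    (by exact_mod_cast (Complex.continuous_ofReal.tendsto 0).comp h)
  simp only [one_mul, zero_mul, sub_zero, integral_complex_ofReal] at hlim
  have hre := (Complex.continuous_re.tendsto 0).comp hlim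
  refine hre.congr fun n => ?_
  refine integral_integral_cond_strata T hS n (F := fun ω => min 1 |X n ω|) ?_
  have := hX n
  exact Integrable.of_bound (C := 1) (by fun_prop) (ae_of_all _ fun ω => hmin _)

lemma StrongBalance.assumption2 {pA : ℝ} (hbal : StrongBalance T S pA) (hci : T.CondIndep S)
    (hpA : pA ∈ Set.Ioo (0 : ℝ) 1) : Assumption2 T S fun _ => pA := by
  refine ⟨hci, fun _ => hpA, fun s => tendsto_probFilter_iff.1 ?_⟩
  have hsqrt : Tendsto (fun z : ℕ × T.Ω => (√(z.1 : ℝ))⁻¹) (probFilter T.P) (𝓝 0) :=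
    ((tendsto_inv_atTop_zero.comp Real.tendsto_sqrt_atTop).comp
      tendsto_natCast_atTop_atTop).comp tendsto_fst_probFilter
  have h := (hsqrt.mul (hbal s)).add_const pA
  rw [zero_mul, zero_add] at h
  refine h.congr' ?_
  filter_upwards [eventually_natCast_ne_zero T] with z hz
  have hr : √(z.1 : ℝ) ≠ 0 :=
    Real.sqrt_ne_zero'.2 (lt_of_le_of_ne (Nat.cast_nonneg _) hz.symm)
  rw [inv_mul_cancel_left₀ hr, sub_add_cancel]

end Estimators

end LATE
end

/-! ### The three statements combined. -/

theorem mainTheorem12 {𝒵 : Type u} [MeasurableSpace 𝒵] {𝒮 : Type w} [Fintype 𝒮] [DecidableEq 𝒮]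
    (Q : Measure (LATE.Participant 𝒵)) [IsProbabilityMeasure Q]
    (S : 𝒵 → 𝒮) (hS : ∀ s, MeasurableSet (S ⁻¹' {s})) (h1 : LATE.Assumption1 Q S) :
    -- stratum-specific propensities: the asymptotic variance of the SAT IV estimator ...
    ((∀ (pA : 𝒮 → ℝ) (T : LATE.Trial.{u, v} Q), LATE.Assumption2 T S pA →
        T.HasAsymptoticVariance S (fun _ x => x.betaSat) (LATE.late Q)
          (LATE.Vsat (LATE.primitives Q S) (LATE.late Q) pA)) ∧
      -- ... and its unique minimizer
      ((∀ s, 0 < LATE.Pi1 (LATE.primitives Q S s) (LATE.late Q) ∧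
          0 < LATE.Pi2 (LATE.primitives Q S s) (LATE.late Q)) →
        (∀ s, LATE.optPropensity (LATE.primitives Q S s) (LATE.late Q) ∈ Set.Ioo (0 : ℝ) 1) ∧
        ∀ pA : 𝒮 → ℝ, (∀ s, pA s ∈ Set.Ioo (0 : ℝ) 1) →
          pA ≠ (fun s => LATE.optPropensity (LATE.primitives Q S s) (LATE.late Q)) →
          LATE.Vsat (LATE.primitives Q S) (LATE.late Q)
              (fun s => LATE.optPropensity (LATE.primitives Q S s) (LATE.late Q)) <
            LATE.Vsat (LATE.primitives Q S) (LATE.late Q) pA)) ∧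
    -- constant propensities with `τ = 0`: the asymptotic variances of all three estimators ...
    ((∀ (pA : ℝ) (T : LATE.Trial.{u, v} Q), LATE.Assumption3 T S pA (fun _ => 0) →
        T.HasAsymptoticVariance S (fun _ x => x.betaSat) (LATE.late Q)
          (LATE.Vsat (LATE.primitives Q S) (LATE.late Q) fun _ => pA) ∧
        T.HasAsymptoticVariance S (fun _ x => x.betaSfe) (LATE.late Q)
          (LATE.Vsat (LATE.primitives Q S) (LATE.late Q) fun _ => pA) ∧
        T.HasAsymptoticVariance S (fun _ x => x.betaTwoS) (LATE.late Q)
          (LATE.Vsat (LATE.primitives Q S) (LATE.late Q) fun _ => pA)) ∧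
      -- ... and the unique minimizer
      (0 < ∑ s, (LATE.primitives Q S s).p * LATE.Pi1 (LATE.primitives Q S s) (LATE.late Q) →
        0 < ∑ s, (LATE.primitives Q S s).p * LATE.Pi2 (LATE.primitives Q S s) (LATE.late Q) →
        LATE.optConstPropensity (LATE.primitives Q S) (LATE.late Q) ∈ Set.Ioo (0 : ℝ) 1 ∧
        ∀ pA ∈ Set.Ioo (0 : ℝ) 1,
          pA ≠ LATE.optConstPropensity (LATE.primitives Q S) (LATE.late Q) →
          LATE.Vsat (LATE.primitives Q S) (LATE.late Q)
              (fun _ => LATE.optConstPropensity (LATE.primitives Q S) (LATE.late Q)) <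
            LATE.Vsat (LATE.primitives Q S) (LATE.late Q) (fun _ => pA))) ∧
    -- consistency of the plug-in estimators computed from the data of a pilot trial
    (∀ (pP : 𝒮 → ℝ) (T : LATE.Trial.{u, v} Q), LATE.Assumption2 T S pP →
      (∀ s, 0 < LATE.Pi1 (LATE.primitives Q S s) (LATE.late Q) →
        TendstoInMeasure T.P (fun n ω => (T.sample S n ω).optPropensityHat s) atTop
          (fun _ => LATE.optPropensity (LATE.primitives Q S s) (LATE.late Q))) ∧
      (0 < ∑ s, (LATE.primitives Q S s).p * LATE.Pi1 (LATE.primitives Q S s) (LATE.late Q) →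
        TendstoInMeasure T.P (fun n ω => (T.sample S n ω).optConstPropensityHat) atTop
          (fun _ => LATE.optConstPropensity (LATE.primitives Q S) (LATE.late Q)))) := by
  have hp : ∀ s, 0 < (LATE.primitives Q S s).p := h1.stratum_pos
  refine ⟨⟨fun pA T h2 => LATE.hasAsymptoticVariance_betaSat T hS h1 h2, fun h =>
    ⟨fun s => LATE.optimum_mem_Ioo (h s).1 (h s).2, fun pA hpA hne =>
      LATE.Vsat_optPropensity_lt hp h1.probC_pos h hpA hne⟩⟩,
    ⟨fun pA T h3 => ?_, fun ha hb => ⟨LATE.optimum_mem_Ioo ha hb, fun pA hpA hne =>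
      LATE.Vsat_optConstPropensity_lt h1.probC_pos ha hb hpA hne⟩⟩,
    fun pP T h2 => ⟨fun s hs => LATE.tendsto_probFilter_iff.1
      (LATE.tendsto_optPropensityHat T hS h1 h2 s hs), fun hs => LATE.tendsto_probFilter_iff.1
      (LATE.tendsto_optConstPropensityHat T hS h1 h2 hs)⟩⟩
  -- Strong balance implies convergence of the propensities, so everything proved under
  -- `Assumption2` applies to the constant propensity.
  have hbal := h3.strongBalance T hS
  have h2 := hbal.assumption2 T h3.condIndep h3.pA_mem
  exact ⟨LATE.hasAsymptoticVariance_betaSat T hS h1 h2,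
    LATE.hasAsymptoticVariance_betaSfe T hS h1 h2 hbal h3.pA_mem,
    LATE.hasAsymptoticVariance_betaTwoS T hS h1 h2 hbal h3.pA_mem⟩
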